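/- Let $k$ be a field with $\operatorname{char}(k)\neq 2$, let $R$ be a commutative $k$-algebra, and let $L$ be a (finitely generated) projective $R$-module of constant rank $1$. Let $A=R\oplus L$ be the commutative $k$-algebra with multiplication $(r,x)(s,y)=(rs,\,ry+sx)$, so that $L$ is a square-zero ideal of $A$ with $A/L=R$. For a commutative $k$-algebra $B$, let $C_*(B)$ be the Hochschild complex over $k$, i.e. $C_n(B)=B^{\otimes_k(n+1)}$ with boundary $$b(b_0\otimes\cdots\otimes b_n)=\sum_{i=0}^{n-1}(-1)^i\, b_0\otimes\cdots\otimes b_ib_{i+1}\otimes\cdots\otimes b_n+(-1)^n\, b_nb_0\otimes b_1\otimes\cdots\otimes b_{n-1},$$ and let $HH_n(B)=H_n(C_*(B))$. Let $HH_n(A,L)$ be the relative Hochschild homology, i.e. the $n$-th homology of the kernel of $C_*(A)\to C_*(A/L)$. All these are $R$-modules, $R$ acting by multiplication on the zeroth tensor factor. For $p\ge 0$ put $$M_p=\begin{cases}L^{\otimes_R(p+1)} & p \text{ even},\\ L^{\otimes_R p} & p\text{ odd}.\end{cases}$$ Then for every $n\ge 0$ there is an isomorphism of $R$-modules $$HH_n(A,L)\;\cong\;\bigoplus_{p+q=n}M_p\otimes_R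 HH_q(R).$$ -/

import Mathlib

open CategoryTheory
open scoped TensorProduct DirectSum

universe u

noncomputable section

namespace Hochschild

section Push

variable (k : Type u) [CommRing k] (A : Type u) [CommRing A] [Algebra k A]

theorem prod_fiber_update {A : Type u} [CommRing A] {ι κ : Type} [Fintype ι] [DecidableEq ι]
    [DecidableEq κ] (φ : ι → κ) (a : ι → A) (x : ι) (v : A) :
    (fun j => ∏ y with φ y = j, Function.update a x v y) =
      Function.update (fun j => ∏ y with φ y = j, a y) (φ x)
        (v * ∏ y ∈ ({y | φ y = φ x} : Finset ι) \ {x}, a y) := by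
  funext j
  by_cases h : j = φ x
  · subst h
    rw [Function.update_self, Finset.prod_update_of_mem (by simp)]
  · rw [Function.update_of_ne h, Finset.prod_update_of_notMem]
    simpa using fun h' => h h'.symm

/-- For a map `φ : ι → κ` of finite sets, the `k`-linear map `A^{⊗ ι} → A^{⊗ κ}` which sends
`⊗_x a_x` to `⊗_j (∏_{φ x = j} a_x)`. -/
def push {ι κ : Type} [Fintype ι] [DecidableEq κ] (φ : ι → κ) :
    (⨂[k] _ : ι, A) →ₗ[k] (⨂[k] _ : κ, A) :=
  PiTensorProduct.lift
    { toFun := fun a => PiTensorProduct.tprod k (fun j => ∏ x with φ x = j, a x)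
      map_update_add' := fun a x v w => by
        simp only [prod_fiber_update, add_mul, MultilinearMap.map_update_add]
      map_update_smul' := fun a x c v => by
        simp only [prod_fiber_update, smul_mul_assoc, MultilinearMap.map_update_smul] }

theorem push_tprod {ι κ : Type} [Fintype ι] [DecidableEq κ] (φ : ι → κ) (a : ι → A) :
    push k A φ (PiTensorProduct.tprod k a) =
      PiTensorProduct.tprod k (fun j => ∏ x with φ x = j, a x) := by
  simp [push]

theorem push_push {ι κ τ : Type} [Fintype ι] [Fintype κ] [DecidableEq κ]
    [DecidableEq τ] (φ : ι → κ) (ψ : κ → τ) (x : ⨂[k] _ : ι, A) :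
    push k A ψ (push k A φ x) = push k A (ψ ∘ φ) x := by
  classical
  have : push k A ψ ∘ₗ push k A φ = push k A (ψ ∘ φ) := by
    ext a
    simp only [LinearMap.compMultilinearMap_apply, LinearMap.comp_apply, push_tprod]
    congr 1
    funext j
    rw [← Finset.prod_fiberwise_of_maps_to (s := {x | (ψ ∘ φ) x = j})
      (t := {y | ψ y = j}) (g := φ) (by simp)]
    refine Finset.prod_congr rfl fun y hy => Finset.prod_congr ?_ fun _ _ => rfl
    ext x
    simp only [Finset.mem_filter, Finset.mem_univ, true_and, Function.comp_apply] at hy ⊢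
    constructor
    · rintro rfl; exact ⟨hy, rfl⟩
    · exact fun h => h.2
  exact LinearMap.congr_fun this x

theorem push_mul {ι κ : Type} [Fintype ι] [DecidableEq κ] (φ : ι → κ)
    (a : ι → A) (x : ⨂[k] _ : ι, A) :
    push k A φ (PiTensorProduct.tprod k a * x) =
      push k A φ (PiTensorProduct.tprod k a) * push k A φ x := by
  have : push k A φ ∘ₗ LinearMap.mulLeft k (PiTensorProduct.tprod k a) =
      LinearMap.mulLeft k (push k A φ (PiTensorProduct.tprod k a)) ∘ₗ push k A φ := by
    ext b
    simp only [LinearMap.compMultilinearMap_apply, LinearMap.comp_apply, LinearMap.mulLeft_apply,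
      PiTensorProduct.tprod_mul_tprod, push_tprod]
    congr 1
    funext j
    simp [Finset.prod_mul_distrib]
  exact LinearMap.congr_fun this x

end Push

section Chains

variable (k : Type u) [CommRing k] (A : Type u) [CommRing A] [Algebra k A]

/-- The Hochschild `n`-chains `C_n(A) = A ⊗_k A ⊗_k ⋯ ⊗_k A` (`n + 1` factors, indexed by
`0, …, n`) of a commutative `k`-algebra `A`. -/
def Chain (n : ℕ) : Type u := ⨂[k] _ : Fin (n + 1), A

instance (n : ℕ) : CommRing (Chain k A n) :=
  inferInstanceAs (CommRing (⨂[k] _ : Fin (n + 1), A))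

/-- The pure tensor `a_0 ⊗ a_1 ⊗ ⋯ ⊗ a_n`. -/
def Chain.tprod {n : ℕ} (a : Fin (n + 1) → A) : Chain k A n :=
  PiTensorProduct.tprod k a

variable (S : Type u) [CommRing S] [Algebra S A]

/-- If `A` is an `S`-algebra, then `S` acts on `C_n(A)` through the factor `a_0`. -/
instance (n : ℕ) : Module S (Chain k A n) :=
  Module.compHom (Chain k A n)
    ((show A →+* Chain k A n from (PiTensorProduct.singleAlgHom (R := k)
      (A := fun _ : Fin (n + 1) => A) 0).toRingHom).comp (algebraMap S A))

variable {S} in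
theorem Chain.smul_def {n : ℕ} (s : S) (x : Chain k A n) :
    s • x = Chain.tprod k A (Pi.mulSingle 0 (algebraMap S A s)) * x := rfl

variable {S} in
theorem Chain.smul_tprod {n : ℕ} (s : S) (a : Fin (n + 1) → A) :
    s • Chain.tprod k A a = Chain.tprod k A (Function.update a 0 (s • a 0)) := by
  rw [Chain.smul_def]
  refine (PiTensorProduct.tprod_mul_tprod _ _).trans (congrArg _ ?_)
  funext j
  by_cases h : j = 0
  · subst h; simp [Algebra.smul_def]
  · simp [h]

/-- The map on indices which underlies the `i`-th face map `C_{n+1}(A) → C_n(A)`: for `i ≤ n` it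
is the weakly increasing surjection which identifies `i` and `i + 1`, and for `i = n + 1` it
sends `n + 1` to `0` and fixes `0, …, n`. -/
def faceIdx {n : ℕ} (i : Fin (n + 2)) (x : Fin (n + 2)) : Fin (n + 1) :=
  Fin.ofNat (n + 1) (if x ≤ i then (x : ℕ) else x - 1)

theorem faceIdx_zero {n : ℕ} (i : Fin (n + 2)) : faceIdx i 0 = 0 := by
  simp [faceIdx]

theorem faceIdx_val_of_le {n : ℕ} (i x : Fin (n + 2)) (h : x ≤ i) (hx : (x : ℕ) < n + 1) :
    (faceIdx i x : ℕ) = x := by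
  simp [faceIdx, h, Nat.mod_eq_of_lt hx]

theorem faceIdx_val_of_lt {n : ℕ} (i x : Fin (n + 2)) (h : i < x) :
    (faceIdx i x : ℕ) = x - 1 := by
  have : (x : ℕ) - 1 < n + 1 := by omega
  simp [faceIdx, not_le.2 h, Nat.mod_eq_of_lt this]

theorem faceIdx_last {n : ℕ} : faceIdx (Fin.last (n + 1)) (Fin.last (n + 1)) = 0 := by
  ext; simp [faceIdx]

theorem faceIdx_faceIdx {n : ℕ} (i j : Fin (n + 2)) (h : i ≤ j) :
    faceIdx i ∘ faceIdx j.succ = faceIdx j ∘ faceIdx i.castSucc := by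
  funext x
  ext
  obtain ⟨i, hi⟩ := i
  obtain ⟨j, hj⟩ := j
  obtain ⟨x, hx⟩ := x
  rcases Nat.lt_or_ge x (n + 2) with hx' | hx'
  · have h1 : x % (n + 1 + 1) = x := Nat.mod_eq_of_lt hx'
    have h2 : (x - 1) % (n + 1 + 1) = x - 1 := Nat.mod_eq_of_lt (by omega)
    simp only [faceIdx, Function.comp_apply, Fin.ofNat, Fin.le_def, Fin.val_succ,
      Fin.val_castSucc] at h ⊢
    split_ifs <;> simp only [h1, h2] at * <;> omega
  · obtain rfl : x = n + 2 := by omega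
    simp only [faceIdx, Function.comp_apply, Fin.ofNat, Fin.le_def, Fin.val_succ,
      Fin.val_castSucc] at h ⊢
    have h1 : (n + 2) % (n + 1 + 1) = 0 := Nat.mod_self _
    have h2 : (n + 2 - 1) % (n + 1 + 1) = n + 1 := Nat.mod_eq_of_lt (by omega)
    split_ifs <;> simp only [h1, h2, Nat.mod_self, Nat.zero_mod] at * <;> omega

/-- The `i`-th face map `d_i : C_{n+1}(A) → C_n(A)`. It sends `a_0 ⊗ ⋯ ⊗ a_{n+1}` to
`a_0 ⊗ ⋯ ⊗ a_i a_{i+1} ⊗ ⋯ ⊗ a_{n+1}` for `i ≤ n` and to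
`a_{n+1} a_0 ⊗ a_1 ⊗ ⋯ ⊗ a_n` for `i = n + 1`; see `face_castSucc_tprod`, `face_last_tprod`. -/
def face {n : ℕ} (i : Fin (n + 2)) : Chain k A (n + 1) →ₗ[S] Chain k A n where
  toFun := push k A (faceIdx i)
  map_add' := map_add _
  map_smul' := fun s x => by
    refine (push_mul k A (faceIdx i) _ _).trans (congrArg (· * push k A (faceIdx i) x) ?_)
    refine (push_tprod k A _ _).trans (congrArg (PiTensorProduct.tprod k) ?_)
    simp only [MonoidHom.mulSingle_apply, Pi.mulSingle, prod_fiber_update]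
    simp [faceIdx_zero]
    rfl

theorem face_castSucc_tprod {n : ℕ} (i : Fin (n + 1)) (a : Fin (n + 2) → A) :
    face k A S i.castSucc (Chain.tprod k A a) =
      Chain.tprod k A (i.castSucc.contractNth (· * ·) a) := by
  refine (push_tprod k A _ _).trans (congrArg (PiTensorProduct.tprod k) ?_)
  funext j
  have key (x : Fin (n + 2)) : faceIdx i.castSucc x = j ↔
      ((x : ℕ) ≤ i ∧ (x : ℕ) = j) ∨ ((i : ℕ) < x ∧ (x : ℕ) = j + 1) := by
    rw [Fin.ext_iff]
    rcases le_or_gt x i.castSucc with h | h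
    · have h' : (x : ℕ) ≤ i := h
      rw [faceIdx_val_of_le _ _ h (by omega)]
      omega
    · have h' : (i : ℕ) < x := h
      rw [faceIdx_val_of_lt _ _ h]
      omega
  simp only [key]
  rcases lt_trichotomy (j : ℕ) i with h | h | h
  · have : ({x | ((x : ℕ) ≤ i ∧ (x : ℕ) = j) ∨ ((i : ℕ) < x ∧ (x : ℕ) = j + 1)} :
        Finset (Fin (n + 2))) = {j.castSucc} := by
      ext x
      simp only [Finset.mem_filter, Finset.mem_univ, true_and, Finset.mem_singleton, Fin.ext_iff,
        Fin.val_castSucc]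
      omega
    rw [this, Finset.prod_singleton, Fin.contractNth_apply_of_lt _ _ _ _ h]
  · have : ({x | ((x : ℕ) ≤ i ∧ (x : ℕ) = j) ∨ ((i : ℕ) < x ∧ (x : ℕ) = j + 1)} :
        Finset (Fin (n + 2))) = {j.castSucc, j.succ} := by
      ext x
      simp only [Finset.mem_filter, Finset.mem_univ, true_and, Finset.mem_singleton, Fin.ext_iff,
        Fin.val_castSucc, Finset.mem_insert, Fin.val_succ]
      omega
    rw [this, Finset.prod_pair (by simp [Fin.ext_iff]), Fin.contractNth_apply_of_eq _ _ _ _ h]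
  · have : ({x | ((x : ℕ) ≤ i ∧ (x : ℕ) = j) ∨ ((i : ℕ) < x ∧ (x : ℕ) = j + 1)} :
        Finset (Fin (n + 2))) = {j.succ} := by
      ext x
      simp only [Finset.mem_filter, Finset.mem_univ, true_and, Finset.mem_singleton, Fin.ext_iff,
        Fin.val_succ]
      omega
    rw [this, Finset.prod_singleton, Fin.contractNth_apply_of_gt _ _ _ _ h]

theorem face_last_tprod {n : ℕ} (a : Fin (n + 2) → A) :
    face k A S (Fin.last (n + 1)) (Chain.tprod k A a) =
      Chain.tprod k A
        (Fin.cons (a (Fin.last (n + 1)) * a 0) fun j : Fin n => a j.castSucc.succ) := by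
  refine (push_tprod k A _ _).trans (congrArg (PiTensorProduct.tprod k) ?_)
  have key (x : Fin (n + 2)) (j : Fin (n + 1)) : faceIdx (Fin.last (n + 1)) x = j ↔
      ((x : ℕ) = j) ∨ ((x : ℕ) = n + 1 ∧ (j : ℕ) = 0) := by
    rw [Fin.ext_iff]
    rcases Nat.lt_or_ge x (n + 1) with h | h
    · rw [faceIdx_val_of_le _ _ (Fin.le_last x) h]
      omega
    · obtain rfl : x = Fin.last (n + 1) := Fin.ext (by simp; omega)
      rw [faceIdx_last]
      have h0 : ((0 : Fin (n + 1)) : ℕ) = 0 := rfl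
      have hl : ((Fin.last (n + 1) : Fin (n + 2)) : ℕ) = n + 1 := rfl
      omega
  funext j
  simp only [key]
  refine Fin.cases ?_ (fun j => ?_) j
  · have : ({x | ((x : ℕ) = (0 : Fin (n + 1))) ∨ ((x : ℕ) = n + 1 ∧ ((0 : Fin (n + 1)) : ℕ) = 0)} :
        Finset (Fin (n + 2))) = {Fin.last (n + 1), 0} := by
      ext x
      simp only [Finset.mem_filter, Finset.mem_univ, true_and, Finset.mem_singleton, Fin.ext_iff,
        Finset.mem_insert, Fin.val_zero, Fin.val_last, and_true]
      exact or_comm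
    rw [this, Finset.prod_pair (by simp [Fin.ext_iff]), Fin.cons_zero]
  · have : ({x | ((x : ℕ) = j.succ) ∨ ((x : ℕ) = n + 1 ∧ (j.succ : ℕ) = 0)} :
        Finset (Fin (n + 2))) = {j.castSucc.succ} := by
      ext x
      simp only [Finset.mem_filter, Finset.mem_univ, true_and, Finset.mem_singleton, Fin.ext_iff,
        Fin.val_succ, Fin.val_castSucc]
      omega
    rw [this, Finset.prod_singleton, Fin.cons_succ]

theorem face_face {n : ℕ} (i j : Fin (n + 2)) (h : i ≤ j) (x : Chain k A (n + 2)) :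
    face k A S i (face k A S j.succ x) = face k A S j (face k A S i.castSucc x) := by
  refine (push_push k A _ _ _).trans (Eq.trans ?_ (push_push k A _ _ _).symm)
  rw [faceIdx_faceIdx i j h]

/-- The Hochschild boundary `b = ∑_{i=0}^{n+1} (-1)^i d_i : C_{n+1}(A) → C_n(A)`. -/
def b (n : ℕ) : Chain k A (n + 1) →ₗ[S] Chain k A n :=
  ∑ i : Fin (n + 2), (-1 : ℤ) ^ (i : ℕ) • face k A S i

theorem b_b (n : ℕ) : b k A S n ∘ₗ b k A S (n + 1) = 0 := by
  ext x
  simp only [b, LinearMap.comp_apply, LinearMap.sum_apply, LinearMap.smul_apply, map_sum,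
    map_zsmul, LinearMap.zero_apply, Finset.smul_sum, smul_smul]
  rw [← Finset.sum_product', Finset.univ_product_univ]
  let P : Finset (Fin (n + 3) × Fin (n + 2)) := {ij | (ij.1 : ℕ) ≤ ij.2}
  rw [← Finset.sum_add_sum_compl P, ← eq_neg_iff_add_eq_zero, ← Finset.sum_neg_distrib]
  refine Finset.sum_bij (fun ij hij => (ij.2.succ,
    ij.1.castLT (lt_of_le_of_lt (Finset.mem_filter.mp hij).2 ij.2.is_lt))) ?_ ?_ ?_ ?_
  · rintro ⟨i, j⟩ hij
    simp only [P, Finset.mem_filter, Finset.mem_univ, true_and, Finset.mem_compl,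
      Fin.val_succ, Fin.val_castLT] at hij ⊢
    omega
  · rintro ⟨i, j⟩ hij ⟨i', j'⟩ hij' h
    simp only [Prod.mk.injEq, Fin.ext_iff, Fin.val_succ, Fin.val_castLT] at h ⊢
    omega
  · rintro ⟨i, j⟩ hij
    simp only [P, Finset.mem_filter, Finset.mem_univ, true_and, Finset.mem_compl] at hij
    refine ⟨(j.castSucc, i.pred (by rintro rfl; simp at hij)), ?_, ?_⟩
    · simp only [P, Finset.mem_filter, Finset.mem_univ, true_and, Fin.val_castSucc, Fin.val_pred]
      omega
    · simp
  · rintro ⟨i, j⟩ hij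
    simp only [P, Finset.mem_filter, Finset.mem_univ, true_and] at hij
    have h := face_face k A S (i.castLT (lt_of_le_of_lt hij j.is_lt)) j hij x
    rw [Fin.castSucc_castLT] at h
    simp only [h, ← neg_smul, Fin.val_succ, Fin.val_castLT]
    congr 1
    ring

/-- The Hochschild complex `C_*(A)` of the commutative `k`-algebra `A`, as a complex of
`S`-modules for an `S`-algebra structure on `A`. -/
def complex : ChainComplex (ModuleCat.{u} S) ℕ :=
  ChainComplex.of (fun n => ModuleCat.of S (Chain k A n)) (fun n => ModuleCat.ofHom (b k A S n))
    (fun n => by rw [← ModuleCat.ofHom_comp, b_b]; rfl)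

/-- Hochschild homology `HH_n(A) = HH_n(A/k)`, as an `S`-module. -/
def HH (n : ℕ) : ModuleCat.{u} S := (complex k A S).homology n

end Chains

section Relative

variable (k : Type u) [CommRing k] {S : Type u} [CommRing S] [Algebra k S]
  {A B : Type u} [CommRing A] [Algebra k A] [Algebra S A] [IsScalarTower k S A]
  [CommRing B] [Algebra k B] [Algebra S B] [IsScalarTower k S B]

/-- The map `C_n(A) → C_n(B)`, `a_0 ⊗ ⋯ ⊗ a_n ↦ f a_0 ⊗ ⋯ ⊗ f a_n`, induced by an algebra map
`f : A → B`. -/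
def chainMap (f : A →ₐ[S] B) (n : ℕ) : Chain k A n →ₗ[S] Chain k B n where
  toFun := PiTensorProduct.map fun _ : Fin (n + 1) => (f.restrictScalars k).toLinearMap
  map_add' := map_add _
  map_smul' := fun s x => by
    have h : (PiTensorProduct.map fun _ : Fin (n + 1) => (f.restrictScalars k).toLinearMap) ∘ₗ
          LinearMap.mulLeft k (PiTensorProduct.tprod k (Pi.mulSingle 0 (algebraMap S A s))) =
        LinearMap.mulLeft k (PiTensorProduct.tprod k (Pi.mulSingle 0 (algebraMap S B s))) ∘ₗ
          PiTensorProduct.map fun _ : Fin (n + 1) => (f.restrictScalars k).toLinearMap := by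
      ext a
      simp only [LinearMap.compMultilinearMap_apply, LinearMap.comp_apply,
        LinearMap.mulLeft_apply, PiTensorProduct.tprod_mul_tprod, PiTensorProduct.map_tprod]
      congr 1
      funext j
      by_cases hj : j = 0
      · subst hj; simp
      · simp [hj]
    exact LinearMap.congr_fun h x

theorem chainMap_tprod (f : A →ₐ[S] B) {n : ℕ} (a : Fin (n + 1) → A) :
    chainMap k f n (Chain.tprod k A a) = Chain.tprod k B (fun j => f (a j)) :=
  PiTensorProduct.map_tprod _ _

theorem face_chainMap (f : A →ₐ[S] B) {n : ℕ} (i : Fin (n + 2)) (x : Chain k A (n + 1)) :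
    chainMap k f n (face k A S i x) = face k B S i (chainMap k f (n + 1) x) := by
  have h : (PiTensorProduct.map fun _ : Fin (n + 1) => (f.restrictScalars k).toLinearMap) ∘ₗ
        push k A (faceIdx i) = push k B (faceIdx i) ∘ₗ
      PiTensorProduct.map fun _ : Fin (n + 2) => (f.restrictScalars k).toLinearMap := by
    ext a
    simp only [LinearMap.compMultilinearMap_apply, LinearMap.comp_apply, push_tprod,
      PiTensorProduct.map_tprod]
    congr 1
    funext j
    simp
  exact LinearMap.congr_fun h x

theorem b_chainMap (f : A →ₐ[S] B) (n : ℕ) :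
    chainMap k f n ∘ₗ b k A S n = b k B S n ∘ₗ chainMap k f (n + 1) := by
  ext x
  simp only [b, LinearMap.comp_apply, LinearMap.sum_apply, LinearMap.smul_apply, map_sum,
    map_zsmul, face_chainMap]

/-- The map of Hochschild complexes `C_*(A) → C_*(B)` induced by `f : A → B`. -/
def complexMap (f : A →ₐ[S] B) : complex k A S ⟶ complex k B S :=
  ChainComplex.ofHom (X := complex k A S) (Y := complex k B S)
    (fun n => ModuleCat.ofHom (chainMap k f n)) (fun n => by
      simp only [complex, ChainComplex.of_d]
      exact (ModuleCat.ofHom_comp _ _).symm.trans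
        ((congrArg ModuleCat.ofHom (b_chainMap k f n).symm).trans (ModuleCat.ofHom_comp _ _)))

variable (S) in
/-- The relative Hochschild complex `C_*(A, I)` of an ideal `I` of `A`: the kernel of
`C_*(A) → C_*(A/I)`. -/
def relComplex (I : Ideal A) : ChainComplex (ModuleCat.{u} S) ℕ :=
  Limits.kernel (complexMap k (Ideal.Quotient.mkₐ S I))

variable (S) in
/-- Relative Hochschild homology `HH_n(A, I)` over `k`: the homology of `C_*(A, I)`. -/
def relHH (I : Ideal A) (n : ℕ) : ModuleCat.{u} S := (relComplex k S I).homology n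

end Relative

/-- The `R`-module `M_p`: `L^{⊗ (p + 1)}` if `p` is even, and `L^{⊗ p}` if `p` is odd, where
tensor powers are taken over `R`. -/
abbrev oddPower (R : Type u) [CommRing R] (L : Type u) [AddCommGroup L] [Module R L] (p : ℕ) :
    Type u :=
  ⨂[R]^(if Even p then p + 1 else p) L

end Hochschild
end

/-! Write ρ for the projection of A = R ⊕ L onto R and ν = 1 - ρ, and work in the subcomplex of
C_*(A) killed by ρ. Counting factors in L gives each chain a parity; b preserves parity, and as 2 is
invertible the complex is the sum of its even and odd parts. Chains with a_0 in L form a subcomplex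
N. The operator P (`headProj`), which is ρ on a_0, identifies the quotient by N with the chains
having a_0 in R, under the differential Pb. Here P fails to be a chain map by [b, P] = F + G, where
F multiplies ν(a_1) into a_0 and G multiplies the signed last factor ±ν(a_n) into a_0
(`b_headProj`).

Rank one enters through l(x)y = l(y)x for functionals l on L. By this identity the functionals of a
dual basis of L extend to derivations D_i of A twisted by the involution `sgn` = ρ - ν. Inserting
D_i at each factor in turn while multiplying a_0 by the dual basis element e_i gives an operator h
with [b, h] = F - G ∘ parity (`Frame.b_homotopy`). On odd chains [b, P - h] = 0, so the odd part is
the direct sum of N and the quotient. On even chains the connecting map F + G is homotopic to 2F.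

The map F induces an isomorphism from degree n + 1 of the homology of the reduced quotient (a_0 in
R, killed by ρ) to degree n of that of N (`reducedEquiv`). Indeed the extra degeneracy contracts the
kernel of F up to a cyclic shift, and this shift is nilpotent on reduced chains. Hence the even part
is acyclic, and only the odd part contributes.

It remains to count. Splitting off a_0 shows that the homology of N in parity ε is L tensored with
that of the quotient in parity -ε. The odd quotient is already reduced; the even one is C_*(R) plus
its reduced part. So the relative homology X_n satisfies X_{n+2} = L ⊗ HH_{n+2}(R) ⊕ L ⊗ HH_{n+1}(R)
⊕ L ⊗ L ⊗ X_n, the recursion that comes from M_0 = M_1 = L and M_{p+2} = L ⊗ L ⊗ M_p. -/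

noncomputable section

namespace Hochschild

/-! ### Operators acting factor by factor on Hochschild chains -/

section SlotMap

variable (k : Type u) [CommRing k] {R : Type u} [CommRing R] [Algebra k R]
  {A : Type u} [CommRing A] [Algebra k A] [Algebra R A] [IsScalarTower k R A]

/-- Scalars of k can be absorbed into factor 0, so pure tensors generate additively. This matters
because the R-structure on chains is not the k-structure of the tensor product: maps are compared as
additive maps first. -/
theorem Chain.induction {n : ℕ} {p : Chain k A n → Prop} (x : Chain k A n)
    (tprod : ∀ a, p (Chain.tprod k A a)) (add : ∀ x y, p x → p y → p (x + y)) : p x := by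
  refine PiTensorProduct.induction_on (motive := p) x (fun r f => ?_) (fun x y => add x y)
  have h := MultilinearMap.map_update_smul (PiTensorProduct.tprod k) f 0 r (f 0)
  rw [Function.update_eq_self] at h
  exact h ▸ tprod (Function.update f 0 (r • f 0))

theorem Chain.tprod_update_add {n : ℕ} (a : Fin (n + 1) → A) (i : Fin (n + 1)) (u v : A) :
    Chain.tprod k A (Function.update a i (u + v)) =
      Chain.tprod k A (Function.update a i u) + Chain.tprod k A (Function.update a i v) :=
  MultilinearMap.map_update_add (PiTensorProduct.tprod k) _ _ _ _

theorem Chain.tprod_update_sum {n : ℕ} {ι : Type*} (s : Finset ι) (a : Fin (n + 1) → A)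
    (i : Fin (n + 1)) (u : ι → A) :
    Chain.tprod k A (Function.update a i (∑ t ∈ s, u t)) =
      ∑ t ∈ s, Chain.tprod k A (Function.update a i (u t)) :=
  MultilinearMap.map_update_sum (PiTensorProduct.tprod k (s := fun _ : Fin (n + 1) => A)) s i u a

theorem Chain.tprod_eq_zero {n : ℕ} {a : Fin (n + 1) → A} {i : Fin (n + 1)} (h : a i = 0) :
    Chain.tprod k A a = 0 :=
  MultilinearMap.map_coord_zero (PiTensorProduct.tprod k) i h

theorem Chain.addHom_ext {n : ℕ} {M : Type*} [AddCommGroup M] {f g : Chain k A n →+ M}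
    (h : ∀ a, f (Chain.tprod k A a) = g (Chain.tprod k A a)) : f = g := by
  ext x
  refine Chain.induction k (p := fun x => f x = g x) x h fun x y hx hy => ?_
  rw [map_add, map_add, hx, hy]

omit [Algebra k R] [IsScalarTower k R A] in
theorem Chain.linearMap_ext {n : ℕ} {M : Type*} [AddCommGroup M] [Module R M]
    {f g : Chain k A n →ₗ[R] M}
    (h : ∀ a, f (Chain.tprod k A a) = g (Chain.tprod k A a)) : f = g := by
  ext x
  refine Chain.induction k (p := fun x => f x = g x) x h fun x y hx hy => ?_
  rw [map_add, map_add, hx, hy]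

/-- The additive map `C_n(A) → C_m(A)` with prescribed values, multilinear in the tensor factors,
on pure tensors. -/
def Chain.lift {n m : ℕ}
    (f : MultilinearMap k (fun _ : Fin (n + 1) => A) (⨂[k] _ : Fin (m + 1), A)) :
    Chain k A n →+ Chain k A m :=
  (PiTensorProduct.lift f).toAddMonoidHom

theorem Chain.lift_tprod {n m : ℕ}
    (f : MultilinearMap k (fun _ : Fin (n + 1) => A) (⨂[k] _ : Fin (m + 1), A))
    (a : Fin (n + 1) → A) : Chain.lift k f (Chain.tprod k A a) = f a :=
  PiTensorProduct.lift.tprod (φ := f) a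

/-- An additive map between chains is linear if it is so on pure tensors. -/
def Chain.linearOfTprod {n m : ℕ} (f : Chain k A n →+ Chain k A m)
    (h : ∀ (s : R) a, f (s • Chain.tprod k A a) = s • f (Chain.tprod k A a)) :
    Chain k A n →ₗ[R] Chain k A m where
  toFun := f
  map_add' := f.map_add
  map_smul' s x := by
    refine Chain.induction k (p := fun x => f (s • x) = s • f x) x (h s) fun x y hx hy => ?_
    rw [smul_add, map_add, hx, hy, map_add, smul_add]

/-- The endomorphism `a_0 ⊗ ⋯ ⊗ a_n ↦ f_0 a_0 ⊗ ⋯ ⊗ f_n a_n` of `C_n(A)`. -/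
def slotMap {n : ℕ} (f : Fin (n + 1) → A →ₗ[R] A) : Chain k A n →ₗ[R] Chain k A n :=
  Chain.linearOfTprod k (Chain.lift k
      ((PiTensorProduct.tprod k).compLinearMap fun i => (f i).restrictScalars k)) fun s a => by
    rw [Chain.smul_tprod, Chain.lift_tprod, Chain.lift_tprod]
    refine Eq.trans ?_ (Chain.smul_tprod k A s fun i => f i (a i)).symm
    refine congrArg (Chain.tprod k A) ?_
    funext j
    by_cases h : j = 0
    · subst h; simp
    · simp [h]

theorem slotMap_tprod {n : ℕ} (f : Fin (n + 1) → A →ₗ[R] A) (a : Fin (n + 1) → A) :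
    slotMap k f (Chain.tprod k A a) = Chain.tprod k A (fun i => f i (a i)) :=
  Chain.lift_tprod k ((PiTensorProduct.tprod k).compLinearMap fun i => (f i).restrictScalars k) a

theorem slotMap_slotMap {n : ℕ} (f g : Fin (n + 1) → A →ₗ[R] A) (x : Chain k A n) :
    slotMap k f (slotMap k g x) = slotMap k (fun i => f i ∘ₗ g i) x := by
  have : slotMap k f ∘ₗ slotMap k g = slotMap k (fun i => f i ∘ₗ g i) :=
    Chain.linearMap_ext k fun a => by simp [slotMap_tprod]
  exact LinearMap.congr_fun this x

theorem slotMap_id {n : ℕ} (x : Chain k A n) :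
    slotMap k (fun _ => (LinearMap.id : A →ₗ[R] A)) x = x := by
  have : slotMap k (fun _ : Fin (n + 1) => (LinearMap.id : A →ₗ[R] A)) = LinearMap.id :=
    Chain.linearMap_ext k fun a => by simp [slotMap_tprod]
  exact LinearMap.congr_fun this x

theorem slotMap_eq_zero {n : ℕ} {f : Fin (n + 1) → A →ₗ[R] A} {i : Fin (n + 1)} (h : f i = 0)
    (x : Chain k A n) : slotMap k f x = 0 := by
  have : slotMap k f = 0 :=
    Chain.linearMap_ext k fun a => by
      rw [slotMap_tprod]
      exact Chain.tprod_eq_zero k (i := i) (by simp [h])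
  exact LinearMap.congr_fun this x

theorem slotMap_update_sum {n : ℕ} {ι : Type*} (s : Finset ι) (f : Fin (n + 1) → A →ₗ[R] A)
    (i : Fin (n + 1)) (u : ι → A →ₗ[R] A) (x : Chain k A n) :
    slotMap k (Function.update f i (∑ t ∈ s, u t)) x =
      ∑ t ∈ s, slotMap k (Function.update f i (u t)) x := by
  have key (g : A →ₗ[R] A) (a : Fin (n + 1) → A) : (fun j => Function.update f i g j (a j)) =
      Function.update (fun j => f j (a j)) i (g (a i)) := by
    funext j
    by_cases h : j = i
    · subst h; simp
    · simp [h]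
  have : slotMap k (Function.update f i (∑ t ∈ s, u t)) =
      ∑ t ∈ s, slotMap k (Function.update f i (u t)) :=
    Chain.linearMap_ext k fun a => by
      simp only [LinearMap.sum_apply, slotMap_tprod, key, Chain.tprod_update_sum]
  rw [this, LinearMap.sum_apply]

theorem slotMap_update_add {n : ℕ} (f : Fin (n + 1) → A →ₗ[R] A)
    (i : Fin (n + 1)) (u v : A →ₗ[R] A) (x : Chain k A n) :
    slotMap k (Function.update f i (u + v)) x =
      slotMap k (Function.update f i u) x + slotMap k (Function.update f i v) x := by
  simpa using slotMap_update_sum k Finset.univ f i ![u, v] x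

theorem face_slotMap {n : ℕ} (i : Fin (n + 1)) (f : Fin (n + 2) → A →ₗ[R] A)
    (g : Fin (n + 1) → A →ₗ[R] A) (hlt : ∀ j < i, f j.castSucc = g j)
    (hgt : ∀ j, i < j → f j.succ = g j)
    (heq : ∀ u v, f i.castSucc u * f i.succ v = g i (u * v)) (x : Chain k A (n + 1)) :
    face k A R i.castSucc (slotMap k f x) = slotMap k g (face k A R i.castSucc x) := by
  have : face k A R i.castSucc ∘ₗ slotMap k f = slotMap k g ∘ₗ face k A R i.castSucc :=
    Chain.linearMap_ext k fun a => by
      simp only [LinearMap.comp_apply, slotMap_tprod, face_castSucc_tprod]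
      congr 1
      funext j
      rcases lt_trichotomy j i with h | h | h
      · rw [Fin.contractNth_apply_of_lt _ _ _ _ h, Fin.contractNth_apply_of_lt _ _ _ _ h, hlt j h]
      · subst h
        rw [Fin.contractNth_apply_of_eq _ _ _ _ (by simp),
          Fin.contractNth_apply_of_eq _ _ _ _ (by simp), heq]
      · rw [Fin.contractNth_apply_of_gt _ _ _ _ h, Fin.contractNth_apply_of_gt _ _ _ _ h, hgt j h]
  exact LinearMap.congr_fun this x

/-- The two families agree away from the merged pair, so multilinearity adds the two images in the
single merged factor. In this form a twisted Leibniz rule passes through a face map. -/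
theorem face_slotMap_add {n : ℕ} (i : Fin (n + 1)) (f f' : Fin (n + 2) → A →ₗ[R] A)
    (g : Fin (n + 1) → A →ₗ[R] A) (hlt : ∀ j < i, f j.castSucc = g j ∧ f' j.castSucc = g j)
    (hgt : ∀ j, i < j → f j.succ = g j ∧ f' j.succ = g j)
    (heq : ∀ u v, f i.castSucc u * f i.succ v + f' i.castSucc u * f' i.succ v = g i (u * v))
    (x : Chain k A (n + 1)) :
    face k A R i.castSucc (slotMap k f x) + face k A R i.castSucc (slotMap k f' x) =
      slotMap k g (face k A R i.castSucc x) := by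
  have : face k A R i.castSucc ∘ₗ slotMap k f + face k A R i.castSucc ∘ₗ slotMap k f' =
      slotMap k g ∘ₗ face k A R i.castSucc :=
    Chain.linearMap_ext k fun a => by
      simp only [LinearMap.comp_apply, LinearMap.add_apply, slotMap_tprod, face_castSucc_tprod]
      have key (f : Fin (n + 2) → A →ₗ[R] A) (hlt : ∀ j < i, f j.castSucc = g j)
          (hgt : ∀ j, i < j → f j.succ = g j) :
          i.castSucc.contractNth (· * ·) (fun j => f j (a j)) =
            Function.update (fun j => g j (i.castSucc.contractNth (· * ·) a j)) i
              (f i.castSucc (a i.castSucc) * f i.succ (a i.succ)) := by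
        funext j
        rcases lt_trichotomy j i with h | h | h
        · rw [Fin.contractNth_apply_of_lt _ _ _ _ h, Function.update_of_ne h.ne,
            Fin.contractNth_apply_of_lt _ _ _ _ h, hlt j h]
        · subst h
          rw [Fin.contractNth_apply_of_eq _ _ _ _ (by simp), Function.update_self]
        · rw [Fin.contractNth_apply_of_gt _ _ _ _ h, Function.update_of_ne h.ne',
            Fin.contractNth_apply_of_gt _ _ _ _ h, hgt j h]
      rw [key f (fun j h => (hlt j h).1) (fun j h => (hgt j h).1),
        key f' (fun j h => (hlt j h).2) (fun j h => (hgt j h).2), ← Chain.tprod_update_add, heq]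
      congr 1
      rw [Function.update_eq_self_iff, Fin.contractNth_apply_of_eq _ _ _ _ (by simp)]
  exact LinearMap.congr_fun this x

theorem face_last_slotMap {n : ℕ} (f : Fin (n + 2) → A →ₗ[R] A)
    (g : Fin (n + 1) → A →ₗ[R] A) (h0 : ∀ u v, f (Fin.last (n + 1)) u * f 0 v = g 0 (u * v))
    (hs : ∀ j : Fin n, f j.castSucc.succ = g j.succ) (x : Chain k A (n + 1)) :
    face k A R (Fin.last (n + 1)) (slotMap k f x) =
      slotMap k g (face k A R (Fin.last (n + 1)) x) := by
  have : face k A R (Fin.last (n + 1)) ∘ₗ slotMap k f =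
      slotMap k g ∘ₗ face k A R (Fin.last (n + 1)) :=
    Chain.linearMap_ext k fun a => by
      simp only [LinearMap.comp_apply, slotMap_tprod, face_last_tprod]
      congr 1
      funext j
      refine Fin.cases ?_ (fun j => ?_) j
      · simp [h0]
      · simp [hs]
  exact LinearMap.congr_fun this x

end SlotMap

/-! ### Twisted Lie derivatives and their commutator with b -/

section SkewLie

variable (k : Type u) [CommRing k] {R : Type u} [CommRing R] [Algebra k R]
  {A : Type u} [CommRing A] [Algebra k A] [Algebra R A] [IsScalarTower k R A]

/-- The maps on tensor factors which make up the `j`-th summand of `skewLie`. -/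
def skewSlot (s : A →ₗ[R] A) (e : A) (D : A →ₗ[R] A) (j m : ℕ) : A →ₗ[R] A :=
  if m = 0 then LinearMap.mulLeft R e else if m < j then s else if m = j then D else LinearMap.id

theorem skewSlot_zero (s : A →ₗ[R] A) (e : A) (D : A →ₗ[R] A) (j : ℕ) :
    skewSlot s e D j 0 = LinearMap.mulLeft R e := rfl

theorem skewSlot_of_lt (s : A →ₗ[R] A) (e : A) (D : A →ₗ[R] A) {j m : ℕ} (h0 : 0 < m)
    (h : m < j) : skewSlot s e D j m = s := by
  simp [skewSlot, h0.ne', h]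

theorem skewSlot_self (s : A →ₗ[R] A) (e : A) (D : A →ₗ[R] A) {j : ℕ} (h0 : 0 < j) :
    skewSlot s e D j j = D := by
  simp [skewSlot, h0.ne']

theorem skewSlot_of_gt (s : A →ₗ[R] A) (e : A) (D : A →ₗ[R] A) {j m : ℕ} (h : j < m) :
    skewSlot s e D j m = LinearMap.id := by
  simp [skewSlot, h.not_gt, h.ne', Nat.ne_of_gt (Nat.zero_lt_of_lt h)]

theorem skewSlot_succ_succ (s : A →ₗ[R] A) (e : A) (D : A →ₗ[R] A) {j m : ℕ} (h : 0 < m) :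
    skewSlot s e D (j + 1) (m + 1) = skewSlot s e D j m := by
  simp [skewSlot, h.ne']

theorem skewSlot_succ_left (s : A →ₗ[R] A) (e : A) (D : A →ₗ[R] A) {j m : ℕ} (h : m < j) :
    skewSlot s e D (j + 1) m = skewSlot s e D j m := by
  simp [skewSlot, h, Nat.lt_succ_of_lt h]

/-- The operator
`a_0 ⊗ ⋯ ⊗ a_n ↦ ∑_{j ≥ 1} e a_0 ⊗ s a_1 ⊗ ⋯ ⊗ s a_{j-1} ⊗ D a_j ⊗ a_{j+1} ⊗ ⋯ ⊗ a_n`. -/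
def skewLie (s : A →ₗ[R] A) (e : A) (D : A →ₗ[R] A) (n : ℕ) : Chain k A n →ₗ[R] Chain k A n :=
  ∑ j ∈ Finset.range n, slotMap k fun m => skewSlot s e D (j + 1) m

/-- Bookkeeping for a face map: the summands marking the two factors that get multiplied fuse into
one, and later marks move down by one. -/
theorem sum_range_succ_merge {M : Type*} [AddCommMonoid M] (f g : ℕ → M) (p n : ℕ) (hp : p < n)
    (hlt : ∀ j < p, f j = g j) (heq : f p + f (p + 1) = g p)
    (hgt : ∀ j, p < j → j < n → f (j + 1) = g j) :
    ∑ j ∈ Finset.range (n + 1), f j = ∑ j ∈ Finset.range n, g j := by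
  induction n, hp using Nat.le_induction with
  | base =>
    rw [Finset.sum_range_succ, Finset.sum_range_succ, Finset.sum_range_succ, add_assoc, heq]
    exact congrArg (· + g p) (Finset.sum_congr rfl fun j hj => hlt j (Finset.mem_range.1 hj))
  | succ n hn ih =>
    rw [Finset.sum_range_succ, Finset.sum_range_succ g n, hgt n hn (by omega)]
    exact congrArg (· + g n) (ih fun j h h' => hgt j h (by omega))

variable {s : A →ₗ[R] A} {e : A} {D : A →ₗ[R] A}
  (hs : ∀ a b, s (a * b) = s a * s b) (hes : ∀ a, e * s a = e * a)
  (hD : ∀ a b, D (a * b) = s a * D b + D a * b)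

include hs hD in
-- The face multiplies a_i by a_{i+1} with i ≥ 1. If D stands to the right of both, s is
-- multiplicative; if to the left, both factors are untouched; the two summands with D on one of
-- them combine by the twisted Leibniz rule.
theorem face_skewLie_of_ne_zero {n : ℕ} (i : Fin (n + 1)) (hi : i ≠ 0) (x : Chain k A (n + 1)) :
    face k A R i.castSucc (skewLie k s e D (n + 1) x) =
      skewLie k s e D n (face k A R i.castSucc x) := by
  have hi' : (i : ℕ) ≠ 0 := fun h => hi (Fin.ext h)
  simp only [skewLie, LinearMap.sum_apply, map_sum]
  -- The summand of index j has D on factor j + 1, so the fused summands are those of index i - 1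
  -- and i.
  refine sum_range_succ_merge _ _ ((i : ℕ) - 1) n (by omega) (fun j hj => ?_) ?_
    (fun j hj hj' => ?_)
  · refine face_slotMap k i _ _ (fun m hm => ?_) (fun m hm => ?_) (fun u v => ?_) x
    · simp only [Fin.val_castSucc]
    · have : (i : ℕ) < m := hm
      simp only [Fin.val_succ]
      rw [skewSlot_of_gt _ _ _ (by omega), skewSlot_of_gt _ _ _ (by omega)]
    · simp only [Fin.val_succ, Fin.val_castSucc]
      rw [skewSlot_of_gt _ _ _ (by omega : j + 1 < (i : ℕ)),
        skewSlot_of_gt _ _ _ (by omega : j + 1 < (i : ℕ) + 1)]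
      rfl
  · have h1 : (i : ℕ) - 1 + 1 = i := by omega
    rw [h1]
    refine face_slotMap_add k i _ _ _ (fun m hm => ?_) (fun m hm => ?_) (fun u v => ?_) x
    · have : (m : ℕ) < i := hm
      simp only [Fin.val_castSucc, true_and]
      exact skewSlot_succ_left _ _ _ this
    · have : (i : ℕ) < m := hm
      simp only [Fin.val_succ]
      rw [skewSlot_of_gt _ _ _ (by omega), skewSlot_of_gt _ _ _ (by omega),
        skewSlot_of_gt _ _ _ (by omega)]
      simp
    · simp only [Fin.val_succ, Fin.val_castSucc]
      rw [skewSlot_self _ _ _ (by omega), skewSlot_self _ _ _ (by omega),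
        skewSlot_of_gt _ _ _ (by omega : (i : ℕ) < i + 1), skewSlot_of_lt _ _ _ (by omega)
          (by omega), hD, add_comm]
      rfl
  · refine face_slotMap k i _ _ (fun m hm => ?_) (fun m hm => ?_) (fun u v => ?_) x
    · have : (m : ℕ) < i := hm
      simp only [Fin.val_castSucc]
      exact skewSlot_succ_left _ _ _ (by omega)
    · have : (i : ℕ) < m := hm
      exact skewSlot_succ_succ _ _ _ (by omega)
    · simp only [Fin.val_succ, Fin.val_castSucc]
      rw [skewSlot_of_lt _ _ _ (by omega) (by omega), skewSlot_of_lt _ _ _ (by omega) (by omega),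
        skewSlot_of_lt _ _ _ (by omega) (by omega), hs]

include hes in
-- When D stands beyond factor 1, that factor carries s, which is invisible next to e. Only the
-- summand with D on factor 1 has no counterpart after the face, and it survives as the error term.
theorem face_zero_skewLie {n : ℕ} (x : Chain k A (n + 1)) :
    face k A R (Fin.castSucc 0) (skewLie k s e D (n + 1) x) =
      skewLie k s e D n (face k A R (Fin.castSucc 0) x) +
        face k A R (Fin.castSucc 0) (slotMap k (fun m => skewSlot s e D 1 m) x) := by
  simp only [skewLie, LinearMap.sum_apply, map_sum]
  rw [Finset.sum_range_succ']
  refine congrArg (· + _) (Finset.sum_congr rfl fun j hj => ?_)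
  refine face_slotMap k 0 _ _ (fun m hm => ?_) (fun m hm => ?_) (fun u v => ?_) x
  · exact absurd hm (Fin.not_lt_zero m)
  · exact skewSlot_succ_succ _ _ _ hm
  · simp only [Fin.val_succ, Fin.val_castSucc, Fin.val_zero, skewSlot_zero,
      LinearMap.mulLeft_apply]
    rw [skewSlot_of_lt _ _ _ (by omega) (by omega), mul_right_comm, hes]
    ring

theorem face_last_skewLie {n : ℕ} (x : Chain k A (n + 1)) :
    face k A R (Fin.last (n + 1)) (skewLie k s e D (n + 1) x) =
      skewLie k s e D n (face k A R (Fin.last (n + 1)) x) +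
        face k A R (Fin.last (n + 1)) (slotMap k (fun m => skewSlot s e D (n + 1) m) x) := by
  simp only [skewLie, LinearMap.sum_apply, map_sum]
  rw [Finset.sum_range_succ]
  refine congrArg (· + _) (Finset.sum_congr rfl fun j hj => ?_)
  have := Finset.mem_range.1 hj
  refine face_last_slotMap k _ _ (fun u v => ?_) (fun m => ?_) x
  · simp only [Fin.val_last, Fin.val_zero, skewSlot_zero, LinearMap.mulLeft_apply]
    rw [skewSlot_of_gt _ _ _ (by omega), LinearMap.id_apply]
    ring
  · simp

omit [Algebra k R] [IsScalarTower k R A] in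
theorem b_apply {n : ℕ} (x : Chain k A (n + 1)) :
    b k A R n x = ∑ i : Fin (n + 1), (-1 : ℤ) ^ (i : ℕ) • face k A R i.castSucc x +
      (-1 : ℤ) ^ (n + 1) • face k A R (Fin.last (n + 1)) x := by
  simp only [b, LinearMap.sum_apply, LinearMap.smul_apply]
  rw [Fin.sum_univ_castSucc]
  simp only [Fin.val_castSucc, Fin.val_last]

include hs hes hD in
-- Inner faces commute with the operator, so the commutator consists of two end terms: D on the
-- factor that d_0 merges into a_0, and D on the factor that the last face merges into a_0.
theorem b_skewLie {n : ℕ} (x : Chain k A (n + 1)) :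
    b k A R n (skewLie k s e D (n + 1) x) = skewLie k s e D n (b k A R n x) +
      face k A R (Fin.castSucc 0) (slotMap k (fun m => skewSlot s e D 1 m) x) +
      (-1 : ℤ) ^ (n + 1) •
        face k A R (Fin.last (n + 1)) (slotMap k (fun m => skewSlot s e D (n + 1) m) x) := by
  simp only [b_apply, map_add, map_sum, map_zsmul]
  rw [Fin.sum_univ_succ, Fin.sum_univ_succ, face_zero_skewLie k hes, face_last_skewLie]
  have : ∀ i : Fin n, face k A R i.succ.castSucc (skewLie k s e D (n + 1) x) =
      skewLie k s e D n (face k A R i.succ.castSucc x) := fun i =>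
    face_skewLie_of_ne_zero k hs hD i.succ (Fin.succ_ne_zero i) x
  simp only [this, Fin.val_zero, pow_zero, one_smul, smul_add]
  abel

end SkewLie

/-! ### Pure tensors with a distinguished head, and the extra degeneracy -/

section Cons

variable (k : Type u) [CommRing k] (R : Type u) [CommRing R]
  {A : Type u} [CommRing A] [Algebra k A] [Algebra R A]

theorem Chain.sum_tprod_cons {n : ℕ} {ι : Type*} (s : Finset ι) (u : ι → A) (a : Fin n → A) :
    ∑ t ∈ s, Chain.tprod k A (Fin.cons (u t) a) =
      Chain.tprod k A (Fin.cons (∑ t ∈ s, u t) a) := by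
  have := Chain.tprod_update_sum k s (Fin.cons 0 a : Fin (n + 1) → A) 0 u
  simpa only [Fin.update_cons_zero] using this.symm

theorem Chain.tprod_cons_add {n : ℕ} (u v : A) (a : Fin n → A) :
    Chain.tprod k A (Fin.cons (u + v) a) =
      Chain.tprod k A (Fin.cons u a) + Chain.tprod k A (Fin.cons v a) := by
  have := Chain.tprod_update_add k (Fin.cons 0 a : Fin (n + 1) → A) 0 u v
  simpa only [Fin.update_cons_zero] using this

theorem Chain.tprod_cons_sub {n : ℕ} (u v : A) (a : Fin n → A) :
    Chain.tprod k A (Fin.cons (u - v) a) =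
      Chain.tprod k A (Fin.cons u a) - Chain.tprod k A (Fin.cons v a) := by
  rw [eq_sub_iff_add_eq, ← Chain.tprod_cons_add, sub_add_cancel]

theorem Chain.tprod_cons_neg {n : ℕ} (u : A) (a : Fin n → A) :
    Chain.tprod k A (Fin.cons (-u) a) = -Chain.tprod k A (Fin.cons u a) := by
  rw [eq_neg_iff_add_eq_zero, ← Chain.tprod_cons_add, neg_add_cancel]
  exact Chain.tprod_eq_zero k (i := 0) rfl

theorem face_zero_tprod {n : ℕ} (a : Fin (n + 2) → A) :
    face k A R (Fin.castSucc 0) (Chain.tprod k A a) =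
      Chain.tprod k A (Fin.cons (a 0 * a 1) fun j : Fin n => a j.succ.succ) := by
  rw [face_castSucc_tprod]
  congr 1
  funext j
  refine Fin.cases ?_ (fun j => ?_) j
  · rw [Fin.contractNth_apply_of_eq _ _ _ _ (by simp)]
    rfl
  · rw [Fin.contractNth_apply_of_gt _ _ _ _ (by simp)]
    rfl

/-- The extra degeneracy `a_0 ⊗ ⋯ ⊗ a_n ↦ 1 ⊗ a_0 ⊗ ⋯ ⊗ a_n`. -/
def extraDegen (A : Type u) [CommRing A] [Algebra k A] (n : ℕ) :
    Chain k A n →+ Chain k A (n + 1) :=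
  (push k A (Fin.succ : Fin (n + 1) → Fin (n + 2))).toAddMonoidHom

theorem extraDegen_tprod {n : ℕ} (a : Fin (n + 1) → A) :
    extraDegen k A n (Chain.tprod k A a) = Chain.tprod k A (Fin.cons 1 a) := by
  refine (push_tprod k A _ _).trans (congrArg (PiTensorProduct.tprod k) ?_)
  funext j
  rw [Finset.prod_filter]
  refine Fin.cases ?_ (fun j => ?_) j
  · simp [Fin.succ_ne_zero]
  · simp

theorem face_zero_extraDegen {n : ℕ} (x : Chain k A n) :
    face k A R (Fin.castSucc 0) (extraDegen k A n x) = x := by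
  have : (face k A R (Fin.castSucc 0)).toAddMonoidHom.comp (extraDegen k A n) =
      AddMonoidHom.id _ :=
    Chain.addHom_ext k fun a => by
      change face k A R (Fin.castSucc 0) (extraDegen k A n (Chain.tprod k A a)) =
        Chain.tprod k A a
      rw [extraDegen_tprod, face_zero_tprod]
      congr 1
      funext j
      refine Fin.cases ?_ (fun j => ?_) j
      · exact one_mul _
      · rfl
  exact DFunLike.congr_fun this x

theorem face_succ_extraDegen {n : ℕ} (i : Fin (n + 1)) (x : Chain k A (n + 1)) :
    face k A R i.succ.castSucc (extraDegen k A (n + 1) x) =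
      extraDegen k A n (face k A R i.castSucc x) := by
  have : (face k A R i.succ.castSucc).toAddMonoidHom.comp (extraDegen k A (n + 1)) =
      (extraDegen k A n).comp (face k A R i.castSucc).toAddMonoidHom :=
    Chain.addHom_ext k fun a => by
      change face k A R i.succ.castSucc (extraDegen k A (n + 1) (Chain.tprod k A a)) =
        extraDegen k A n (face k A R i.castSucc (Chain.tprod k A a))
      rw [extraDegen_tprod, face_castSucc_tprod, face_castSucc_tprod, extraDegen_tprod]
      congr 1
      funext j
      refine Fin.cases ?_ (fun j => ?_) j
      · rw [Fin.contractNth_apply_of_lt _ _ _ _ (by simp)]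
        rfl
      · rw [Fin.cons_succ]
        rcases lt_trichotomy (j : ℕ) i with h | h | h
        · rw [Fin.contractNth_apply_of_lt _ _ _ _ (by simpa using h),
            Fin.contractNth_apply_of_lt _ _ _ _ (by simpa using h)]
          rfl
        · rw [Fin.contractNth_apply_of_eq _ _ _ _ (by simpa using h),
            Fin.contractNth_apply_of_eq _ _ _ _ (by simpa using h)]
          rfl
        · rw [Fin.contractNth_apply_of_gt _ _ _ _ (by simpa using h),
            Fin.contractNth_apply_of_gt _ _ _ _ (by simpa using h)]
          rfl
  exact DFunLike.congr_fun this x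

/-- Since d_0 inverts the degeneracy and the inner faces commute with it up to a shift of index, it
would be a contracting homotopy except for the last, cyclic face, which gives the correction. -/
theorem b_extraDegen {n : ℕ} (x : Chain k A (n + 1)) :
    b k A R (n + 1) (extraDegen k A (n + 1) x) = x - extraDegen k A n (b k A R n x) +
      (-1 : ℤ) ^ (n + 1) • (extraDegen k A n (face k A R (Fin.last (n + 1)) x) -
        face k A R (Fin.last (n + 2)) (extraDegen k A (n + 1) x)) := by
  simp only [b_apply, map_add, map_sum, map_zsmul]
  rw [Fin.sum_univ_succ, face_zero_extraDegen]
  simp only [face_succ_extraDegen, Fin.val_succ, pow_succ, mul_neg_one, neg_smul, smul_sub, neg_neg,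
    Finset.sum_neg_distrib, Fin.val_zero, pow_zero, one_smul]
  abel

end Cons

/-- An idempotent endomorphism `ρ` of the `R`-algebra `A` whose kernel has square zero. -/
structure SqZeroRetract (R A : Type u) [CommRing R] [CommRing A] [Algebra R A] where
  /-- the projection onto the image -/
  ρ : A →ₐ[R] A
  idem : ∀ a, ρ (ρ a) = ρ a
  sq_zero : ∀ a b, (a - ρ a) * (b - ρ b) = 0

/-! ### Square-zero retracts, dual frames and the homotopy h -/

namespace SqZeroRetract

variable (k : Type u) [CommRing k] {R : Type u} [CommRing R] [Algebra k R]
  {A : Type u} [CommRing A] [Algebra k A] [Algebra R A] [IsScalarTower k R A]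
  (T : SqZeroRetract R A)

/-- The projection `ρ` as a linear map. -/
def proj : A →ₗ[R] A := T.ρ.toLinearMap

/-- The projection onto the square-zero ideal `ker ρ`. -/
def nil : A →ₗ[R] A := LinearMap.id - T.proj

/-- The involution which is `1` on the image of `ρ` and `-1` on its kernel. -/
def sgn : A →ₗ[R] A := T.proj - T.nil

theorem nil_apply (a : A) : T.nil a = a - T.proj a := rfl
theorem sgn_apply (a : A) : T.sgn a = T.proj a - T.nil a := rfl
theorem proj_one : T.proj 1 = 1 := map_one T.ρ
theorem proj_mul (a b : A) : T.proj (a * b) = T.proj a * T.proj b := map_mul T.ρ a b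
theorem proj_proj (a : A) : T.proj (T.proj a) = T.proj a := T.idem a
theorem proj_nil (a : A) : T.proj (T.nil a) = 0 := by
  rw [nil_apply, map_sub, proj_proj, sub_self]
theorem nil_proj (a : A) : T.nil (T.proj a) = 0 := by
  rw [nil_apply, proj_proj, sub_self]
theorem nil_nil (a : A) : T.nil (T.nil a) = T.nil a := by
  rw [nil_apply (a := T.nil a), proj_nil, sub_zero]
theorem nil_mul_nil (a b : A) : T.nil a * T.nil b = 0 := T.sq_zero a b
theorem proj_add_nil (a : A) : T.proj a + T.nil a = a := by rw [nil_apply, add_sub_cancel]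
theorem eq_proj_add_nil (a : A) : a = T.proj a + T.nil a := (T.proj_add_nil a).symm
theorem mul_nil (a b : A) : a * T.nil b = T.proj a * T.nil b := by
  conv_lhs => rw [T.eq_proj_add_nil a, add_mul, nil_mul_nil, add_zero]
theorem nil_mul (a b : A) : T.nil (a * b) = T.proj a * T.nil b + T.nil a * T.proj b := by
  have h := T.nil_mul_nil a b
  simp only [nil_apply, proj_mul] at h ⊢
  linear_combination h
theorem sgn_mul (a b : A) : T.sgn (a * b) = T.sgn a * T.sgn b := by
  simp only [sgn_apply, proj_mul, nil_mul]
  linear_combination -T.nil_mul_nil a b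
theorem proj_sgn (a : A) : T.proj (T.sgn a) = T.proj a := by
  rw [sgn_apply, map_sub, proj_proj, proj_nil, sub_zero]
theorem sgn_proj (a : A) : T.sgn (T.proj a) = T.proj a := by
  rw [sgn_apply, proj_proj, nil_proj, sub_zero]
theorem nil_sgn (a : A) : T.nil (T.sgn a) = -T.nil a := by
  rw [sgn_apply, map_sub, nil_proj, nil_nil, zero_sub]
theorem sgn_nil (a : A) : T.sgn (T.nil a) = -T.nil a := by
  rw [sgn_apply, nil_nil, proj_nil, zero_sub]
theorem sgn_sgn (a : A) : T.sgn (T.sgn a) = a := by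
  rw [sgn_apply, proj_sgn, nil_sgn, sub_neg_eq_add, proj_add_nil]
theorem sgn_one : T.sgn 1 = 1 := by
  have := T.sgn_proj 1
  rwa [proj_one] at this

/-- The projection `ρ` on the factor `a_0`. -/
def headProj (n : ℕ) : Chain k A n →ₗ[R] Chain k A n :=
  slotMap k fun m => if m = 0 then T.proj else LinearMap.id

/-- The projection `ρ` on the factors `a_j, a_{j+1}, …`. -/
def tailProj (j n : ℕ) : Chain k A n →ₗ[R] Chain k A n :=
  slotMap k fun m => if j ≤ m then T.proj else LinearMap.id

/-- The projection `ρ` on all factors. -/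
def allProj (n : ℕ) : Chain k A n →ₗ[R] Chain k A n :=
  slotMap k fun _ => T.proj

/-- The involution of `C_n(A)` induced by `sgn`. -/
def parity (n : ℕ) : Chain k A n →ₗ[R] Chain k A n :=
  slotMap k fun _ => T.sgn

/-- `a_0 ⊗ ⋯ ⊗ a_{n+1} ↦ a_0 ν(a_1) ⊗ a_2 ⊗ ⋯ ⊗ a_{n+1}`, where `ν = 1 - ρ`. -/
def absorbFirst (n : ℕ) : Chain k A (n + 1) →ₗ[R] Chain k A n :=
  face k A R (Fin.castSucc 0) ∘ₗ slotMap k fun m => if m = 1 then T.nil else LinearMap.id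

/-- `a_0 ⊗ ⋯ ⊗ a_{n+1} ↦ (-1)^{n+1} ν(a_{n+1}) a_0 ⊗ a_1 ⊗ ⋯ ⊗ a_n`, where `ν = 1 - ρ`. -/
def absorbLast (n : ℕ) : Chain k A (n + 1) →ₗ[R] Chain k A n :=
  (-1 : ℤ) ^ (n + 1) • (face k A R (Fin.last (n + 1)) ∘ₗ
    slotMap k fun m => if m = Fin.last (n + 1) then T.nil else LinearMap.id)

theorem headProj_cons {n : ℕ} (u : A) (a : Fin n → A) :
    T.headProj k n (Chain.tprod k A (Fin.cons u a)) = Chain.tprod k A (Fin.cons (T.proj u) a) := by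
  rw [headProj, slotMap_tprod]
  congr 1
  funext j
  refine Fin.cases ?_ (fun j => ?_) j
  · simp
  · simp [Fin.succ_ne_zero]

theorem absorbFirst_tprod {n : ℕ} (a : Fin (n + 2) → A) :
    T.absorbFirst k n (Chain.tprod k A a) =
      Chain.tprod k A (Fin.cons (a 0 * T.nil (a 1)) fun j : Fin n => a j.succ.succ) := by
  rw [absorbFirst, LinearMap.comp_apply, slotMap_tprod, face_zero_tprod]
  congr 2

theorem absorbLast_tprod {n : ℕ} (a : Fin (n + 2) → A) :
    T.absorbLast k n (Chain.tprod k A a) = (-1 : ℤ) ^ (n + 1) •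
      Chain.tprod k A (Fin.cons (T.nil (a (Fin.last (n + 1))) * a 0)
        fun j : Fin n => a j.castSucc.succ) := by
  rw [absorbLast, LinearMap.smul_apply, LinearMap.comp_apply, slotMap_tprod, face_last_tprod]
  congr 3
  · simp [Fin.ext_iff]
  · funext j
    have := j.isLt
    simp [Fin.ext_iff, this.ne]

/-- Elements `e_i ∈ ker ρ` and functionals `D_i` on `ker ρ` with values in the image of `ρ`, which
form a dual basis of `ker ρ` as a module of rank one. -/
structure Frame (ι : Type) [Fintype ι] where
  e : ι → A
  D : ι → A →ₗ[R] A
  proj_e : ∀ i, T.proj (e i) = 0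
  proj_D : ∀ i a, T.proj (D i a) = D i a
  D_proj : ∀ i a, D i (T.proj a) = 0
  D_mul : ∀ i a b, D i (a * b) = T.sgn a * D i b + D i a * b
  sum : ∀ a, ∑ i, e i * D i a = T.nil a

namespace Frame

variable {T} {ι : Type} [Fintype ι] (B : T.Frame ι)

theorem nil_e (i : ι) : T.nil (B.e i) = B.e i := by rw [nil_apply, B.proj_e, sub_zero]

theorem e_mul (i : ι) (a : A) : B.e i * a = B.e i * T.proj a := by
  rw [← B.nil_e, mul_comm, mul_nil, mul_comm]

theorem sgn_e (i : ι) : T.sgn (B.e i) = -B.e i := by rw [← B.nil_e, sgn_nil]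

theorem D_nil (i : ι) (a : A) : B.D i (T.nil a) = B.D i a := by
  rw [nil_apply, map_sub, B.D_proj, sub_zero]

theorem sgn_D (i : ι) (a : A) : T.sgn (B.D i a) = B.D i a := by
  rw [← B.proj_D, sgn_proj]

theorem D_sgn (i : ι) (a : A) : B.D i (T.sgn a) = -B.D i a := by
  rw [sgn_apply, map_sub, B.D_proj, B.D_nil, zero_sub]

/-- The homotopy `h`, a sum over all ways of moving a factor in `ker ρ` to position `0`. -/
def homotopy (n : ℕ) : Chain k A n →ₗ[R] Chain k A n :=
  ∑ i, skewLie k T.sgn (B.e i) (B.D i) n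

/-- The sum over the dual basis reassembles ∑ e_i D_i(a_1) into ν(a_1). -/
theorem sum_face_zero {n : ℕ} (x : Chain k A (n + 1)) :
    ∑ i, face k A R (Fin.castSucc 0)
      (slotMap k (fun m => skewSlot T.sgn (B.e i) (B.D i) 1 m) x) = T.absorbFirst k n x := by
  have : ∑ i, face k A R (Fin.castSucc 0) ∘ₗ
      slotMap k (fun m => skewSlot T.sgn (B.e i) (B.D i) 1 m) = T.absorbFirst k n :=
    Chain.linearMap_ext k fun a => by
      rw [absorbFirst_tprod, ← B.sum, Finset.mul_sum, ← Chain.sum_tprod_cons, LinearMap.sum_apply]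
      refine Finset.sum_congr rfl fun i _ => ?_
      rw [LinearMap.comp_apply, slotMap_tprod, face_zero_tprod]
      congr 2
      · simp only [Fin.val_zero, Fin.val_one, skewSlot_zero, LinearMap.mulLeft_apply]
        rw [skewSlot_self _ _ _ one_pos]
        ring
  rw [← this, LinearMap.sum_apply]
  rfl

/-- With D on the last factor, each of a_1, …, a_n carries `sgn`, so the term is a parity twist of
`absorbLast`. The absorbed factor lies in ker ρ, where `sgn` is -1, while `sgn` on a_0 is invisible
after multiplication by that factor; hence the minus sign. -/
theorem sum_face_last {n : ℕ} (x : Chain k A (n + 1)) :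
    (-1 : ℤ) ^ (n + 1) • ∑ i, face k A R (Fin.last (n + 1))
      (slotMap k (fun m => skewSlot T.sgn (B.e i) (B.D i) (n + 1) m) x) =
        -T.absorbLast k n (T.parity k (n + 1) x) := by
  have : (-1 : ℤ) ^ (n + 1) • ∑ i, face k A R (Fin.last (n + 1)) ∘ₗ
      slotMap k (fun m => skewSlot T.sgn (B.e i) (B.D i) (n + 1) m) =
        -T.absorbLast k n ∘ₗ T.parity k (n + 1) :=
    Chain.linearMap_ext k fun a => by
      rw [LinearMap.neg_apply, LinearMap.comp_apply, parity, slotMap_tprod, absorbLast_tprod,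
        ← smul_neg, LinearMap.smul_apply]
      congr 1
      have h : T.nil (T.sgn (a (Fin.last (n + 1)))) * T.sgn (a 0) =
          -∑ i, (B.e i * a 0) * B.D i (a (Fin.last (n + 1))) := by
        rw [nil_sgn, mul_comm, mul_neg, mul_nil, proj_sgn, ← mul_nil, ← B.sum, Finset.mul_sum]
        refine congrArg _ (Finset.sum_congr rfl fun i _ => by ring)
      rw [h, Chain.tprod_cons_neg, neg_neg, ← Chain.sum_tprod_cons, LinearMap.sum_apply]
      refine Finset.sum_congr rfl fun i _ => ?_
      rw [LinearMap.comp_apply, slotMap_tprod, face_last_tprod]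
      congr 2
      · simp only [Fin.val_zero, Fin.val_last, skewSlot_zero, LinearMap.mulLeft_apply]
        rw [skewSlot_self _ _ _ n.succ_pos, mul_comm]
      · funext j
        rw [skewSlot_of_lt _ _ _ (by simp) (by simp)]
  have h := LinearMap.congr_fun this x
  rw [LinearMap.smul_apply, LinearMap.sum_apply] at h
  exact h

/-- The two end terms of `b_skewLie`, summed over the frame. On odd chains the error is the sum of
the two absorptions, as for [b, P]; on even chains it is their difference. -/
theorem b_homotopy {n : ℕ} (x : Chain k A (n + 1)) :
    b k A R n (B.homotopy k (n + 1) x) = B.homotopy k n (b k A R n x) + T.absorbFirst k n x -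
      T.absorbLast k n (T.parity k (n + 1) x) := by
  simp only [homotopy, LinearMap.sum_apply, map_sum]
  rw [sub_eq_add_neg, ← B.sum_face_last k, ← B.sum_face_zero k, Finset.smul_sum,
    ← Finset.sum_add_distrib, ← Finset.sum_add_distrib]
  refine Finset.sum_congr rfl fun i _ => ?_
  refine b_skewLie k T.sgn_mul (fun a => ?_) (B.D_mul i) x
  rw [B.e_mul, proj_sgn, ← B.e_mul]

end Frame

end SqZeroRetract

/-! ### Sign cancellation and multiplicative operators -/

section Cons

variable (k : Type u) [CommRing k] (R : Type u) [CommRing R] [Algebra k R]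
  {A : Type u} [CommRing A] [Algebra k A] [Algebra R A] [IsScalarTower k R A]

theorem exists_eq_cons {n : ℕ} {A : Type*} (a : Fin (n + 1) → A) :
    ∃ u t, a = Fin.cons u t :=
  ⟨a 0, Fin.tail a, (Fin.cons_self_tail a).symm⟩

omit [Algebra k R] [IsScalarTower k R A] in
theorem Chain.tprod_update_neg {n : ℕ} (a : Fin (n + 1) → A) (i : Fin (n + 1)) (u : A) :
    Chain.tprod k A (Function.update a i (-u)) = -Chain.tprod k A (Function.update a i u) := by
  rw [eq_neg_iff_add_eq_zero, ← Chain.tprod_update_add, neg_add_cancel]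
  exact Chain.tprod_eq_zero k (i := i) (by simp)

omit [Algebra k R] [IsScalarTower k R A] in
-- Two minus signs cancel by multilinearity. This serves to show that h preserves parity.
theorem Chain.tprod_congr_neg_neg {n : ℕ} {a c : Fin (n + 1) → A} {p q : Fin (n + 1)}
    (hpq : p ≠ q) (hp : a p = -c p) (hq : a q = -c q) (h : ∀ m, m ≠ p → m ≠ q → a m = c m) :
    Chain.tprod k A a = Chain.tprod k A c := by
  have : a = Function.update (Function.update c p (-c p)) q (-c q) := by
    funext m
    by_cases hmq : m = q
    · subst hmq; simp [hq]
    · by_cases hmp : m = p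
      · subst hmp; simp [hmq, hp]
      · simp [hmq, hmp, h m hmp hmq]
  rw [this, Chain.tprod_update_neg, Function.update_comm hpq, Chain.tprod_update_neg, neg_neg,
    Function.update_eq_self, Function.update_eq_self]

omit [Algebra k R] [IsScalarTower k R A] in
theorem face_one_tprod {n : ℕ} (u v w : A) (a : Fin n → A) :
    face k A R (Fin.castSucc 1) (Chain.tprod k A (Fin.cons u (Fin.cons v (Fin.cons w a)))) =
      Chain.tprod k A (Fin.cons u (Fin.cons (v * w) a)) := by
  rw [face_castSucc_tprod]
  congr 1
  funext j
  refine Fin.cases ?_ (fun j => ?_) j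
  · rw [Fin.contractNth_apply_of_lt _ _ _ _ (by simp)]
    rfl
  · refine Fin.cases ?_ (fun j => ?_) j
    · rw [Fin.contractNth_apply_of_eq _ _ _ _ (by simp)]
      rfl
    · rw [Fin.contractNth_apply_of_gt _ _ _ _ (by simp)]
      rfl

omit [Algebra k R] [IsScalarTower k R A] in
theorem b_apply_succ {n : ℕ} (x : Chain k A (n + 1)) :
    b k A R n x = face k A R (Fin.castSucc 0) x +
      ∑ i : Fin n, (-1 : ℤ) ^ (i + 1 : ℕ) • face k A R i.succ.castSucc x +
      (-1 : ℤ) ^ (n + 1) • face k A R (Fin.last (n + 1)) x := by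
  rw [b_apply, Fin.sum_univ_succ]
  simp only [Fin.val_zero, pow_zero, one_smul, Fin.val_succ]

variable {R} in
theorem b_slotMap {n : ℕ} (f : A →ₗ[R] A) (hf : ∀ a b, f (a * b) = f a * f b)
    (x : Chain k A (n + 1)) :
    b k A R n (slotMap k (fun _ => f) x) = slotMap k (fun _ => f) (b k A R n x) := by
  simp only [b_apply, map_add, map_sum, map_zsmul]
  rw [face_last_slotMap k _ (fun _ => f) (fun u v => (hf u v).symm) (fun _ => rfl)]
  refine congrArg (· + _) (Finset.sum_congr rfl fun i _ => ?_)
  rw [face_slotMap k i _ (fun _ => f) (fun _ _ => rfl) (fun _ _ => rfl) (fun u v => (hf u v).symm)]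

variable {R} in
theorem extraDegen_slotMap {n : ℕ} (f : Fin (n + 1) → A →ₗ[R] A) (g : Fin (n + 2) → A →ₗ[R] A)
    (h0 : g 0 1 = 1) (hs : ∀ j, g j.succ = f j) (x : Chain k A n) :
    extraDegen k A n (slotMap k f x) = slotMap k g (extraDegen k A n x) := by
  have : (extraDegen k A n).comp (slotMap k f).toAddMonoidHom =
      (slotMap k g).toAddMonoidHom.comp (extraDegen k A n) :=
    Chain.addHom_ext k fun a => by
      change extraDegen k A n (slotMap k f (Chain.tprod k A a)) =
        slotMap k g (extraDegen k A n (Chain.tprod k A a))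
      rw [slotMap_tprod, extraDegen_tprod, extraDegen_tprod, slotMap_tprod]
      congr 1
      funext j
      refine Fin.cases ?_ (fun j => ?_) j
      · exact h0.symm
      · simp [hs]
  exact DFunLike.congr_fun this x

end Cons

/-! ### Commutation relations among P, F, h, parity and the extra degeneracy -/

namespace SqZeroRetract

variable (k : Type u) [CommRing k] {R : Type u} [CommRing R] [Algebra k R]
  {A : Type u} [CommRing A] [Algebra k A] [Algebra R A] [IsScalarTower k R A]
  (T : SqZeroRetract R A)

theorem parity_b {n : ℕ} (x : Chain k A (n + 1)) :
    T.parity k n (b k A R n x) = b k A R n (T.parity k (n + 1) x) :=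
  (b_slotMap k T.sgn T.sgn_mul x).symm

theorem allProj_b {n : ℕ} (x : Chain k A (n + 1)) :
    T.allProj k n (b k A R n x) = b k A R n (T.allProj k (n + 1) x) :=
  (b_slotMap k T.proj T.proj_mul x).symm

theorem headProj_headProj {n : ℕ} (x : Chain k A n) :
    T.headProj k n (T.headProj k n x) = T.headProj k n x := by
  rw [headProj, slotMap_slotMap]
  congr 2
  funext j
  ext a
  by_cases h : j = 0 <;> simp [h, proj_proj]

theorem allProj_headProj {n : ℕ} (x : Chain k A n) :
    T.allProj k n (T.headProj k n x) = T.allProj k n x := by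
  rw [headProj, allProj, slotMap_slotMap]
  congr 2
  funext j
  ext a
  by_cases h : j = 0 <;> simp [h, proj_proj]

theorem headProj_allProj {n : ℕ} (x : Chain k A n) :
    T.headProj k n (T.allProj k n x) = T.allProj k n x := by
  rw [headProj, allProj, slotMap_slotMap]
  congr 2
  funext j
  ext a
  by_cases h : j = 0 <;> simp [h, proj_proj]

theorem allProj_allProj {n : ℕ} (x : Chain k A n) :
    T.allProj k n (T.allProj k n x) = T.allProj k n x := by
  rw [allProj, slotMap_slotMap]
  congr 2
  funext j
  ext a
  simp [proj_proj]

theorem parity_parity {n : ℕ} (x : Chain k A n) :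
    T.parity k n (T.parity k n x) = x := by
  rw [parity, slotMap_slotMap]
  refine Eq.trans ?_ (slotMap_id k (R := R) x)
  congr 2
  funext j
  ext a
  simp [sgn_sgn]

theorem parity_headProj {n : ℕ} (x : Chain k A n) :
    T.parity k n (T.headProj k n x) = T.headProj k n (T.parity k n x) := by
  rw [headProj, parity, slotMap_slotMap, slotMap_slotMap]
  congr 2
  funext j
  ext a
  by_cases h : j = 0 <;> simp [h, proj_sgn, sgn_proj]

theorem parity_allProj {n : ℕ} (x : Chain k A n) :
    T.parity k n (T.allProj k n x) = T.allProj k n x := by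
  rw [allProj, parity, slotMap_slotMap]
  congr 2
  funext j
  ext a
  simp [sgn_proj]

theorem allProj_parity {n : ℕ} (x : Chain k A n) :
    T.allProj k n (T.parity k n x) = T.allProj k n x := by
  rw [allProj, parity, slotMap_slotMap]
  congr 2
  funext j
  ext a
  simp [proj_sgn]

theorem tailProj_one_headProj {n : ℕ} (x : Chain k A n) :
    T.tailProj k 1 n (T.headProj k n x) = T.allProj k n x := by
  rw [headProj, tailProj, slotMap_slotMap, allProj]
  congr 2
  funext j
  ext a
  by_cases h : j = 0
  · simp [h]
  · have : 1 ≤ (j : ℕ) := Nat.one_le_iff_ne_zero.2 fun h' => h (Fin.ext h')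
    simp [h, this]

theorem tailProj_of_gt {n j : ℕ} (hj : n < j) (x : Chain k A n) :
    T.tailProj k j n x = x := by
  refine Eq.trans ?_ (slotMap_id k (R := R) x)
  rw [tailProj]
  congr 2
  funext m
  rw [if_neg (by omega)]

theorem face_headProj {n : ℕ} (i : Fin n) (x : Chain k A (n + 1)) :
    face k A R i.succ.castSucc (T.headProj k (n + 1) x) =
      T.headProj k n (face k A R i.succ.castSucc x) := by
  refine face_slotMap k i.succ _ _ (fun j hj => ?_) (fun j hj => ?_) (fun u v => ?_) x
  · by_cases h : j = 0 <;> simp [h]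
  · rw [if_neg (Fin.succ_ne_zero _), if_neg (Fin.ne_zero_of_lt hj)]
  · simp [Fin.ext_iff]

theorem face_zero_headProj {n : ℕ} (x : Chain k A (n + 1)) :
    face k A R (Fin.castSucc 0) (T.headProj k (n + 1) x) =
      T.headProj k n (face k A R (Fin.castSucc 0) x) + T.absorbFirst k n x := by
  have : face k A R (Fin.castSucc 0) ∘ₗ T.headProj k (n + 1) =
      T.headProj k n ∘ₗ face k A R (Fin.castSucc 0) + T.absorbFirst k n :=
    Chain.linearMap_ext k fun a => by
      obtain ⟨u, a, rfl⟩ := exists_eq_cons a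
      obtain ⟨v, a, rfl⟩ := exists_eq_cons a
      rw [LinearMap.add_apply, LinearMap.comp_apply, LinearMap.comp_apply, headProj_cons,
        face_zero_tprod, face_zero_tprod, headProj_cons, absorbFirst_tprod,
        ← Chain.tprod_cons_add]
      congr 2
      change T.proj u * v = T.proj (u * v) + u * T.nil v
      rw [proj_mul, mul_nil, ← mul_add, proj_add_nil]
  exact LinearMap.congr_fun this x

theorem face_last_headProj {n : ℕ} (x : Chain k A (n + 1)) :
    (-1 : ℤ) ^ (n + 1) • face k A R (Fin.last (n + 1)) (T.headProj k (n + 1) x) =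
      (-1 : ℤ) ^ (n + 1) • T.headProj k n (face k A R (Fin.last (n + 1)) x) +
        T.absorbLast k n x := by
  have : (-1 : ℤ) ^ (n + 1) • face k A R (Fin.last (n + 1)) ∘ₗ T.headProj k (n + 1) =
      (-1 : ℤ) ^ (n + 1) • T.headProj k n ∘ₗ face k A R (Fin.last (n + 1)) + T.absorbLast k n :=
    Chain.linearMap_ext k fun a => by
      obtain ⟨u, a, rfl⟩ := exists_eq_cons a
      rw [LinearMap.add_apply, LinearMap.smul_apply, LinearMap.smul_apply, LinearMap.comp_apply,
        LinearMap.comp_apply, headProj_cons, face_last_tprod, face_last_tprod, headProj_cons,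
        absorbLast_tprod, ← smul_add]
      congr 1
      refine Eq.trans ?_ (Chain.tprod_cons_add k _ _ _)
      congr 2
      change a (Fin.last n) * T.proj u = T.proj (a (Fin.last n) * u) + T.nil (a (Fin.last n)) * u
      rw [proj_mul, mul_comm (T.nil _), mul_nil, mul_comm (T.proj u), ← add_mul, proj_add_nil]
  exact LinearMap.congr_fun this x

/-- Only the first and last faces involve a_0, and ρ(u)v = ρ(uv) + uν(v) because ker ρ has square
zero. Both error terms have their head in ker ρ. -/
theorem b_headProj {n : ℕ} (x : Chain k A (n + 1)) :
    b k A R n (T.headProj k (n + 1) x) =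
      T.headProj k n (b k A R n x) + T.absorbFirst k n x + T.absorbLast k n x := by
  simp only [b_apply_succ, map_add, map_sum, map_zsmul]
  rw [face_zero_headProj, face_last_headProj]
  simp only [face_headProj]
  abel

theorem headProj_absorbFirst {n : ℕ} (x : Chain k A (n + 1)) :
    T.headProj k n (T.absorbFirst k n x) = 0 := by
  have : T.headProj k n ∘ₗ T.absorbFirst k n = 0 :=
    Chain.linearMap_ext k fun a => by
      rw [LinearMap.comp_apply, absorbFirst_tprod, headProj_cons, proj_mul, proj_nil, mul_zero]
      exact Chain.tprod_eq_zero k (i := 0) rfl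
  exact LinearMap.congr_fun this x

theorem headProj_absorbLast {n : ℕ} (x : Chain k A (n + 1)) :
    T.headProj k n (T.absorbLast k n x) = 0 := by
  have : T.headProj k n ∘ₗ T.absorbLast k n = 0 :=
    Chain.linearMap_ext k fun a => by
      rw [LinearMap.comp_apply, absorbLast_tprod, map_zsmul, headProj_cons, proj_mul, proj_nil,
        zero_mul, Chain.tprod_eq_zero k (i := 0) rfl, smul_zero]
      rfl
  exact LinearMap.congr_fun this x

theorem absorbFirst_headProj {n : ℕ} (x : Chain k A (n + 1)) :
    T.absorbFirst k n (T.headProj k (n + 1) x) = T.absorbFirst k n x := by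
  have : T.absorbFirst k n ∘ₗ T.headProj k (n + 1) = T.absorbFirst k n :=
    Chain.linearMap_ext k fun a => by
      obtain ⟨u, a, rfl⟩ := exists_eq_cons a
      rw [LinearMap.comp_apply, headProj_cons, absorbFirst_tprod, absorbFirst_tprod]
      congr 2
      exact (T.mul_nil _ _).symm
  exact LinearMap.congr_fun this x

theorem parity_absorbFirst {n : ℕ} (x : Chain k A (n + 1)) :
    T.parity k n (T.absorbFirst k n x) = T.absorbFirst k n (T.parity k (n + 1) x) := by
  have : T.parity k n ∘ₗ T.absorbFirst k n = T.absorbFirst k n ∘ₗ T.parity k (n + 1) :=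
    Chain.linearMap_ext k fun a => by
      rw [LinearMap.comp_apply, LinearMap.comp_apply, absorbFirst_tprod, parity, slotMap_tprod,
        parity, slotMap_tprod, absorbFirst_tprod]
      congr 1
      funext j
      refine Fin.cases ?_ (fun j => ?_) j
      · simp only [Fin.cons_zero]
        rw [sgn_mul, sgn_nil, nil_sgn]
      · rfl
  exact LinearMap.congr_fun this x

/-- This is the derivation rule ν(vw) = ν(v)w + vν(w), valid since products of two elements of ker ρ
vanish. -/
theorem absorbFirst_face_one {n : ℕ} (x : Chain k A (n + 2)) :
    T.absorbFirst k n (face k A R (Fin.castSucc 1) x) =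
      face k A R (Fin.castSucc 0) (T.absorbFirst k (n + 1) x) +
        T.absorbFirst k n (face k A R (Fin.castSucc 0) x) := by
  have : T.absorbFirst k n ∘ₗ face k A R (Fin.castSucc 1) =
      face k A R (Fin.castSucc 0) ∘ₗ T.absorbFirst k (n + 1) +
        T.absorbFirst k n ∘ₗ face k A R (Fin.castSucc 0) :=
    Chain.linearMap_ext k fun a => by
      obtain ⟨u, a, rfl⟩ := exists_eq_cons a
      obtain ⟨v, a, rfl⟩ := exists_eq_cons a
      obtain ⟨w, a, rfl⟩ := exists_eq_cons a
      rw [LinearMap.add_apply, LinearMap.comp_apply, LinearMap.comp_apply, LinearMap.comp_apply,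
        face_one_tprod, absorbFirst_tprod, absorbFirst_tprod, face_zero_tprod, face_zero_tprod,
        absorbFirst_tprod]
      refine Eq.trans ?_ (Chain.tprod_cons_add k _ _ _)
      congr 2
      change u * T.nil (v * w) = u * T.nil v * w + u * v * T.nil w
      rw [nil_mul]
      linear_combination -u * T.mul_nil v w - u * T.mul_nil w v
  exact LinearMap.congr_fun this x

theorem absorbFirst_face_succ {n : ℕ} (i : Fin (n + 1)) (x : Chain k A (n + 2)) :
    T.absorbFirst k n (face k A R i.succ.succ x) =
      face k A R i.succ (T.absorbFirst k (n + 1) x) := by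
  have h : slotMap k (fun m : Fin (n + 2) => if m = 1 then T.nil else LinearMap.id)
      (face k A R i.succ.succ x) =
      face k A R i.succ.succ
        (slotMap k (fun m : Fin (n + 3) => if m = 1 then T.nil else LinearMap.id) x) := by
    refine Fin.lastCases ?_ (fun i => ?_) i
    · rw [Fin.succ_last, Fin.succ_last]
      refine (face_last_slotMap k _ _ (fun u v => ?_) (fun j => ?_) x).symm
      · have h1 : Fin.last (n + 2) ≠ 1 := by simp [Fin.ext_iff]
        have h2 (m : ℕ) : (0 : Fin (m + 2)) ≠ 1 := by simp
        rw [if_neg h1, if_neg (h2 _), if_neg (h2 _)]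
        rfl
      · simp only [Fin.ext_iff, Fin.val_succ, Fin.val_castSucc, Fin.val_one]
    · rw [← Fin.castSucc_succ, ← Fin.castSucc_succ]
      refine (face_slotMap k i.succ.succ _ _ (fun j hj => ?_) (fun j hj => ?_) (fun u v => ?_)
        x).symm
      · simp [Fin.ext_iff]
      · have : (i : ℕ) + 2 < j := hj
        rw [if_neg, if_neg]
        · rintro rfl
          simp at this
        · simp only [Fin.ext_iff, Fin.val_succ, Fin.val_one]
          omega
      · simp [Fin.ext_iff]
  rw [absorbFirst, LinearMap.comp_apply, h]
  exact face_face k A R 0 i.succ (Fin.zero_le _) _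

/-- By the derivation rule the face d_1 yields d_0 F + F d_0, whose second term cancels against the
d_0 term of b. The remaining faces pass through F with their index lowered by one, which produces
the sign. -/
theorem absorbFirst_b {n : ℕ} (x : Chain k A (n + 2)) :
    T.absorbFirst k n (b k A R (n + 1) x) = -b k A R n (T.absorbFirst k (n + 1) x) := by
  simp only [b, LinearMap.sum_apply, LinearMap.smul_apply, map_sum, map_zsmul]
  rw [Fin.sum_univ_succ, Fin.sum_univ_succ, Fin.sum_univ_succ (n := n + 1)]
  have h := T.absorbFirst_face_one k x
  rw [show (0 : Fin (n + 2)).succ = Fin.castSucc 1 from rfl, h]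
  simp only [absorbFirst_face_succ, Fin.val_succ, pow_succ, mul_neg_one, neg_neg, neg_smul,
    Finset.sum_neg_distrib, Fin.val_zero, pow_zero, one_smul, Fin.val_castSucc, Fin.val_one]
  simp only [Fin.castSucc_zero, neg_add]
  abel

theorem headProj_extraDegen {n : ℕ} (x : Chain k A n) :
    T.headProj k (n + 1) (extraDegen k A n x) = extraDegen k A n x := by
  refine Eq.trans (extraDegen_slotMap k (R := R) (fun _ => LinearMap.id) _ ?_ ?_ x).symm ?_
  · simp [proj_one]
  · simp [Fin.succ_ne_zero]
  · rw [slotMap_id]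

theorem parity_extraDegen {n : ℕ} (x : Chain k A n) :
    T.parity k (n + 1) (extraDegen k A n x) = extraDegen k A n (T.parity k n x) :=
  (extraDegen_slotMap k (R := R) _ _ T.sgn_one (fun _ => rfl) x).symm

theorem allProj_extraDegen {n : ℕ} (x : Chain k A n) :
    T.allProj k (n + 1) (extraDegen k A n x) = extraDegen k A n (T.allProj k n x) :=
  (extraDegen_slotMap k (R := R) _ _ T.proj_one (fun _ => rfl) x).symm

theorem absorbFirst_extraDegen {n : ℕ} (x : Chain k A n) :
    T.absorbFirst k n (extraDegen k A n x) = x - T.headProj k n x := by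
  have : (T.absorbFirst k n).toAddMonoidHom.comp (extraDegen k A n) =
      AddMonoidHom.id _ - (T.headProj k n).toAddMonoidHom :=
    Chain.addHom_ext k fun a => by
      obtain ⟨u, a, rfl⟩ := exists_eq_cons a
      change T.absorbFirst k n (extraDegen k A n (Chain.tprod k A (Fin.cons u a))) =
        Chain.tprod k A (Fin.cons u a) - T.headProj k n (Chain.tprod k A (Fin.cons u a))
      rw [extraDegen_tprod, absorbFirst_tprod, headProj_cons, ← Chain.tprod_cons_sub]
      congr 2
      exact one_mul _
  exact DFunLike.congr_fun this x

/-- The difference between the identity and the homotopy formed with the extra degeneracy. -/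
def cyclicShift (n : ℕ) : Chain k A (n + 1) →+ Chain k A (n + 1) :=
  (-1 : ℤ) ^ (n + 1) •
    (((extraDegen k A n).comp (face k A R (Fin.last (n + 1))).toAddMonoidHom).comp
        (slotMap k fun m => if m = Fin.last (n + 1) then T.proj else LinearMap.id).toAddMonoidHom -
      ((T.headProj k (n + 1)).toAddMonoidHom.comp
        (face k A R (Fin.last (n + 2))).toAddMonoidHom).comp (extraDegen k A (n + 1)))

theorem cyclicShift_apply {n : ℕ} (x : Chain k A (n + 1)) :
    T.cyclicShift k n x = (-1 : ℤ) ^ (n + 1) •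
      (extraDegen k A n (face k A R (Fin.last (n + 1))
        (slotMap k (fun m => if m = Fin.last (n + 1) then T.proj else LinearMap.id) x)) -
      T.headProj k (n + 1) (face k A R (Fin.last (n + 2)) (extraDegen k A (n + 1) x))) := rfl

/-- The extra degeneracy contracts the quotient complex with differential Pb, up to the absorption F
and a cyclic shift. Both are dealt with later: F vanishes on the chains of interest, and the shift
is nilpotent on reduced chains. -/
theorem headProj_b_extraDegen {n : ℕ} (x : Chain k A (n + 1)) (hx : T.headProj k (n + 1) x = x) :
    T.headProj k (n + 1) (b k A R (n + 1) (extraDegen k A (n + 1) x)) +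
        extraDegen k A n (T.headProj k n (b k A R n x)) =
      x - extraDegen k A n (T.absorbFirst k n x) + T.cyclicShift k n x := by
  have h1 := T.b_headProj k x
  rw [hx] at h1
  have h2 : T.headProj k n (b k A R n x) =
      b k A R n x - T.absorbFirst k n x - T.absorbLast k n x := by
    rw [sub_sub, eq_sub_iff_add_eq, ← add_assoc]
    exact h1.symm
  -- Splitting the last factor as ρ + ν, the ν-part of the last face cancels against `absorbLast` in
  -- h2, so the shift retains only the ρ-part.
  have h3 : face k A R (Fin.last (n + 1))
      (slotMap k (fun m => if m = Fin.last (n + 1) then T.proj else LinearMap.id) x) +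
      face k A R (Fin.last (n + 1))
      (slotMap k (fun m => if m = Fin.last (n + 1) then T.nil else LinearMap.id) x) =
      face k A R (Fin.last (n + 1)) x := by
    have hu (g : A →ₗ[R] A) : (fun m => if m = Fin.last (n + 1) then g else LinearMap.id) =
        Function.update (fun _ => LinearMap.id) (Fin.last (n + 1)) g := by
      funext m
      by_cases h : m = Fin.last (n + 1)
      · subst h; simp
      · simp [h]
    rw [← map_add, hu, hu, ← slotMap_update_add]
    congr 1
    refine Eq.trans ?_ (slotMap_id k (R := R) x)
    congr 2
    rw [Function.update_eq_self_iff]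
    ext a
    exact T.proj_add_nil a
  rw [h2, b_extraDegen, cyclicShift_apply, absorbLast, LinearMap.smul_apply, LinearMap.comp_apply,
    ← h3]
  simp only [map_sub, map_add, map_zsmul, hx, headProj_extraDegen, smul_sub, smul_add]
  abel

theorem cyclicShift_tprod {n : ℕ} (a : Fin (n + 2) → A) :
    T.cyclicShift k n (Chain.tprod k A a) = (-1 : ℤ) ^ (n + 1) •
      (Chain.tprod k A (Fin.cons 1 (Fin.cons (T.proj (a (Fin.last (n + 1))) * a 0)
        fun j : Fin n => a j.castSucc.succ)) -
      Chain.tprod k A (Fin.cons (T.proj (a (Fin.last (n + 1))))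
        fun j : Fin (n + 1) => a j.castSucc)) := by
  rw [cyclicShift_apply, slotMap_tprod, face_last_tprod, extraDegen_tprod, extraDegen_tprod,
    face_last_tprod, headProj_cons]
  congr 3
  · congr 2
    · simp [Fin.ext_iff]
    · funext j
      have := j.isLt
      simp [Fin.ext_iff, this.ne]
  · congr 2
    · exact mul_one _

/-- The shift moves a_m to position m + 1 and returns the last factor to the front only through ρ,
where a further ρ changes nothing. Iterating, a chain killed by ρ on its tail is eventually killed
by the shift. -/
theorem tailProj_cyclicShift {n j : ℕ} (h1 : 1 ≤ j) (hj : j ≤ n + 1) (x : Chain k A (n + 1)) :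
    T.tailProj k (j + 1) (n + 1) (T.cyclicShift k n x) =
      T.cyclicShift k n (T.tailProj k j (n + 1) x) := by
  have : (T.tailProj k (j + 1) (n + 1)).toAddMonoidHom.comp (T.cyclicShift k n) =
      (T.cyclicShift k n).comp (T.tailProj k j (n + 1)).toAddMonoidHom :=
    Chain.addHom_ext k fun a => by
      change T.tailProj k (j + 1) (n + 1) (T.cyclicShift k n (Chain.tprod k A a)) =
        T.cyclicShift k n (T.tailProj k j (n + 1) (Chain.tprod k A a))
      rw [cyclicShift_tprod, tailProj, tailProj, slotMap_tprod, cyclicShift_tprod, map_zsmul,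
        map_sub, slotMap_tprod, slotMap_tprod]
      have h0 : ¬ j ≤ 0 := by omega
      congr 3
      · funext m
        refine Fin.cases ?_ (fun m => Fin.cases ?_ (fun m => ?_) m) m
        · simp
        · simp [h0, hj, proj_proj]
        · simp
      · funext m
        refine Fin.cases ?_ (fun m => ?_) m
        · simp [hj, proj_proj]
        · simp
  exact DFunLike.congr_fun this x

namespace Frame

variable {T} {ι : Type} [Fintype ι] (B : T.Frame ι)

/-- The head is multiplied by e_i, which lies in ker ρ. With `homotopy_headProj` this says that h
maps the quotient complex into the chains with head in ker ρ. -/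
theorem headProj_homotopy {n : ℕ} (x : Chain k A n) :
    T.headProj k n (B.homotopy k n x) = 0 := by
  simp only [homotopy, skewLie, LinearMap.sum_apply, map_sum]
  refine Finset.sum_eq_zero fun i _ => Finset.sum_eq_zero fun j _ => ?_
  rw [headProj, slotMap_slotMap]
  refine slotMap_eq_zero k (i := 0) ?_ x
  ext a
  simp [skewSlot_zero, proj_mul, B.proj_e]

theorem homotopy_headProj {n : ℕ} (x : Chain k A n) :
    B.homotopy k n (T.headProj k n x) = B.homotopy k n x := by
  simp only [homotopy, skewLie, LinearMap.sum_apply]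
  refine Finset.sum_congr rfl fun i _ => Finset.sum_congr rfl fun j _ => ?_
  rw [headProj, slotMap_slotMap]
  congr 2
  funext m
  ext a
  by_cases h : m = 0
  · subst h
    simp [skewSlot_zero, ← B.e_mul]
  · simp [h]

/-- Multiplication by e_i changes the sign at factor 0 and D_i changes it at the marked factor; the
two changes cancel, and the remaining factors carry `sgn` or the identity. -/
theorem parity_homotopy {n : ℕ} (x : Chain k A n) :
    T.parity k n (B.homotopy k n x) = B.homotopy k n (T.parity k n x) := by
  have key (j : ℕ) (hj : j < n) (i : ι) (x : Chain k A n) :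
      T.parity k n (slotMap k (fun m => skewSlot T.sgn (B.e i) (B.D i) (j + 1) m) x) =
        slotMap k (fun m => skewSlot T.sgn (B.e i) (B.D i) (j + 1) m) (T.parity k n x) := by
    have : T.parity k n ∘ₗ slotMap k (fun m => skewSlot T.sgn (B.e i) (B.D i) (j + 1) m) =
        slotMap k (fun m => skewSlot T.sgn (B.e i) (B.D i) (j + 1) m) ∘ₗ T.parity k n :=
      Chain.linearMap_ext k fun a => by
        simp only [LinearMap.comp_apply, parity, slotMap_tprod]
        refine Chain.tprod_congr_neg_neg k (p := 0) (q := ⟨j + 1, by omega⟩) ?_ ?_ ?_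
          fun m hm hm' => ?_
        · simp [Fin.ext_iff]
        · simp only [Fin.val_zero, skewSlot_zero, LinearMap.mulLeft_apply]
          rw [sgn_mul, B.sgn_e, neg_mul]
        · simp only
          rw [skewSlot_self _ _ _ j.succ_pos, B.sgn_D, B.D_sgn, neg_neg]
        · have h0 : (m : ℕ) ≠ 0 := fun h => hm (Fin.ext h)
          have h1 : (m : ℕ) ≠ j + 1 := fun h => hm' (Fin.ext h)
          rw [skewSlot, if_neg h0, if_neg h1]
          split_ifs <;> rfl
    exact LinearMap.congr_fun this x
  simp only [homotopy, skewLie, LinearMap.sum_apply, map_sum]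
  exact Finset.sum_congr rfl fun i _ => Finset.sum_congr rfl fun j hj =>
    key j (Finset.mem_range.1 hj) i x

end Frame

end SqZeroRetract

/-! ### Homology as subquotients, and criteria for isomorphisms -/

section Subquot

variable {R : Type u} [CommRing R] {X Y Y' : Type u} [AddCommGroup X] [Module R X]
  [AddCommGroup Y] [Module R Y] [AddCommGroup Y'] [Module R Y']

/-- The quotient of cycles `Z` by the boundaries `B` which lie in `Z`. -/
abbrev Subquot (Z B : Submodule R X) : Type u := Z ⧸ B.submoduleOf Z

/-- The map of subquotients induced by a linear map. -/
def Subquot.map (f : X →ₗ[R] Y) {Z B : Submodule R X} {Z' B' : Submodule R Y}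
    (hZ : ∀ x ∈ Z, f x ∈ Z') (hB : ∀ x ∈ B, f x ∈ B') : Subquot Z B →ₗ[R] Subquot Z' B' :=
  Submodule.mapQ _ _ (f.restrict hZ) fun x hx => hB x hx

theorem Subquot.mk_eq_zero {Z B : Submodule R X} {x : Z} :
    (Submodule.Quotient.mk x : Subquot Z B) = 0 ↔ (x : X) ∈ B := by
  rw [Submodule.Quotient.mk_eq_zero]
  rfl

theorem Subquot.mk_eq_mk {Z B : Submodule R X} {x y : Z} :
    (Submodule.Quotient.mk x : Subquot Z B) = Submodule.Quotient.mk y ↔ (x - y : X) ∈ B := by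
  rw [Submodule.Quotient.eq]
  rfl

/-- A criterion for two linear maps to identify a subquotient with a product of subquotients. -/
def Subquot.prodEquiv (f : X →ₗ[R] Y) (g : X →ₗ[R] Y') {Z B : Submodule R X}
    {Z₁ B₁ : Submodule R Y} {Z₂ B₂ : Submodule R Y'}
    (hZ₁ : ∀ x ∈ Z, f x ∈ Z₁) (hB₁ : ∀ x ∈ B, f x ∈ B₁)
    (hZ₂ : ∀ x ∈ Z, g x ∈ Z₂) (hB₂ : ∀ x ∈ B, g x ∈ B₂)
    (inj : ∀ x ∈ Z, f x ∈ B₁ → g x ∈ B₂ → x ∈ B)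
    (surj : ∀ y ∈ Z₁, ∀ y' ∈ Z₂, ∃ x ∈ Z, f x = y ∧ g x = y') :
    Subquot Z B ≃ₗ[R] Subquot Z₁ B₁ × Subquot Z₂ B₂ :=
  LinearEquiv.ofBijective ((Subquot.map f hZ₁ hB₁).prod (Subquot.map g hZ₂ hB₂)) <| by
    constructor
    · rw [injective_iff_map_eq_zero]
      rintro ⟨x⟩ hx
      have h := Prod.ext_iff.1 hx
      exact Subquot.mk_eq_zero.2
        (inj x x.2 (Subquot.mk_eq_zero.1 h.1) (Subquot.mk_eq_zero.1 h.2))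
    · rintro ⟨⟨y⟩, ⟨y'⟩⟩
      obtain ⟨x, hx, h, h'⟩ := surj y y.2 y' y'.2
      exact ⟨Submodule.Quotient.mk ⟨x, hx⟩, Prod.ext
        (congrArg Submodule.Quotient.mk (Subtype.ext h))
        (congrArg Submodule.Quotient.mk (Subtype.ext h'))⟩

/-- A criterion for a linear map to induce an isomorphism of subquotients. -/
def Subquot.equiv (f : X →ₗ[R] Y) {Z B : Submodule R X} {Z' B' : Submodule R Y}
    (hZ : ∀ x ∈ Z, f x ∈ Z') (hB : ∀ x ∈ B, f x ∈ B')
    (inj : ∀ x ∈ Z, f x ∈ B' → x ∈ B) (surj : ∀ y ∈ Z', ∃ x ∈ Z, y - f x ∈ B') :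
    Subquot Z B ≃ₗ[R] Subquot Z' B' :=
  LinearEquiv.ofBijective (Subquot.map f hZ hB) <| by
    constructor
    · rw [injective_iff_map_eq_zero]
      rintro ⟨x⟩ hx
      exact Subquot.mk_eq_zero.2 (inj x x.2 (Subquot.mk_eq_zero.1 hx))
    · rintro ⟨y⟩
      obtain ⟨x, hx, h⟩ := surj y y.2
      exact ⟨Submodule.Quotient.mk ⟨x, hx⟩, (Subquot.mk_eq_mk.2 h).symm⟩

/-- If `x_i`, `l_i` form a dual basis of `L`, an action `μ` of `L` from `X` to `Y` with a
corresponding family of maps back identifies `L ⊗ X` with `Y`. -/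
def tensorEquivOfDualBasis {L : Type u} [AddCommGroup L] [Module R L] {ι : Type} [Fintype ι]
    (x : ι → L) (l : ι → L →ₗ[R] R) (hx : ∀ y, ∑ i, l i y • x i = y)
    (μ : L →ₗ[R] X →ₗ[R] Y) (ν : ι → Y →ₗ[R] X) (h₁ : ∀ y, ∑ i, μ (x i) (ν i y) = y)
    (h₂ : ∀ i y z, ν i (μ y z) = l i y • z) : L ⊗[R] X ≃ₗ[R] Y :=
  LinearEquiv.ofLinearMap (TensorProduct.lift μ) (∑ i, TensorProduct.mk R L X (x i) ∘ₗ ν i)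
    (by ext y; simpa using h₁ y)
    (by
      refine TensorProduct.ext' fun y z => ?_
      simp only [LinearMap.comp_apply, TensorProduct.lift.tmul, LinearMap.sum_apply, h₂,
        TensorProduct.mk_apply, LinearMap.id_apply, TensorProduct.tmul_smul]
      simp only [TensorProduct.smul_tmul', ← TensorProduct.sum_tmul, hx])

/-- The version of `tensorEquivOfDualBasis` for subquotients. -/
def Subquot.tensorEquiv {L : Type u} [AddCommGroup L] [Module R L] {ι : Type} [Fintype ι]
    (x : ι → L) (l : ι → L →ₗ[R] R) (hx : ∀ y, ∑ i, l i y • x i = y)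
    (μ : L →ₗ[R] X →ₗ[R] Y) (ν : ι → Y →ₗ[R] X)
    {Z B : Submodule R X} {Z' B' : Submodule R Y}
    (hZ : ∀ y, ∀ z ∈ Z, μ y z ∈ Z') (hB : ∀ y, ∀ z ∈ B, μ y z ∈ B')
    (hZ' : ∀ i, ∀ z ∈ Z', ν i z ∈ Z) (hB' : ∀ i, ∀ z ∈ B', ν i z ∈ B)
    (h₁ : ∀ z ∈ Z', ∑ i, μ (x i) (ν i z) = z)
    (h₂ : ∀ i y, ∀ z ∈ Z, ν i (μ y z) = l i y • z) :
    L ⊗[R] Subquot Z B ≃ₗ[R] Subquot Z' B' :=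
  tensorEquivOfDualBasis x l hx
    { toFun := fun y => Subquot.map (μ y) (hZ y) (hB y)
      map_add' := fun y y' => by
        refine LinearMap.ext fun z => ?_
        obtain ⟨z, rfl⟩ := Submodule.Quotient.mk_surjective _ z
        refine congrArg Submodule.Quotient.mk (Subtype.ext ?_)
        change μ (y + y') z = μ y z + μ y' z
        rw [map_add, LinearMap.add_apply]
      map_smul' := fun r y => by
        refine LinearMap.ext fun z => ?_
        obtain ⟨z, rfl⟩ := Submodule.Quotient.mk_surjective _ z
        refine congrArg Submodule.Quotient.mk (Subtype.ext ?_)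
        change μ (r • y) z = r • μ y z
        rw [map_smul, LinearMap.smul_apply] }
    (fun i => Subquot.map (ν i) (hZ' i) (hB' i))
    (fun z => by
      obtain ⟨z, rfl⟩ := Submodule.Quotient.mk_surjective _ z
      have (i : ι) : (Subquot.map (μ (x i)) (hZ (x i)) (hB (x i)))
          (Subquot.map (ν i) (hZ' i) (hB' i) (Submodule.Quotient.mk z)) =
          (B'.submoduleOf Z').mkQ ⟨μ (x i) (ν i z), hZ _ _ (hZ' _ _ z.2)⟩ := rfl
      simp only [LinearMap.coe_mk, AddHom.coe_mk, this]
      rw [← map_sum]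
      refine congrArg Submodule.Quotient.mk (Subtype.ext ?_)
      rw [AddSubmonoidClass.coe_finsetSum]
      exact h₁ z z.2)
    (fun i y z => by
      obtain ⟨z, rfl⟩ := Submodule.Quotient.mk_surjective _ z
      exact congrArg Submodule.Quotient.mk (Subtype.ext (h₂ i y z z.2)))

end Subquot

section Boundary

variable (k : Type u) [CommRing k] (R : Type u) [CommRing R]
  (A : Type u) [CommRing A] [Algebra k A] [Algebra R A]

/-- The boundary `C_n(A) → C_{n-1}(A)`, which is `0` for `n = 0`. -/
def bd : (n : ℕ) → Chain k A n →ₗ[R] Chain k A (n - 1)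
  | 0 => 0
  | n + 1 => b k A R n

theorem b_b_apply {n : ℕ} (x : Chain k A (n + 2)) : b k A R n (b k A R (n + 1) x) = 0 :=
  LinearMap.congr_fun (b_b k A R n) x

theorem bd_b {n : ℕ} (x : Chain k A (n + 1)) : bd k R A n (b k A R n x) = 0 := by
  cases n with
  | zero => rfl
  | succ n => exact b_b_apply k R A x

end Boundary

/-! ### The nil, projective and reduced complexes, and absorption as an isomorphism on homology -/

namespace SqZeroRetract

variable (k : Type u) [CommRing k] {R : Type u} [CommRing R] [Algebra k R]
  {A : Type u} [CommRing A] [Algebra k A] [Algebra R A] [IsScalarTower k R A]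
  (T : SqZeroRetract R A)

/-- The chains of parity `ε` whose first factor lies in `ker ρ`. -/
def nilPart (ε : ℤ) (n : ℕ) : Submodule R (Chain k A n) :=
  LinearMap.ker (T.headProj k n) ⊓ LinearMap.ker (T.parity k n - ε • LinearMap.id)

/-- The chains of parity `ε` whose first factor lies in the image of `ρ`. -/
def projPart (ε : ℤ) (n : ℕ) : Submodule R (Chain k A n) :=
  LinearMap.ker (T.headProj k n - LinearMap.id) ⊓
    LinearMap.ker (T.parity k n - ε • LinearMap.id)

/-- The chains of parity `ε` whose first factor lies in the image of `ρ` and which vanish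
under `ρ`. -/
def reducedPart (ε : ℤ) (n : ℕ) : Submodule R (Chain k A n) :=
  T.projPart k ε n ⊓ LinearMap.ker (T.allProj k n)

variable {k T} in
theorem mem_nilPart {ε : ℤ} {n : ℕ} {x : Chain k A n} :
    x ∈ T.nilPart k ε n ↔ T.headProj k n x = 0 ∧ T.parity k n x = ε • x := by
  simp [nilPart, sub_eq_zero]

variable {k T} in
theorem mem_projPart {ε : ℤ} {n : ℕ} {x : Chain k A n} :
    x ∈ T.projPart k ε n ↔ T.headProj k n x = x ∧ T.parity k n x = ε • x := by
  simp [projPart, sub_eq_zero]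

variable {k T} in
theorem mem_reducedPart {ε : ℤ} {n : ℕ} {x : Chain k A n} :
    x ∈ T.reducedPart k ε n ↔
      (T.headProj k n x = x ∧ T.parity k n x = ε • x) ∧ T.allProj k n x = 0 := by
  rw [reducedPart, Submodule.mem_inf, mem_projPart, LinearMap.mem_ker]

/-- The homology of the subcomplex `nilPart`. -/
abbrev nilHomology (ε : ℤ) (n : ℕ) : Type u :=
  Subquot (T.nilPart k ε n ⊓ LinearMap.ker (bd k R A n))
    ((T.nilPart k ε (n + 1)).map (b k A R n))

/-- The homology of the quotient complex `projPart`. -/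
abbrev projHomology (ε : ℤ) (n : ℕ) : Type u :=
  Subquot (T.projPart k ε n ⊓ LinearMap.ker (T.headProj k (n - 1) ∘ₗ bd k R A n))
    ((T.projPart k ε (n + 1)).map (T.headProj k n ∘ₗ b k A R n))

/-- The homology of the quotient complex `reducedPart`. -/
abbrev reducedHomology (ε : ℤ) (n : ℕ) : Type u :=
  Subquot (T.reducedPart k ε n ⊓ LinearMap.ker (T.headProj k (n - 1) ∘ₗ bd k R A n))
    ((T.reducedPart k ε (n + 1)).map (T.headProj k n ∘ₗ b k A R n))

/-- The homology of the kernel of `ρ` on the Hochschild complex. -/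
abbrev kerHomology (n : ℕ) : Type u :=
  Subquot (LinearMap.ker (T.allProj k n) ⊓ LinearMap.ker (bd k R A n))
    ((LinearMap.ker (T.allProj k (n + 1))).map (b k A R n))

/-- The error terms of `b_headProj` are killed by P. So b preserves the chains with head in ker ρ,
and Pb is the differential of the quotient complex. -/
theorem headProj_b_headProj {n : ℕ} (x : Chain k A (n + 1)) :
    T.headProj k n (b k A R n (T.headProj k (n + 1) x)) = T.headProj k n (b k A R n x) := by
  rw [b_headProj, map_add, map_add, headProj_headProj, headProj_absorbFirst,
    headProj_absorbLast, add_zero, add_zero]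

theorem absorbFirst_headProj_b {n : ℕ} (x : Chain k A (n + 2)) :
    T.absorbFirst k n (T.headProj k (n + 1) (b k A R (n + 1) x)) =
      -b k A R n (T.absorbFirst k (n + 1) x) := by
  rw [absorbFirst_headProj, absorbFirst_b]

theorem allProj_eq_zero_of_headProj {n : ℕ} {x : Chain k A n} (h : T.headProj k n x = 0) :
    T.allProj k n x = 0 := by
  rw [← allProj_headProj, h, map_zero]

theorem headProj_eq_allProj_zero (x : Chain k A 0) : T.headProj k 0 x = T.allProj k 0 x := by
  rw [headProj, allProj]
  congr 2
  funext j
  rw [if_pos (Fin.ext (by omega))]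

theorem reducedPart_zero {ε : ℤ} {x : Chain k A 0} (hx : x ∈ T.reducedPart k ε 0) : x = 0 := by
  rw [mem_reducedPart] at hx
  rw [← hx.1.1, headProj_eq_allProj_zero, hx.2]

theorem extraDegen_mem {ε : ℤ} {n : ℕ} {x : Chain k A n} (h : T.parity k n x = ε • x)
    (h' : T.allProj k n x = 0) : extraDegen k A n x ∈ T.reducedPart k ε (n + 1) := by
  rw [mem_reducedPart, headProj_extraDegen, parity_extraDegen, allProj_extraDegen, h, h', map_zsmul,
    map_zero]
  exact ⟨⟨rfl, rfl⟩, rfl⟩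

theorem absorbFirst_mem {ε : ℤ} {n : ℕ} {x : Chain k A (n + 1)}
    (h : T.parity k (n + 1) x = ε • x) : T.absorbFirst k n x ∈ T.nilPart k ε n := by
  rw [mem_nilPart, headProj_absorbFirst, parity_absorbFirst, h, map_zsmul]
  exact ⟨rfl, rfl⟩

theorem headProj_b_mem {ε : ℤ} {n : ℕ} {x : Chain k A (n + 1)}
    (hx : x ∈ T.reducedPart k ε (n + 1)) :
    T.headProj k n (b k A R n x) ∈ T.reducedPart k ε n := by
  rw [mem_reducedPart] at hx ⊢
  rw [headProj_headProj, parity_headProj, parity_b, hx.1.2, allProj_headProj, allProj_b, hx.2,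
    map_zsmul, map_zsmul, map_zero]
  exact ⟨⟨rfl, rfl⟩, rfl⟩

/-- Acyclicity of ker F in the reduced complex, by induction on d, the number of shifts left until
the tail is empty. For a cycle x in ker F, the contraction formula gives PbEx = x + Nx with E the
extra degeneracy and N the shift. Here Nx is again a cycle in ker F, with the vanishing tail
starting one place later; if w bounds Nx then Ex - w bounds x. -/
theorem exists_of_tailProj_eq_zero {ε : ℤ} {n : ℕ} (d : ℕ) : ∀ {j : ℕ} {x : Chain k A (n + 1)},
    j + d = n + 2 → 1 ≤ j → T.tailProj k j (n + 1) x = 0 → x ∈ T.reducedPart k ε (n + 1) →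
    T.headProj k n (b k A R n x) = 0 → T.absorbFirst k n x = 0 →
    ∃ w ∈ T.reducedPart k ε (n + 2), T.absorbFirst k (n + 1) w = 0 ∧
      T.headProj k (n + 1) (b k A R (n + 1) w) = x := by
  induction d with
  | zero =>
    intro j x hj _ h _ _ _
    rw [tailProj_of_gt k T (by omega)] at h
    exact ⟨0, Submodule.zero_mem _, map_zero _, by simp [h]⟩
  | succ d ih =>
    intro j x hj h1 h hx hb hF
    have hx' := mem_reducedPart.1 hx
    have key := T.headProj_b_extraDegen k x hx'.1.1
    rw [hb, hF, map_zero, add_zero, sub_zero] at key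
    have hE := T.extraDegen_mem k hx'.1.2 hx'.2
    have hFE : T.absorbFirst k (n + 1) (extraDegen k A (n + 1) x) = 0 := by
      rw [absorbFirst_extraDegen, hx'.1.1, sub_self]
    have hN : T.cyclicShift k n x =
        T.headProj k (n + 1) (b k A R (n + 1) (extraDegen k A (n + 1) x)) - x := by
      rw [key, add_sub_cancel_left]
    obtain ⟨w, hw, hFw, hbw⟩ := ih (j := j + 1) (x := T.cyclicShift k n x) (by omega) (by omega)
      (by rw [tailProj_cyclicShift k T h1 (by omega), h, map_zero])
      (by rw [hN]; exact Submodule.sub_mem _ (T.headProj_b_mem k hE) hx)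
      (by rw [hN, map_sub, map_sub, headProj_b_headProj, b_b_apply, map_zero, hb, sub_zero])
      (by rw [hN, map_sub, absorbFirst_headProj_b, hFE, map_zero, neg_zero, hF, sub_zero])
    refine ⟨extraDegen k A (n + 1) x - w, Submodule.sub_mem _ hE hw, ?_, ?_⟩
    · rw [map_sub, hFE, hFw, sub_zero]
    · rw [map_sub, map_sub, hbw, key, add_sub_cancel_right]

theorem exists_of_absorbFirst_eq_zero {ε : ℤ} {n : ℕ} {x : Chain k A (n + 1)}
    (hx : x ∈ T.reducedPart k ε (n + 1)) (hb : T.headProj k n (b k A R n x) = 0)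
    (hF : T.absorbFirst k n x = 0) :
    ∃ w ∈ T.reducedPart k ε (n + 2), T.absorbFirst k (n + 1) w = 0 ∧
      T.headProj k (n + 1) (b k A R (n + 1) w) = x := by
  have hx' := mem_reducedPart.1 hx
  refine T.exists_of_tailProj_eq_zero k (n + 1) (j := 1) (by omega) le_rfl ?_ hx hb hF
  rw [← hx'.1.1, tailProj_one_headProj, hx'.2]

/-- Injectivity of F on homology. If Fx = bs, adding to x the boundary of the extra degeneracy of s,
whose absorption is -bs, moves x into ker F, where cycles bound. -/
theorem exists_of_absorbFirst_eq_b {ε : ℤ} {n : ℕ} {x : Chain k A (n + 1)}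
    (hx : x ∈ T.reducedPart k ε (n + 1)) (hb : T.headProj k n (b k A R n x) = 0)
    {s : Chain k A (n + 1)} (hs : s ∈ T.nilPart k ε (n + 1))
    (hF : T.absorbFirst k n x = b k A R n s) :
    ∃ w ∈ T.reducedPart k ε (n + 2), T.headProj k (n + 1) (b k A R (n + 1) w) = x := by
  have hs' := mem_nilPart.1 hs
  have hE := T.extraDegen_mem k hs'.2 (T.allProj_eq_zero_of_headProj k hs'.1)
  obtain ⟨w, hw, -, h⟩ := T.exists_of_absorbFirst_eq_zero k
    (x := x + T.headProj k (n + 1) (b k A R (n + 1) (extraDegen k A (n + 1) s)))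
    (Submodule.add_mem _ hx (T.headProj_b_mem k hE))
    (by rw [map_add, map_add, headProj_b_headProj, b_b_apply, hb, map_zero, add_zero])
    (by rw [map_add, absorbFirst_headProj_b, absorbFirst_extraDegen, hs'.1, sub_zero, hF,
          add_neg_cancel])
  exact ⟨w - extraDegen k A (n + 1) s, Submodule.sub_mem _ hw hE, by
    rw [map_sub, map_sub, h, add_sub_cancel_right]⟩

/-- Surjectivity of F on homology. The extra degeneracy of s is a preimage because s has head in ker
ρ; its boundary is a cycle in ker F, so an element of ker F corrects the preimage to a cycle. -/
theorem exists_absorbFirst_eq {ε : ℤ} {n : ℕ} {s : Chain k A n} (hs : s ∈ T.nilPart k ε n)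
    (hb : bd k R A n s = 0) :
    ∃ x ∈ T.reducedPart k ε (n + 1), T.headProj k n (b k A R n x) = 0 ∧
      T.absorbFirst k n x = s := by
  have hs' := mem_nilPart.1 hs
  have hE := T.extraDegen_mem k hs'.2 (T.allProj_eq_zero_of_headProj k hs'.1)
  have hFE : T.absorbFirst k n (extraDegen k A n s) = s := by
    rw [absorbFirst_extraDegen, hs'.1, sub_zero]
  cases n with
  | zero => exact ⟨_, hE, T.reducedPart_zero k (T.headProj_b_mem k hE), hFE⟩
  | succ n =>
    obtain ⟨w, hw, hFw, h⟩ := T.exists_of_absorbFirst_eq_zero k (T.headProj_b_mem k hE)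
      (by rw [headProj_b_headProj, b_b_apply, map_zero])
      (by
        rw [absorbFirst_headProj_b, hFE]
        exact neg_eq_zero.2 hb)
    exact ⟨_, Submodule.sub_mem _ hE hw, by rw [map_sub, map_sub, h, sub_self],
      by rw [map_sub, hFE, hFw, sub_zero]⟩

/-- `absorbFirst` identifies the homology of `reducedPart` with that of `nilPart`. -/
def reducedEquiv (ε : ℤ) (n : ℕ) :
    T.reducedHomology k ε (n + 1) ≃ₗ[R] T.nilHomology k ε n :=
  Subquot.equiv (T.absorbFirst k n)
    (by
      rintro x ⟨hx, hb⟩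
      refine ⟨T.absorbFirst_mem k (mem_reducedPart.1 hx).1.2, ?_⟩
      cases n with
      | zero => rfl
      | succ n =>
        have hb' : T.headProj k (n + 1) (b k A R (n + 1) x) = 0 := hb
        have := T.absorbFirst_headProj_b k x
        rw [hb', map_zero] at this
        exact neg_eq_zero.1 this.symm)
    (by
      rintro _ ⟨w, hw, rfl⟩
      refine ⟨-T.absorbFirst k (n + 1) w,
        Submodule.neg_mem _ (T.absorbFirst_mem k (mem_reducedPart.1 hw).1.2), ?_⟩
      rw [map_neg]
      exact (T.absorbFirst_headProj_b k w).symm)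
    (by
      rintro x ⟨hx, hb⟩ ⟨s, hs, h⟩
      exact T.exists_of_absorbFirst_eq_b k hx hb hs h.symm)
    (by
      rintro s ⟨hs, hb⟩
      obtain ⟨x, hx, hbx, h⟩ := T.exists_absorbFirst_eq k hs hb
      exact ⟨x, ⟨hx, hbx⟩, by rw [h, sub_self]; exact Submodule.zero_mem _⟩)

theorem subsingleton_reducedHomology_zero (ε : ℤ) : Subsingleton (T.reducedHomology k ε 0) := by
  refine subsingleton_of_forall_eq 0 fun x => ?_
  obtain ⟨x, rfl⟩ := Submodule.Quotient.mk_surjective _ x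
  have : x = 0 := Subtype.ext (T.reducedPart_zero k x.2.1)
  rw [this, Submodule.Quotient.mk_zero]

end SqZeroRetract

/-! ### Dividing by two: acyclicity of the even part and splitting of the odd part -/

theorem half_smul {R M : Type*} [Ring R] [AddCommGroup M] [Module R M] {c : R} (hc : c + c = 1)
    (x : M) : c • (x + x) = x := by
  rw [smul_add, ← add_smul, hc, one_smul]

theorem eq_zero_of_add_self {R M : Type*} [Ring R] [AddCommGroup M] [Module R M] {c : R}
    (hc : c + c = 1) {x : M} (h : x + x = 0) : x = 0 := by
  rw [← half_smul hc x, h, smul_zero]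

namespace SqZeroRetract

variable (k : Type u) [CommRing k] {R : Type u} [CommRing R] [Algebra k R]
  {A : Type u} [CommRing A] [Algebra k A] [Algebra R A] [IsScalarTower k R A]
  {T : SqZeroRetract R A} {ι : Type} [Fintype ι] (B : T.Frame ι)

/-- On odd chains P and h have the same commutator F + G with b, so their difference is a chain map.
-/
theorem Frame.bd_headProj_sub_homotopy {n : ℕ} {x : Chain k A n} (hx : T.parity k n x = -x) :
    bd k R A n (T.headProj k n x - B.homotopy k n x) =
      T.headProj k (n - 1) (bd k R A n x) - B.homotopy k (n - 1) (bd k R A n x) := by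
  cases n with
  | zero => simp [bd]
  | succ n =>
    change b k A R n _ = T.headProj k n (b k A R n x) - B.homotopy k n (b k A R n x)
    rw [map_sub, b_headProj, B.b_homotopy k, hx, map_neg]
    abel

/-- On even chains the commutators are F + G and F - G, so G cancels in the sum. -/
theorem Frame.b_headProj_add_homotopy {n : ℕ} {x : Chain k A (n + 1)}
    (hx : T.parity k (n + 1) x = x) :
    b k A R n (T.headProj k (n + 1) x + B.homotopy k (n + 1) x) =
      T.headProj k n (b k A R n x) + B.homotopy k n (b k A R n x) +
        (T.absorbFirst k n x + T.absorbFirst k n x) := by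
  rw [map_add, b_headProj, B.b_homotopy k, hx]
  abel

variable {c : R} (hc : c + c = 1)

include B hc in
-- Lift x along F to a reduced cycle y of the quotient complex; then b(y + hy) = 2Fy = 2x.
theorem Frame.exists_b_eq_of_nilPart {n : ℕ} {x : Chain k A n} (hx : x ∈ T.nilPart k 1 n)
    (hb : bd k R A n x = 0) : ∃ w, T.allProj k (n + 1) w = 0 ∧ b k A R n w = x := by
  obtain ⟨y, hy, hby, hF⟩ := T.exists_absorbFirst_eq k hx hb
  have hy' := mem_reducedPart.1 hy
  have h := B.b_headProj_add_homotopy k (x := y) (by rw [hy'.1.2, one_smul])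
  -- The term h(by) vanishes along with P(by), as h depends only on the head projection.
  rw [hy'.1.1, hby, ← B.homotopy_headProj k (x := b k A R n y), hby, map_zero, hF, zero_add,
    zero_add] at h
  refine ⟨c • (y + B.homotopy k (n + 1) y), ?_, ?_⟩
  · rw [map_smul, map_add, hy'.2,
      T.allProj_eq_zero_of_headProj k (B.headProj_homotopy k y), add_zero, smul_zero]
  · rw [map_smul, h, half_smul hc]

include B hc in
-- The long exact sequence done by hand: F(Px) is a boundary, so Px bounds in the quotient complex.
-- Subtracting a lift of that bound leaves a cycle with head in ker ρ, which bounds by the previous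
-- lemma.
theorem Frame.exists_b_eq_of_even {n : ℕ} {x : Chain k A n} (hx : T.allProj k n x = 0)
    (hp : T.parity k n x = x) (hb : bd k R A n x = 0) :
    ∃ w, T.allProj k (n + 1) w = 0 ∧ b k A R n w = x := by
  have hPx : T.headProj k n x ∈ T.reducedPart k 1 n := by
    rw [mem_reducedPart, headProj_headProj, parity_headProj, allProj_headProj, hp, one_smul]
    exact ⟨⟨rfl, rfl⟩, hx⟩
  obtain ⟨w, hw, h⟩ : ∃ w ∈ T.reducedPart k 1 (n + 1),
      T.headProj k n (b k A R n w) = T.headProj k n x := by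
    cases n with
    | zero => exact ⟨0, Submodule.zero_mem _, by simp [T.reducedPart_zero k hPx]⟩
    | succ n =>
      have hb' : b k A R n x = 0 := hb
      -- For an even cycle, b(Px + hx) = 2Fx. Subtracting the cycle x does not affect the boundary
      -- and puts Px + hx into ker P, so half of Px - x + hx is the required primitive of Fx.
      refine T.exists_of_absorbFirst_eq_b k hPx ?_
        (s := c • (T.headProj k (n + 1) x - x + B.homotopy k (n + 1) x)) ?_ ?_
      · rw [headProj_b_headProj, hb', map_zero]
      · refine Submodule.smul_mem _ _ (mem_nilPart.2 ⟨?_, ?_⟩)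
        · rw [map_add, map_sub, headProj_headProj, sub_self, B.headProj_homotopy k, zero_add]
        · rw [map_add, map_sub, parity_headProj, B.parity_homotopy k, hp, one_smul]
      · have := B.b_headProj_add_homotopy k hp
        rw [hb', map_zero, map_zero, zero_add, zero_add] at this
        rw [absorbFirst_headProj, map_smul, sub_add_eq_add_sub, map_sub, this, hb', sub_zero,
          half_smul hc]
  have hw' := mem_reducedPart.1 hw
  obtain ⟨v, hv, hbv⟩ := B.exists_b_eq_of_nilPart k hc (x := x - b k A R n w)
    (mem_nilPart.2 ⟨by rw [map_sub, h, sub_self], by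
      rw [map_sub, hp, parity_b, hw'.1.2, one_smul, one_smul]⟩)
    (by rw [map_sub, hb, bd_b, sub_zero])
  exact ⟨v + w, by rw [map_add, hv, hw'.2, add_zero], by rw [map_add, hbv, sub_add_cancel]⟩

include hc in
-- Since ρ ∘ `sgn` = ρ, the projection of an odd chain equals its own negative.
theorem allProj_eq_zero_of_odd {n : ℕ} {x : Chain k A n} (hx : T.parity k n x = -x) :
    T.allProj k n x = 0 := by
  refine eq_zero_of_add_self hc ?_
  have := T.allProj_parity k x
  rw [hx, map_neg] at this
  nth_rw 1 [← this]
  exact neg_add_cancel _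

theorem mem_projPart_neg_one {n : ℕ} {x : Chain k A n} :
    x ∈ T.projPart k (-1) n ↔ T.headProj k n x = x ∧ T.parity k n x = -x := by
  rw [mem_projPart, neg_one_smul]

theorem mem_nilPart_neg_one {n : ℕ} {x : Chain k A n} :
    x ∈ T.nilPart k (-1) n ↔ T.headProj k n x = 0 ∧ T.parity k n x = -x := by
  rw [mem_nilPart, neg_one_smul]

include hc in
theorem projPart_neg_one (n : ℕ) : T.projPart k (-1) n = T.reducedPart k (-1) n := by
  ext x
  rw [mem_reducedPart, mem_projPart, iff_self_and]
  rintro ⟨-, h⟩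
  exact allProj_eq_zero_of_odd k hc (by rw [h, neg_one_smul])

/-- All chains of odd parity with first factor in the image of `ρ` are reduced. -/
def projEquivReduced (n : ℕ) : T.projHomology k (-1) n ≃ₗ[R] T.reducedHomology k (-1) n :=
  Subquot.equiv LinearMap.id
    (by rw [projPart_neg_one k hc]; exact fun x hx => hx)
    (by rw [projPart_neg_one k hc]; exact fun x hx => hx)
    (fun x _ hx => by rw [projPart_neg_one k hc]; exact hx)
    (by
      rw [projPart_neg_one k hc]
      exact fun x hx => ⟨x, hx, by simp⟩)

variable (T) in
/-- The projection onto the chains of odd parity, where `c = 1/2`. -/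
def oddProj (c : R) (n : ℕ) : Chain k A n →ₗ[R] Chain k A n :=
  c • (LinearMap.id - T.parity k n)

theorem oddProj_apply (c : R) {n : ℕ} (x : Chain k A n) :
    T.oddProj k c n x = c • (x - T.parity k n x) := rfl

theorem parity_oddProj (c : R) {n : ℕ} (x : Chain k A n) :
    T.parity k n (T.oddProj k c n x) = -T.oddProj k c n x := by
  rw [oddProj_apply, map_smul, map_sub, parity_parity, ← smul_neg, neg_sub]

include hc in
theorem oddProj_of_odd {n : ℕ} {x : Chain k A n} (hx : T.parity k n x = -x) :
    T.oddProj k c n x = x := by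
  rw [oddProj_apply, hx, sub_neg_eq_add, half_smul hc]

theorem oddProj_b (c : R) {n : ℕ} (x : Chain k A (n + 1)) :
    T.oddProj k c n (b k A R n x) = b k A R n (T.oddProj k c (n + 1) x) := by
  rw [oddProj_apply, oddProj_apply, map_smul, map_sub, parity_b]

theorem bd_oddProj (c : R) {n : ℕ} {x : Chain k A n} (hx : bd k R A n x = 0) :
    bd k R A n (T.oddProj k c n x) = 0 := by
  cases n with
  | zero => rfl
  | succ n =>
    have h : b k A R n x = 0 := hx
    change b k A R n _ = 0
    rw [← oddProj_b, h, map_zero]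

/-- The projection `P - h` of the odd part of the Hochschild complex. -/
def Frame.split (n : ℕ) : Chain k A n →ₗ[R] Chain k A n :=
  T.headProj k n - B.homotopy k n

theorem Frame.bd_split {n : ℕ} {x : Chain k A n} (hx : T.parity k n x = -x) :
    bd k R A n (B.split k n x) = B.split k (n - 1) (bd k R A n x) :=
  B.bd_headProj_sub_homotopy k hx

theorem Frame.b_split {n : ℕ} {x : Chain k A (n + 1)} (hx : T.parity k (n + 1) x = -x) :
    b k A R n (B.split k (n + 1) x) = B.split k n (b k A R n x) :=
  B.bd_headProj_sub_homotopy k hx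

/-- With `Frame.split_headProj` this makes P - h a section of the projection to the quotient
complex; on odd chains it is a section of complexes. -/
theorem Frame.headProj_split {n : ℕ} (x : Chain k A n) :
    T.headProj k n (B.split k n x) = T.headProj k n x := by
  rw [split, LinearMap.sub_apply, map_sub, headProj_headProj, B.headProj_homotopy k, sub_zero]

theorem Frame.split_headProj {n : ℕ} (x : Chain k A n) :
    B.split k n (T.headProj k n x) = B.split k n x := by
  rw [split, LinearMap.sub_apply, headProj_headProj, B.homotopy_headProj k, LinearMap.sub_apply]

theorem Frame.split_split {n : ℕ} (x : Chain k A n) :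
    B.split k n (B.split k n x) = B.split k n x := by
  rw [← B.split_headProj k, B.headProj_split k, B.split_headProj k]

theorem Frame.parity_split {n : ℕ} (x : Chain k A n) :
    T.parity k n (B.split k n x) = B.split k n (T.parity k n x) := by
  rw [split, LinearMap.sub_apply, map_sub, parity_headProj, B.parity_homotopy k, LinearMap.sub_apply]

/-- The even part of the kernel complex is acyclic and its odd part splits. -/
def Frame.kerEquiv (n : ℕ) :
    T.kerHomology k n ≃ₗ[R] T.nilHomology k (-1) n × T.projHomology k (-1) n :=
  Subquot.prodEquiv ((LinearMap.id - B.split k n) ∘ₗ T.oddProj k c n)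
    (T.headProj k n ∘ₗ T.oddProj k c n)
    (by
      rintro x ⟨-, hb⟩
      refine ⟨(mem_nilPart_neg_one k).2 ⟨?_, ?_⟩, ?_⟩
      · simp only [LinearMap.comp_apply, LinearMap.sub_apply, LinearMap.id_apply, map_sub,
          B.headProj_split k, sub_self]
      · simp only [LinearMap.comp_apply, LinearMap.sub_apply, LinearMap.id_apply, map_sub,
          B.parity_split k, parity_oddProj, map_neg]
        abel
      · rw [SetLike.mem_coe, LinearMap.mem_ker, LinearMap.comp_apply, LinearMap.sub_apply, map_sub,
          B.bd_split k (parity_oddProj k c x), LinearMap.id_apply, bd_oddProj k c hb, map_zero,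
          sub_zero])
    (by
      rintro _ ⟨w, -, rfl⟩
      refine ⟨(LinearMap.id - B.split k (n + 1) : Chain k A (n + 1) →ₗ[R] _) (T.oddProj k c (n + 1) w),
        (mem_nilPart_neg_one k).2 ⟨?_, ?_⟩, ?_⟩
      · simp only [LinearMap.sub_apply, LinearMap.id_apply, map_sub, B.headProj_split k, sub_self]
      · simp only [LinearMap.sub_apply, LinearMap.id_apply, map_sub,
          B.parity_split k, parity_oddProj, map_neg]
        abel
      · rw [LinearMap.comp_apply, LinearMap.sub_apply, LinearMap.sub_apply, map_sub,
          B.b_split k (parity_oddProj k c w), oddProj_b]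
        rfl)
    (by
      rintro x ⟨-, hb⟩
      refine ⟨(mem_projPart_neg_one k).2 ⟨?_, ?_⟩, ?_⟩
      · rw [LinearMap.comp_apply, headProj_headProj]
      · rw [LinearMap.comp_apply, parity_headProj, parity_oddProj, map_neg]
      · have hb' := bd_oddProj k c (T := T) hb
        cases n with
        | zero => rfl
        | succ n =>
          change T.headProj k n (b k A R n (T.headProj k (n + 1) _)) = 0
          rw [headProj_b_headProj]
          exact (congrArg (T.headProj k n) hb').trans (map_zero _))
    (by
      rintro _ ⟨w, -, rfl⟩
      refine ⟨T.headProj k (n + 1) (T.oddProj k c (n + 1) w),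
        (mem_projPart_neg_one k).2 ⟨?_, ?_⟩, ?_⟩
      · rw [headProj_headProj]
      · rw [parity_headProj, parity_oddProj, map_neg]
      · rw [LinearMap.comp_apply, headProj_b_headProj, LinearMap.comp_apply, oddProj_b])
    (by
      rintro x ⟨hx, hb⟩ ⟨s, hs, h⟩ ⟨q, hq, h'⟩
      rw [SetLike.mem_coe, mem_nilPart_neg_one] at hs
      rw [SetLike.mem_coe, mem_projPart_neg_one] at hq
      rw [SetLike.mem_coe, LinearMap.mem_ker] at hx hb
      -- The odd part is the sum of its component in ker P, equal to bs, and of its image under P -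
      -- h. The latter depends only on the head projection Pbq, hence is (P - h)(bq) = b((P - h)q).
      have hodd : T.oddProj k c n x = b k A R n (s + B.split k (n + 1) q) := by
        rw [LinearMap.comp_apply, LinearMap.comp_apply] at h'
        rw [map_add, h, B.b_split k hq.2, ← B.split_headProj k (b k A R n q), h', B.split_headProj k]
        simp
      -- What remains is the even part of x, a cycle in an acyclic complex.
      obtain ⟨w, hw, hbw⟩ := B.exists_b_eq_of_even k hc (x := x - T.oddProj k c n x)
        (by rw [map_sub, hx, allProj_eq_zero_of_odd k hc (parity_oddProj k c x), sub_zero])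
        (by
          have : x - T.oddProj k c n x = c • (x + T.parity k n x) := by
            nth_rw 1 [← half_smul hc x]
            rw [oddProj_apply, ← smul_sub]
            congr 1
            abel
          rw [this, map_smul, map_add, parity_parity, add_comm])
        (by rw [map_sub, hb, bd_oddProj k c hb, sub_zero])
      refine ⟨w + (s + B.split k (n + 1) q), ?_, ?_⟩
      · rw [SetLike.mem_coe, LinearMap.mem_ker, map_add, map_add, hw,
          allProj_eq_zero_of_odd k hc hs.2, allProj_eq_zero_of_odd k hc
            (by rw [B.parity_split k, hq.2, map_neg]), add_zero, add_zero]
      · rw [map_add, hbw, ← hodd, sub_add_cancel])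
    (by
      rintro s ⟨hs, hbs⟩ q ⟨hq, hbq⟩
      rw [SetLike.mem_coe, mem_nilPart_neg_one] at hs
      rw [SetLike.mem_coe, mem_projPart_neg_one] at hq
      have hodd : T.parity k n (s + B.split k n q) = -(s + B.split k n q) := by
        rw [map_add, hs.2, B.parity_split k, hq.2, map_neg, neg_add]
      refine ⟨s + B.split k n q, ⟨allProj_eq_zero_of_odd k hc hodd, ?_⟩, ?_, ?_⟩
      · have hbq' : T.headProj k (n - 1) (bd k R A n q) = 0 := hbq
        rw [SetLike.mem_coe, LinearMap.mem_ker, map_add, hbs, B.bd_split k hq.2,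
          ← B.split_headProj k, hbq', map_zero, add_zero]
      · rw [LinearMap.comp_apply, oddProj_of_odd k hc hodd, LinearMap.sub_apply,
          LinearMap.id_apply, map_add, B.split_split k, ← B.split_headProj k s, hs.1, map_zero,
          zero_add, add_sub_cancel_right]
      · rw [LinearMap.comp_apply, oddProj_of_odd k hc hodd, map_add, hs.1, B.headProj_split k, hq.1,
          zero_add])

end SqZeroRetract

/-! ### Operators on the zeroth factor, and splitting off L -/

section HeadMap

variable (k : Type u) [CommRing k] {R : Type u} [CommRing R] [Algebra k R]
  {A : Type u} [CommRing A] [Algebra k A] [Algebra R A] [IsScalarTower k R A]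

/-- The endomorphism `a_0 ⊗ ⋯ ⊗ a_n ↦ g a_0 ⊗ a_1 ⊗ ⋯ ⊗ a_n` of `C_n(A)`, as a linear function
of `g`. -/
def headMap (n : ℕ) : (A →ₗ[R] A) →ₗ[R] Chain k A n →ₗ[R] Chain k A n where
  toFun g := slotMap k (Function.update (fun _ => LinearMap.id) 0 g)
  map_add' g g' := LinearMap.ext fun x => slotMap_update_add k _ _ _ _ x
  map_smul' r g := Chain.linearMap_ext k fun a => by
    rw [RingHom.id_apply, LinearMap.smul_apply, slotMap_tprod, slotMap_tprod]
    refine Eq.trans ?_ (Chain.smul_tprod k A r _).symm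
    congr 1
    funext j
    by_cases h : j = 0
    · subst h; simp
    · simp [h]

theorem headMap_cons {n : ℕ} (g : A →ₗ[R] A) (u : A) (a : Fin n → A) :
    headMap k n g (Chain.tprod k A (Fin.cons u a)) = Chain.tprod k A (Fin.cons (g u) a) := by
  refine (slotMap_tprod k _ _).trans ?_
  congr 1
  funext j
  refine Fin.cases ?_ (fun j => ?_) j
  · simp
  · simp [Fin.succ_ne_zero]

theorem headMap_headMap {n : ℕ} (g g' : A →ₗ[R] A) (x : Chain k A n) :
    headMap k n g (headMap k n g' x) = headMap k n (g ∘ₗ g') x := by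
  have : headMap k n g ∘ₗ headMap k n g' = headMap k n (g ∘ₗ g') :=
    Chain.linearMap_ext k fun a => by
      obtain ⟨u, a, rfl⟩ := exists_eq_cons a
      simp only [LinearMap.comp_apply, headMap_cons]
  exact LinearMap.congr_fun this x

theorem headMap_id {n : ℕ} (x : Chain k A n) :
    headMap k n (LinearMap.id : A →ₗ[R] A) x = x := by
  have : headMap k n (LinearMap.id : A →ₗ[R] A) = LinearMap.id :=
    Chain.linearMap_ext k fun a => by
      obtain ⟨u, a, rfl⟩ := exists_eq_cons a
      simp only [headMap_cons, LinearMap.id_apply]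
  exact LinearMap.congr_fun this x

theorem slotMap_headMap {n : ℕ} (f g g' : A →ₗ[R] A) (h : f ∘ₗ g = g' ∘ₗ f) (x : Chain k A n) :
    slotMap k (fun _ => f) (headMap k n g x) = headMap k n g' (slotMap k (fun _ => f) x) := by
  refine (slotMap_slotMap k _ _ x).trans (Eq.trans ?_ (slotMap_slotMap k _ _ x).symm)
  congr 2
  funext j
  by_cases hj : j = 0
  · subst hj; simpa using h
  · simp [hj, LinearMap.comp_id, LinearMap.id_comp]

/-- Faces away from a_0 need only q ∘ p = g ∘ r; the two faces that multiply another factor into a_0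
need the second identity. Four maps are allowed so that one statement covers both multiplication by
an element of ker ρ and the functionals D_i. -/
theorem headMap_b {n : ℕ} (p q r g : A →ₗ[R] A) (hq : q ∘ₗ p = g ∘ₗ r)
    (h : ∀ u v, q (p u * v) = g (r u * v)) (x : Chain k A (n + 1)) :
    headMap k n q (b k A R n (headMap k (n + 1) p x)) =
      headMap k n g (b k A R n (headMap k (n + 1) r x)) := by
  simp only [b_apply_succ, map_add, map_sum, map_zsmul]
  have h0 : headMap k n q (face k A R (Fin.castSucc 0) (headMap k (n + 1) p x)) =
      headMap k n g (face k A R (Fin.castSucc 0) (headMap k (n + 1) r x)) := by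
    have : headMap k n q ∘ₗ face k A R (Fin.castSucc 0) ∘ₗ headMap k (n + 1) p =
        headMap k n g ∘ₗ face k A R (Fin.castSucc 0) ∘ₗ headMap k (n + 1) r :=
      Chain.linearMap_ext k fun a => by
        obtain ⟨u, a, rfl⟩ := exists_eq_cons a
        simp only [LinearMap.comp_apply, headMap_cons, face_zero_tprod]
        congr 2
        exact h u _
    exact LinearMap.congr_fun this x
  have hl : headMap k n q (face k A R (Fin.last (n + 1)) (headMap k (n + 1) p x)) =
      headMap k n g (face k A R (Fin.last (n + 1)) (headMap k (n + 1) r x)) := by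
    have : headMap k n q ∘ₗ face k A R (Fin.last (n + 1)) ∘ₗ headMap k (n + 1) p =
        headMap k n g ∘ₗ face k A R (Fin.last (n + 1)) ∘ₗ headMap k (n + 1) r :=
      Chain.linearMap_ext k fun a => by
        obtain ⟨u, a, rfl⟩ := exists_eq_cons a
        simp only [LinearMap.comp_apply, headMap_cons, face_last_tprod]
        congr 2
        change q (_ * p u) = g (_ * r u)
        rw [mul_comm, mul_comm _ (r u)]
        exact h u _
    exact LinearMap.congr_fun this x
  rw [h0, hl]
  congr 2
  refine Finset.sum_congr rfl fun i _ => ?_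
  have hi (p : A →ₗ[R] A) : face k A R i.succ.castSucc (headMap k (n + 1) p x) =
      headMap k n p (face k A R i.succ.castSucc x) := by
    refine face_slotMap k i.succ _ _ (fun j hj => ?_) (fun j hj => ?_) (fun u v => ?_) x
    · by_cases h : j = 0
      · subst h; simp
      · rw [Function.update_of_ne h, Function.update_of_ne (by simpa using h)]
    · rw [Function.update_of_ne (Fin.succ_ne_zero _), Function.update_of_ne (Fin.ne_zero_of_lt hj)]
    · simp [Fin.ext_iff]
  rw [hi, hi, headMap_headMap, headMap_headMap, hq]

theorem bd_headMap {n : ℕ} (p q r g : A →ₗ[R] A) (hq : q ∘ₗ p = g ∘ₗ r)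
    (h : ∀ u v, q (p u * v) = g (r u * v)) (x : Chain k A n) :
    headMap k (n - 1) q (bd k R A n (headMap k n p x)) =
      headMap k (n - 1) g (bd k R A n (headMap k n r x)) := by
  cases n with
  | zero => simp [bd]
  | succ n => exact headMap_b k p q r g hq h x

end HeadMap

namespace SqZeroRetract

variable (k : Type u) [CommRing k] {R : Type u} [CommRing R] [Algebra k R]
  {A : Type u} [CommRing A] [Algebra k A] [Algebra R A] [IsScalarTower k R A]
  {T : SqZeroRetract R A}

theorem headProj_eq_headMap (n : ℕ) : T.headProj k n = headMap k n T.proj :=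
  Chain.linearMap_ext k fun a => by
    obtain ⟨u, a, rfl⟩ := exists_eq_cons a
    rw [headProj_cons, headMap_cons]

theorem headMap_of_nilPart {n : ℕ} {x : Chain k A n} (hx : T.headProj k n x = 0)
    (g : A →ₗ[R] A) : headMap k n (g ∘ₗ T.nil) x = headMap k n g x := by
  have : T.nil = LinearMap.id - T.proj := rfl
  rw [← headMap_headMap, this, map_sub, LinearMap.sub_apply, headMap_id, ← headProj_eq_headMap, hx,
    sub_zero]

theorem headMap_of_projPart {n : ℕ} {x : Chain k A n} (hx : T.headProj k n x = x)
    (g : A →ₗ[R] A) : headMap k n (g ∘ₗ T.proj) x = headMap k n g x := by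
  rw [← headMap_headMap, ← headProj_eq_headMap, hx]

theorem parity_headMap {n : ℕ} (g : A →ₗ[R] A) (h : T.sgn ∘ₗ g = -(g ∘ₗ T.sgn)) {ε : ℤ}
    {x : Chain k A n} (hx : T.parity k n x = ε • x) :
    T.parity k n (headMap k n g x) = (-ε) • headMap k n g x := by
  rw [parity, slotMap_headMap k _ g (-g) (by rw [h, LinearMap.neg_comp])]
  have : slotMap k (fun _ => T.sgn) x = ε • x := hx
  rw [this, map_zsmul, map_neg, LinearMap.neg_apply, smul_neg, neg_smul]

namespace Frame

variable {ι : Type} [Fintype ι] (B : T.Frame ι) {L : Type u} [AddCommGroup L] [Module R L]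
  (j : L →ₗ[R] A) (hj : ∀ y, T.proj (j y) = 0) (x : ι → L) (hx : ∀ i, j (x i) = B.e i)
  (l : ι → L →ₗ[R] R) (hl : ∀ i y, B.D i (j y) = algebraMap R A (l i y))
  (hxl : ∀ y, ∑ i, l i y • x i = y)

include hj in
theorem nil_j (y : L) : T.nil (j y) = j y := by rw [nil_apply, hj, sub_zero]

include hj in
theorem mul_j (y : L) (a : A) : j y * T.proj a = j y * a := by
  rw [← nil_j j hj, mul_comm, ← mul_nil, mul_comm]

include hj in
theorem headMap_mul_mem {ε : ℤ} {n : ℕ} (y : L) {z : Chain k A n}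
    (hz : z ∈ T.projPart k (-ε) n) :
    headMap k n (LinearMap.mul R A (j y)) z ∈ T.nilPart k ε n := by
  rw [mem_projPart] at hz
  rw [mem_nilPart]
  constructor
  · rw [headProj_eq_headMap, headMap_headMap]
    have : T.proj ∘ₗ LinearMap.mul R A (j y) = 0 := by
      ext a
      simp [proj_mul, hj]
    rw [this, map_zero, LinearMap.zero_apply]
  · rw [parity_headMap k _ ?_ hz.2, neg_neg]
    ext a
    simp only [LinearMap.comp_apply, LinearMap.mul_apply', LinearMap.neg_apply]
    rw [sgn_mul, ← nil_j j hj, sgn_nil, neg_mul]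

theorem headMap_D_mem {ε : ℤ} {n : ℕ} (i : ι) {z : Chain k A n}
    (hz : z ∈ T.nilPart k ε n) :
    headMap k n (B.D i) z ∈ T.projPart k (-ε) n := by
  rw [mem_nilPart] at hz
  rw [mem_projPart]
  constructor
  · rw [headProj_eq_headMap, headMap_headMap]
    congr 2
    ext a
    exact B.proj_D i a
  · refine parity_headMap k _ ?_ hz.2
    ext a
    simp [B.sgn_D, B.D_sgn]

include hj in
-- Multiplying a_0 by a fixed element commutes with b. As j y sees only the projection of what it
-- multiplies, P may be inserted, so b corresponds to Pb.
theorem bd_headMap_mul {n : ℕ} (y : L) (z : Chain k A n) :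
    bd k R A n (headMap k n (LinearMap.mul R A (j y)) z) =
      headMap k (n - 1) (LinearMap.mul R A (j y)) (T.headProj k (n - 1) (bd k R A n z)) := by
  have h := bd_headMap k (LinearMap.mul R A (j y)) LinearMap.id LinearMap.id
    (LinearMap.mul R A (j y)) rfl (fun u v => by simp [mul_assoc]) z
  rw [headMap_id, headMap_id] at h
  rw [h, headProj_eq_headMap, headMap_headMap]
  congr 2
  ext a
  exact (mul_j j hj y a).symm

/-- By the twisted Leibniz rule D(ν(u)v) = `sgn`(ν(u)) D(v) + D(u)v. Under ρ the first term dies,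
and the left side is fixed, giving ρ(D(u)v) = D(ν(u)v). -/
theorem bd_headMap_D {n : ℕ} (i : ι) {z : Chain k A n} (hz : T.headProj k n z = 0) :
    T.headProj k (n - 1) (bd k R A n (headMap k n (B.D i) z)) =
      headMap k (n - 1) (B.D i) (bd k R A n z) := by
  have hz' : headMap k n T.nil z = z := by
    have := headMap_of_nilPart k hz LinearMap.id
    rwa [LinearMap.id_comp, headMap_id] at this
  have h := bd_headMap k (B.D i) T.proj T.nil (B.D i)
    (by ext a; simp [B.proj_D, B.D_nil]) (fun u v => by
      rw [proj_mul, B.proj_D, ← B.proj_D i (T.nil u * v), B.D_mul, map_add, proj_mul, proj_sgn,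
        proj_nil, zero_mul, zero_add, proj_mul, B.proj_D, B.D_nil]) z
  rwa [hz', ← headProj_eq_headMap] at h

/-- The nilpotent part is `L` tensored with the part of opposite parity. -/
def nilEquiv (ε ε' : ℤ) (hε : -ε = ε') (n : ℕ) :
    L ⊗[R] T.projHomology k ε' n ≃ₗ[R] T.nilHomology k ε n :=
  Subquot.tensorEquiv x l hxl (headMap k n ∘ₗ LinearMap.mul R A ∘ₗ j)
    (fun i => headMap k n (B.D i))
    (by
      subst hε
      rintro y z ⟨hz, hb⟩
      have hb' : T.headProj k (n - 1) (bd k R A n z) = 0 := hb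
      refine ⟨headMap_mul_mem k j hj y hz, ?_⟩
      exact (bd_headMap_mul k j hj y z).trans (by rw [hb', map_zero]))
    (by
      subst hε
      rintro y _ ⟨w, hw, rfl⟩
      exact ⟨_, headMap_mul_mem k j hj y hw, bd_headMap_mul k (n := n + 1) j hj y w⟩)
    (by
      subst hε
      rintro i z ⟨hz, hb⟩
      have hb' : bd k R A n z = 0 := hb
      refine ⟨B.headMap_D_mem k i hz, ?_⟩
      exact (B.bd_headMap_D k i (mem_nilPart.1 hz).1).trans (by rw [hb', map_zero]))
    (by
      subst hε
      rintro i _ ⟨w, hw, rfl⟩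
      exact ⟨_, B.headMap_D_mem k i hw, B.bd_headMap_D k (n := n + 1) i (mem_nilPart.1 hw).1⟩)
    (by
      rintro z ⟨hz, -⟩
      have : ∑ i, LinearMap.mul R A (j (x i)) ∘ₗ B.D i = LinearMap.id ∘ₗ T.nil := by
        ext a
        simp [hx, B.sum]
      simp only [LinearMap.comp_apply, headMap_headMap]
      rw [← LinearMap.sum_apply, ← map_sum, this, headMap_of_nilPart k (mem_nilPart.1 hz).1,
        headMap_id])
    (by
      rintro i y z ⟨hz, -⟩
      -- The head of z lies in the image of ρ, on which D_i vanishes, so only D_i(j y), a scalar, is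
      -- left.
      have : B.D i ∘ₗ LinearMap.mul R A (j y) ∘ₗ T.proj = (l i y • LinearMap.id) ∘ₗ T.proj := by
        ext a
        simp [B.D_mul, B.D_proj, hl, Algebra.smul_def]
      have hz' := (mem_projPart.1 hz).1
      simp only [LinearMap.comp_apply, headMap_headMap]
      rw [← headMap_of_projPart k hz', LinearMap.comp_assoc, this, headMap_of_projPart k hz',
        map_smul, LinearMap.smul_apply, headMap_id])

end Frame

/-! ### Splitting the Hochschild complex of R off the even quotient -/

section Section

variable (α : A →ₐ[R] R) (hα : ∀ a, T.ρ a = algebraMap R A (α a))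

variable (R) in
/-- Hochschild homology as a quotient of cycles by boundaries. -/
abbrev cycleHomology (n : ℕ) : Type u :=
  Subquot (LinearMap.ker (bd k R R n)) (LinearMap.range (b k R R n))

include hα in
-- Since ρ factors as α followed by the structure map R → A, projecting all factors factors through
-- C_*(R), which is thereby a direct summand.
theorem chainMap_section_chainMap {n : ℕ} (x : Chain k A n) :
    chainMap k (Algebra.ofId R A) n (chainMap k α n x) = T.allProj k n x := by
  have : chainMap k (Algebra.ofId R A) n ∘ₗ chainMap k α n = T.allProj k n :=
    Chain.linearMap_ext k fun a => by
      rw [LinearMap.comp_apply, chainMap_tprod, chainMap_tprod, allProj, slotMap_tprod]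
      congr 1
      funext m
      exact (hα _).symm
  exact LinearMap.congr_fun this x

theorem chainMap_chainMap_section {n : ℕ} (x : Chain k R n) :
    chainMap k α n (chainMap k (Algebra.ofId R A) n x) = x := by
  have : chainMap k α n ∘ₗ chainMap k (Algebra.ofId R A) n = LinearMap.id :=
    Chain.linearMap_ext k fun a => by
      rw [LinearMap.comp_apply, chainMap_tprod, chainMap_tprod]
      congr 1
      funext m
      simp [Algebra.ofId_apply]
  exact LinearMap.congr_fun this x

theorem chainMap_b {A' : Type u} [CommRing A'] [Algebra k A'] [Algebra R A'] [IsScalarTower k R A']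
    {B : Type u} [CommRing B] [Algebra k B] [Algebra R B]
    [IsScalarTower k R B] (f : A' →ₐ[R] B) {n : ℕ} (x : Chain k A' (n + 1)) :
    chainMap k f n (b k A' R n x) = b k B R n (chainMap k f (n + 1) x) :=
  LinearMap.congr_fun (b_chainMap k f n) x

theorem chainMap_bd {A' : Type u} [CommRing A'] [Algebra k A'] [Algebra R A'] [IsScalarTower k R A']
    {B : Type u} [CommRing B] [Algebra k B] [Algebra R B]
    [IsScalarTower k R B] (f : A' →ₐ[R] B) {n : ℕ} (x : Chain k A' n) :
    chainMap k f (n - 1) (bd k R A' n x) = bd k R B n (chainMap k f n x) := by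
  cases n with
  | zero => exact map_zero _
  | succ n => exact chainMap_b k f x

include hα in
theorem chainMap_headProj {n : ℕ} (x : Chain k A n) :
    chainMap k α n (T.headProj k n x) = chainMap k α n x := by
  rw [← chainMap_chainMap_section k α (chainMap k α n (T.headProj k n x)),
    chainMap_section_chainMap k α hα, allProj_headProj, ← chainMap_section_chainMap k α hα,
    chainMap_chainMap_section]

include hα in
theorem chainMap_of_allProj {n : ℕ} {x : Chain k A n} (hx : T.allProj k n x = 0) :
    chainMap k α n x = 0 := by
  rw [← chainMap_chainMap_section k α (chainMap k α n x),
    chainMap_section_chainMap k α hα, hx, map_zero]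

include hα in
theorem allProj_section {n : ℕ} (x : Chain k R n) :
    T.allProj k n (chainMap k (Algebra.ofId R A) n x) = chainMap k (Algebra.ofId R A) n x := by
  rw [← chainMap_section_chainMap k α hα, chainMap_chainMap_section]

include hα in
theorem headProj_section {n : ℕ} (x : Chain k R n) :
    T.headProj k n (chainMap k (Algebra.ofId R A) n x) = chainMap k (Algebra.ofId R A) n x := by
  rw [← allProj_section k α hα, headProj_allProj]

include hα in
theorem section_mem {n : ℕ} (x : Chain k R n) :
    chainMap k (Algebra.ofId R A) n x ∈ T.projPart k 1 n := by
  rw [mem_projPart, headProj_section k α hα, ← allProj_section k α hα, parity_allProj, one_smul]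
  exact ⟨rfl, rfl⟩

theorem sub_allProj_mem {n : ℕ} {x : Chain k A n} (hx : x ∈ T.projPart k 1 n) :
    x - T.allProj k n x ∈ T.reducedPart k 1 n := by
  rw [mem_projPart] at hx
  rw [mem_reducedPart]
  rw [map_sub, map_sub, map_sub, hx.1, headProj_allProj, hx.2, parity_allProj, allProj_allProj,
    one_smul, one_smul]
  exact ⟨⟨rfl, rfl⟩, sub_self _⟩

theorem headProj_b_allProj {n : ℕ} (x : Chain k A (n + 1)) :
    T.headProj k n (b k A R n (T.allProj k (n + 1) x)) =
      T.allProj k n (T.headProj k n (b k A R n x)) := by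
  rw [← allProj_b, headProj_allProj, allProj_headProj]

/-- The even projective part is the Hochschild complex of `R` plus the reduced part. -/
def projEquivProd (n : ℕ) :
    T.projHomology k 1 n ≃ₗ[R] cycleHomology k R n × T.reducedHomology k 1 n :=
  Subquot.prodEquiv (chainMap k α n) (LinearMap.id - T.allProj k n)
    (by
      rintro x ⟨-, hb⟩
      have hb' : T.headProj k (n - 1) (bd k R A n x) = 0 := hb
      rw [LinearMap.mem_ker, ← chainMap_bd, ← chainMap_headProj k α hα, hb', map_zero])
    (by
      rintro _ ⟨w, -, rfl⟩
      refine ⟨chainMap k α (n + 1) w, ?_⟩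
      rw [LinearMap.comp_apply, chainMap_headProj k α hα, chainMap_b])
    (by
      rintro x ⟨hx, hb⟩
      refine ⟨sub_allProj_mem k hx, ?_⟩
      cases n with
      | zero => exact map_zero (T.headProj k (0 - 1))
      | succ n =>
        have hb' : T.headProj k n (b k A R n x) = 0 := hb
        change T.headProj k n (b k A R n (x - T.allProj k (n + 1) x)) = 0
        rw [map_sub, map_sub, headProj_b_allProj, hb', map_zero, sub_zero])
    (by
      rintro _ ⟨w, hw, rfl⟩
      refine ⟨w - T.allProj k (n + 1) w, sub_allProj_mem k hw, ?_⟩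
      rw [map_sub, LinearMap.comp_apply, LinearMap.comp_apply, headProj_b_allProj]
      rfl)
    (by
      rintro x - ⟨w, hw⟩ ⟨q, hq, h⟩
      refine ⟨chainMap k (Algebra.ofId R A) (n + 1) w + q,
        Submodule.add_mem _ (section_mem k α hα w) hq.1, ?_⟩
      rw [map_add, h, LinearMap.comp_apply, ← chainMap_b, hw, chainMap_section_chainMap k α hα,
        headProj_allProj, LinearMap.sub_apply, LinearMap.id_apply, add_sub_cancel])
    (by
      rintro y hy q ⟨hq, hbq⟩
      refine ⟨chainMap k (Algebra.ofId R A) n y + q,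
        ⟨Submodule.add_mem _ (section_mem k α hα y) hq.1, ?_⟩, ?_, ?_⟩
      · have hy' : bd k R R n y = 0 := hy
        rw [SetLike.mem_coe, LinearMap.mem_ker, map_add, hbq, LinearMap.comp_apply, ← chainMap_bd,
          hy', map_zero, map_zero, add_zero]
      · rw [map_add, chainMap_chainMap_section, chainMap_of_allProj k α hα hq.2, add_zero]
      · have hq' : T.allProj k n q = 0 := hq.2
        rw [LinearMap.sub_apply, LinearMap.id_apply, map_add, hq', allProj_section k α hα,
          add_zero, add_sub_cancel_left])

end Section

end SqZeroRetract

/-! ### Comparison with homology of chain complexes and with the kernel complex -/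

section Categorical

/-- The homology of a short complex of modules as a quotient of cycles by boundaries. -/
def shortComplexHomologyEquiv {R : Type u} [CommRing R] (S : ShortComplex (ModuleCat.{u} R)) :
    S.homology ≃ₗ[R] Subquot (LinearMap.ker S.g.hom) (LinearMap.range S.f.hom) :=
  S.moduleCatHomologyIso.toLinearEquiv ≪≫ₗ
    Submodule.quotEquivOfEq _ _ (by
      ext x
      change _ ↔ (x : S.X₂) ∈ LinearMap.range S.f.hom
      constructor
      · rintro ⟨y, rfl⟩
        exact ⟨y, rfl⟩
      · rintro ⟨y, hy⟩
        exact ⟨y, Subtype.ext hy⟩)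

/-- The homology of a chain complex of modules as a quotient of cycles by boundaries. -/
def chainComplexHomologyEquiv {R : Type u} [CommRing R]
    (X : ChainComplex (ModuleCat.{u} R) ℕ) (n : ℕ) :
    X.homology n ≃ₗ[R]
      Subquot (LinearMap.ker (X.d n (n - 1)).hom) (LinearMap.range (X.d (n + 1) n).hom) :=
  (X.homologyIsoSc' (n + 1) n (n - 1) (by simp) (by cases n <;> simp)).toLinearEquiv ≪≫ₗ
    shortComplexHomologyEquiv _

variable (k : Type u) [CommRing k] {R : Type u} [CommRing R] [Algebra k R]
  {A : Type u} [CommRing A] [Algebra k A] [Algebra R A] [IsScalarTower k R A]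

omit [Algebra k R] [IsScalarTower k R A] in
theorem complex_d (n : ℕ) :
    ((complex k A R).d (n + 1) n).hom = b k A R n := by
  simp only [complex, ChainComplex.of_d]
  rfl

omit [Algebra k R] [IsScalarTower k R A] in
theorem complex_d_pred (n : ℕ) :
    ((complex k A R).d n (n - 1)).hom = bd k R A n := by
  cases n with
  | zero =>
    -- In degree 0 the truncated predecessor is 0 itself, and the differential from 0 to 0 is zero,
    -- matching the default value of `bd`.
    rw [(complex k A R).shape 0 (0 - 1) (by simp)]
    rfl
  | succ n => exact complex_d k n

/-- Hochschild homology in terms of cycles and boundaries. -/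
def HHEquiv (n : ℕ) : HH k R R n ≃ₗ[R] SqZeroRetract.cycleHomology k R n :=
  chainComplexHomologyEquiv _ n ≪≫ₗ Subquot.equiv LinearMap.id
    (fun x hx => by rw [← complex_d_pred]; exact hx)
    (fun x hx => by rw [← complex_d]; exact hx)
    (fun x _ hx => by rw [← complex_d] at hx; exact hx)
    (fun x hx => ⟨x, by rw [← complex_d_pred] at hx; exact hx, by
      rw [LinearMap.id_apply, sub_self]
      exact Submodule.zero_mem _⟩)

theorem kernel_ι_injective {R : Type u} [CommRing R] {X Y : ChainComplex (ModuleCat.{u} R) ℕ}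
    (f : X ⟶ Y) (n : ℕ) : Function.Injective ((Limits.kernel.ι f).f n).hom := by
  rw [← ModuleCat.mono_iff_injective]
  infer_instance

/-- Evaluation in a fixed degree is exact, so the kernel of a map of complexes is computed
degreewise. -/
theorem kernel_ι_range {R : Type u} [CommRing R] {X Y : ChainComplex (ModuleCat.{u} R) ℕ}
    (f : X ⟶ Y) (n : ℕ) :
    LinearMap.range ((Limits.kernel.ι f).f n).hom = LinearMap.ker (f.f n).hom := by
  have h : (ShortComplex.mk _ _ (Limits.kernel.condition f)).Exact :=
    ShortComplex.exact_of_f_is_kernel _ (Limits.kernelIsKernel f)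
  have h' := h.map (HomologicalComplex.eval (ModuleCat.{u} R) (ComplexShape.down ℕ) n)
  rw [ShortComplex.moduleCat_exact_iff_range_eq_ker] at h'
  exact h'

theorem relComplex_ι_d (I : Ideal A) (i j : ℕ) (x : (relComplex k R I).X i) :
    ((Limits.kernel.ι (complexMap k (Ideal.Quotient.mkₐ R I))).f j).hom
      (((relComplex k R I).d i j).hom x) =
    ((complex k A R).d i j).hom
      (((Limits.kernel.ι (complexMap k (Ideal.Quotient.mkₐ R I))).f i).hom x) := by
  have := (Limits.kernel.ι (complexMap k (Ideal.Quotient.mkₐ R I))).comm i j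
  exact (LinearMap.congr_fun (congrArg ModuleCat.Hom.hom this) x).symm

variable (R) in
/-- The inclusion of the relative Hochschild complex. -/
def relIncl (I : Ideal A) (n : ℕ) : (relComplex k R I).X n →ₗ[R] Chain k A n :=
  ((Limits.kernel.ι (complexMap k (Ideal.Quotient.mkₐ R I))).f n).hom

theorem relIncl_b (I : Ideal A) (n : ℕ) (x : (relComplex k R I).X (n + 1)) :
    relIncl k R I n (((relComplex k R I).d (n + 1) n).hom x) =
      b k A R n (relIncl k R I (n + 1) x) := by
  rw [← complex_d]
  exact relComplex_ι_d k I _ _ x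

theorem relIncl_bd (I : Ideal A) (n : ℕ) (x : (relComplex k R I).X n) :
    relIncl k R I (n - 1) (((relComplex k R I).d n (n - 1)).hom x) =
      bd k R A n (relIncl k R I n x) := by
  rw [← complex_d_pred]
  exact relComplex_ι_d k I _ _ x

theorem relIncl_injective (I : Ideal A) (n : ℕ) : Function.Injective (relIncl k R I n) :=
  kernel_ι_injective _ n

theorem exists_relIncl_eq_iff (I : Ideal A) (n : ℕ) (y : Chain k A n) :
    (∃ x, relIncl k R I n x = y) ↔ chainMap k (Ideal.Quotient.mkₐ R I) n y = 0 :=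
  SetLike.ext_iff.1 (kernel_ι_range (complexMap k (Ideal.Quotient.mkₐ R I)) n) y

/-- Relative Hochschild homology in terms of cycles and boundaries. -/
def relHHEquiv (I : Ideal A) (n : ℕ) : relHH k R I n ≃ₗ[R]
    Subquot
      (LinearMap.ker (chainMap k (Ideal.Quotient.mkₐ R I) n) ⊓ LinearMap.ker (bd k R A n))
      ((LinearMap.ker (chainMap k (Ideal.Quotient.mkₐ R I) (n + 1))).map (b k A R n)) :=
  chainComplexHomologyEquiv _ n ≪≫ₗ
    Subquot.equiv (relIncl k R I n)
    (by
      intro x hx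
      refine ⟨(exists_relIncl_eq_iff k I n _).1 ⟨x, rfl⟩, ?_⟩
      rw [LinearMap.mem_ker] at hx
      rw [SetLike.mem_coe, LinearMap.mem_ker, ← relIncl_bd, hx, map_zero])
    (by
      rintro _ ⟨w, rfl⟩
      exact ⟨relIncl k R I (n + 1) w, (exists_relIncl_eq_iff k I _ _).1 ⟨w, rfl⟩,
        (relIncl_b k I n w).symm⟩)
    (by
      rintro x - ⟨w, hw, h⟩
      obtain ⟨w, rfl⟩ := (exists_relIncl_eq_iff k I _ w).2 hw
      refine ⟨w, relIncl_injective k I n ?_⟩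
      rw [← h]
      exact relIncl_b k I n w)
    (by
      rintro y ⟨hy, hb⟩
      obtain ⟨x, rfl⟩ := (exists_relIncl_eq_iff k I _ y).2 hy
      refine ⟨x, ?_, by rw [sub_self]; exact Submodule.zero_mem _⟩
      refine relIncl_injective k I _ ?_
      rw [map_zero]
      exact (relIncl_bd k I n x).trans hb)

end Categorical

/-! ### Rank one modules and the trivial square-zero extension -/

/-- The identity may be checked at maximal ideals. There L is free on one generator v, and for x =
av and y = cv both sides are ac l(v) v. The rank hypothesis is used only here. -/
theorem smul_comm_of_rankAtStalk_eq_one {R L : Type u} [CommRing R] [AddCommGroup L] [Module R L]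
    [Module.Finite R L] [Module.Projective R L]
    (hL : ∀ P : PrimeSpectrum R, Module.rankAtStalk L P = 1) (l : L →ₗ[R] R) (x y : L) :
    l x • y = l y • x := by
  refine Module.eq_of_localization_maximal (fun (P : Ideal R) _ => LocalizedModule P.primeCompl L)
    (fun (P : Ideal R) _ => LocalizedModule.mkLinearMap P.primeCompl L) _ _ fun P hP => ?_
  have h1 : Module.finrank (Localization P.primeCompl) (LocalizedModule P.primeCompl L) = 1 :=
    hL ⟨P, hP.isPrime⟩
  have : IsLocalRing (Localization P.primeCompl) :=
    inferInstanceAs (IsLocalRing (Localization.AtPrime P))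
  have : Module.Free (Localization P.primeCompl) (LocalizedModule P.primeCompl L) :=
    Module.free_of_flat_of_isLocalRing
  obtain ⟨v, -, hv⟩ := finrank_eq_one_iff'.1 h1
  let f := LocalizedModule.mkLinearMap P.primeCompl L
  let lP : LocalizedModule P.primeCompl L →ₗ[Localization P.primeCompl]
      Localization P.primeCompl :=
    IsLocalizedModule.mapExtendScalars P.primeCompl f
      (Algebra.linearMap R (Localization P.primeCompl)) (Localization P.primeCompl) l
  have hl (z : L) : lP (f z) = algebraMap R _ (l z) :=
    IsLocalizedModule.map_apply P.primeCompl f (Algebra.linearMap R (Localization P.primeCompl)) l z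
  obtain ⟨a, ha⟩ := hv (f x)
  obtain ⟨c, hc⟩ := hv (f y)
  change f _ = f _
  rw [map_smul, map_smul, ← algebraMap_smul (Localization P.primeCompl) (l x),
    ← algebraMap_smul (Localization P.primeCompl) (l y), ← hl, ← hl, ← ha, ← hc, map_smul, map_smul,
    smul_smul, smul_smul, smul_eq_mul, smul_eq_mul]
  congr 1
  ring

section TrivSqZeroExt

variable (R : Type u) [CommRing R] (L : Type u) [AddCommGroup L] [Module R L] [Module Rᵐᵒᵖ L]
  [IsCentralScalar R L]

/-- The projection `R ⊕ L → R`. -/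
def fstAlgHom : TrivSqZeroExt R L →ₐ[R] R := TrivSqZeroExt.fstHom R R L

/-- The projection of `R ⊕ L` onto `R`. -/
def trivRetract : SqZeroRetract R (TrivSqZeroExt R L) where
  ρ := (Algebra.ofId R _).comp (fstAlgHom R L)
  idem a := by
    simp [fstAlgHom, Algebra.ofId_apply, TrivSqZeroExt.algebraMap_eq_inl]
  sq_zero a b := by
    ext <;> simp [fstAlgHom, Algebra.ofId_apply, TrivSqZeroExt.algebraMap_eq_inl]

theorem trivRetract_proj (a : TrivSqZeroExt R L) :
    (trivRetract R L).proj a = TrivSqZeroExt.inl a.fst := by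
  simp [trivRetract, SqZeroRetract.proj, fstAlgHom, Algebra.ofId_apply,
    TrivSqZeroExt.algebraMap_eq_inl]

theorem trivRetract_nil (a : TrivSqZeroExt R L) :
    (trivRetract R L).nil a = TrivSqZeroExt.inr a.snd := by
  rw [SqZeroRetract.nil_apply, trivRetract_proj]
  ext <;> simp

variable {R L} in
/-- The frame given by a dual basis of a module of rank one. -/
def trivFrame {ι : Type} [Fintype ι] (x : ι → L) (l : ι → L →ₗ[R] R)
    (hx : ∀ y, ∑ i, l i y • x i = y) (hl : ∀ i y z, l i y • z = l i z • y) :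
    (trivRetract R L).Frame ι where
  e i := TrivSqZeroExt.inr (x i)
  D i := Algebra.linearMap R (TrivSqZeroExt R L) ∘ₗ l i ∘ₗ TrivSqZeroExt.sndHom R L
  proj_e i := by simp [trivRetract_proj]
  proj_D i a := by simp [trivRetract_proj, TrivSqZeroExt.algebraMap_eq_inl]
  D_proj i a := by simp [trivRetract_proj, TrivSqZeroExt.algebraMap_eq_inl]
  D_mul i a c := by
    rw [SqZeroRetract.sgn_apply, trivRetract_proj, trivRetract_nil]
    ext
    · simp [TrivSqZeroExt.algebraMap_eq_inl, mul_comm]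
    -- In the L-component the extra terms -l(c)a + l(a)c of the twisted rule cancel by the rank one
    -- identity.
    · simp [TrivSqZeroExt.algebraMap_eq_inl, hl i c.snd a.snd]
  sum a := by
    rw [trivRetract_nil]
    conv_rhs => rw [← hx a.snd]
    refine Eq.trans (Finset.sum_congr rfl fun i _ => ?_)
      (map_sum (TrivSqZeroExt.inrHom R L) _ _).symm
    ext <;> simp [TrivSqZeroExt.algebraMap_eq_inl]

variable (k : Type u) [CommRing k] [Algebra k R] [Module k L] [IsScalarTower k R L]
    [IsScalarTower k Rᵐᵒᵖ L]

/-- The quotient map A → A/L and ρ factor through each other, hence so do the maps they induce on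
chains, and the kernels agree. -/
theorem ker_chainMap_kerIdeal (n : ℕ) :
    LinearMap.ker (chainMap k (Ideal.Quotient.mkₐ R (TrivSqZeroExt.kerIdeal R L)) n) =
      LinearMap.ker ((trivRetract R L).allProj k n) := by
  have h1 : chainMap k (Ideal.Quotient.mkₐ R (TrivSqZeroExt.kerIdeal R L)) n ∘ₗ
      (trivRetract R L).allProj k n =
        chainMap k (Ideal.Quotient.mkₐ R (TrivSqZeroExt.kerIdeal R L)) n :=
    Chain.linearMap_ext k fun a => by
      rw [LinearMap.comp_apply, SqZeroRetract.allProj, slotMap_tprod, chainMap_tprod,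
        chainMap_tprod]
      congr 1
      funext j
      refine Ideal.Quotient.eq.2 ?_
      rw [TrivSqZeroExt.mem_kerIdeal_iff_inr, trivRetract_proj]
      ext <;> simp
  let f : (TrivSqZeroExt R L ⧸ TrivSqZeroExt.kerIdeal R L) →ₐ[R] TrivSqZeroExt R L :=
    Ideal.Quotient.liftₐ _ (trivRetract R L).ρ fun a ha => by
      rw [TrivSqZeroExt.mem_kerIdeal_iff_inr] at ha
      refine (trivRetract_proj R L a).trans ?_
      rw [ha]
      simp
  have h2 : chainMap k f n ∘ₗ chainMap k (Ideal.Quotient.mkₐ R (TrivSqZeroExt.kerIdeal R L)) n =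
      (trivRetract R L).allProj k n :=
    Chain.linearMap_ext k fun a => by
      rw [LinearMap.comp_apply, SqZeroRetract.allProj, slotMap_tprod, chainMap_tprod,
        chainMap_tprod]
      rfl
  apply le_antisymm
  · rw [← h2]
    exact LinearMap.ker_le_ker_comp _ _
  · conv_rhs => rw [← h1]
    exact LinearMap.ker_le_ker_comp _ _

/-- The relative Hochschild homology of the square-zero extension is that of the kernel of the
projection. -/
def relHHEquivKerHomology (n : ℕ) : relHH k R (TrivSqZeroExt.kerIdeal R L) n ≃ₗ[R]
    (trivRetract R L).kerHomology k n :=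
  relHHEquiv k _ n ≪≫ₗ Subquot.equiv LinearMap.id
    (by
      rw [ker_chainMap_kerIdeal]
      exact fun x hx => hx)
    (by
      rw [ker_chainMap_kerIdeal]
      exact fun x hx => hx)
    (fun x _ hx => by
      rw [ker_chainMap_kerIdeal]
      exact hx)
    (by
      rw [ker_chainMap_kerIdeal]
      exact fun x hx => ⟨x, hx, by rw [LinearMap.id_apply, sub_self]; exact Submodule.zero_mem _⟩)

end TrivSqZeroExt

/-! ### The recursion satisfied by the sum of M_p ⊗ H_q over p + q = n -/

section Antidiagonal

/-- Splitting off the first element of the antidiagonal. -/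
def antidiagonalSuccEquiv (n : ℕ) :
    Finset.HasAntidiagonal.antidiagonal (n + 1) ≃
      Option (Finset.HasAntidiagonal.antidiagonal n) where
  toFun
    | ⟨(0, _), _⟩ => none
    | ⟨(p + 1, q), h⟩ => some ⟨(p, q), by
        rw [Finset.HasAntidiagonal.mem_antidiagonal] at h ⊢
        omega⟩
  invFun
    | none => ⟨(0, n + 1), by simp⟩
    | some ⟨(p, q), h⟩ => ⟨(p + 1, q), by
        rw [Finset.HasAntidiagonal.mem_antidiagonal] at h ⊢
        omega⟩
  left_inv := by
    rintro ⟨⟨_ | p, q⟩, h⟩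
    · have := Finset.HasAntidiagonal.mem_antidiagonal.1 h
      simp only [Subtype.mk.injEq, Prod.mk.injEq, true_and]
      omega
    · rfl
  right_inv := by
    rintro (_ | ⟨⟨p, q⟩, h⟩) <;> rfl

variable {R : Type u} [CommRing R]

/-- The direct sum of `M_p ⊗ H_q` over `p + q = n`. -/
abbrev antidiagonalSum (R : Type u) [CommRing R] (M H : ℕ → Type u) [∀ p, AddCommGroup (M p)]
    [∀ p, Module R (M p)] [∀ q, AddCommGroup (H q)] [∀ q, Module R (H q)] (n : ℕ) : Type u :=
  ⨁ pq : Finset.HasAntidiagonal.antidiagonal n, M pq.1.1 ⊗[R] H pq.1.2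

variable (M M' H : ℕ → Type u) [∀ p, AddCommGroup (M p)]
    [∀ p, Module R (M p)] [∀ p, AddCommGroup (M' p)]
    [∀ p, Module R (M' p)] [∀ q, AddCommGroup (H q)] [∀ q, Module R (H q)]

/-- Splitting off the summand with `p = 0`. -/
def antidiagonalSumSucc (n : ℕ) : antidiagonalSum R M H (n + 1) ≃ₗ[R]
    (M 0 ⊗[R] H (n + 1)) × antidiagonalSum R (fun p => M (p + 1)) H n :=
  DirectSum.lequivCongrLeft R (antidiagonalSuccEquiv n) ≪≫ₗ DirectSum.lequivProdDirectSum R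

/-- The direct sum over `p + q = 0` has a single summand. -/
def antidiagonalSumZero : antidiagonalSum R M H 0 ≃ₗ[R] M 0 ⊗[R] H 0 :=
  have : Unique (Finset.HasAntidiagonal.antidiagonal 0) :=
    { default := ⟨(0, 0), by simp⟩
      uniq := by
        rintro ⟨⟨p, q⟩, h⟩
        have := Finset.HasAntidiagonal.mem_antidiagonal.1 h
        simp only [Subtype.mk.injEq, Prod.mk.injEq]
        omega }
  LinearEquiv.ofLinearMap
    (DirectSum.component R (Finset.HasAntidiagonal.antidiagonal 0)
      (fun pq => M pq.1.1 ⊗[R] H pq.1.2) ⟨(0, 0), by simp⟩)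
    (DirectSum.lof R (Finset.HasAntidiagonal.antidiagonal 0)
      (fun pq => M pq.1.1 ⊗[R] H pq.1.2) ⟨(0, 0), by simp⟩)
    (LinearMap.ext fun x => by
      rw [LinearMap.comp_apply, DirectSum.component.lof_self, LinearMap.id_apply])
    (LinearMap.ext fun x => DFinsupp.ext fun i => by
      rw [Subsingleton.elim i ⟨(0, 0), by simp⟩]
      exact DFinsupp.single_eq_same)

variable {M M'} in
/-- Functoriality of the direct sum over `p + q = n` in `M`. -/
def antidiagonalSumCongr (e : ∀ p, M p ≃ₗ[R] M' p) (n : ℕ) :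
    antidiagonalSum R M H n ≃ₗ[R] antidiagonalSum R M' H n :=
  DFinsupp.mapRange.linearEquiv fun pq : Finset.HasAntidiagonal.antidiagonal n =>
    TensorProduct.congr (e pq.1.1) (LinearEquiv.refl R (H pq.1.2))

/-- Tensor products commute with the direct sum over `p + q = n`. -/
def antidiagonalSumTensor (L : Type u) [AddCommGroup L] [Module R L] (n : ℕ) :
    antidiagonalSum R (fun p => L ⊗[R] M p) H n ≃ₗ[R] L ⊗[R] antidiagonalSum R M H n :=
  (DFinsupp.mapRange.linearEquiv fun pq : Finset.HasAntidiagonal.antidiagonal n =>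
    TensorProduct.assoc R L (M pq.1.1) (H pq.1.2)) ≪≫ₗ
      (TensorProduct.directSumRight R R L
        fun pq : Finset.HasAntidiagonal.antidiagonal n => M pq.1.1 ⊗[R] H pq.1.2).symm

variable (L : Type u) [AddCommGroup L] [Module R L]

/-- `L^{⊗ 1} = L`. -/
def tensorPowerOne : (⨂[R]^1 L) ≃ₗ[R] L :=
  PiTensorProduct.subsingletonEquiv (0 : Fin 1)

/-- `M_0 = L`. -/
def oddPowerZero : oddPower R L 0 ≃ₗ[R] L :=
  TensorPower.cast R L (by simp) ≪≫ₗ tensorPowerOne L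

/-- `M_1 = L`. -/
def oddPowerOne : oddPower R L 1 ≃ₗ[R] L :=
  TensorPower.cast R L (by simp) ≪≫ₗ tensorPowerOne L

/-- `M_{p+2} = L ⊗ L ⊗ M_p`. -/
def oddPowerAddTwo (p : ℕ) : oddPower R L (p + 2) ≃ₗ[R] L ⊗[R] (L ⊗[R] oddPower R L p) :=
  TensorPower.cast R L (by
    simp only [Nat.even_add, even_two, iff_true]
    split_ifs <;> omega : (if Even (p + 2) then p + 2 + 1 else p + 2) =
      1 + (1 + if Even p then p + 1 else p)) ≪≫ₗ
  TensorPower.mulEquiv.symm ≪≫ₗ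
    TensorProduct.congr (tensorPowerOne L) (TensorPower.mulEquiv.symm ≪≫ₗ
      TensorProduct.congr (tensorPowerOne L) (LinearEquiv.refl R _))

/-- The direct sum over `p + q = n + 2` with `M_p = oddPower R L p`. -/
def oddPowerSumAddTwo (n : ℕ) : antidiagonalSum R (oddPower R L) H (n + 2) ≃ₗ[R]
    (L ⊗[R] H (n + 2)) × (L ⊗[R] H (n + 1)) ×
      L ⊗[R] (L ⊗[R] antidiagonalSum R (oddPower R L) H n) :=
  antidiagonalSumSucc (oddPower R L) H (n + 1) ≪≫ₗ
    LinearEquiv.prodCongr (TensorProduct.congr (oddPowerZero L) (LinearEquiv.refl R _))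
      (antidiagonalSumSucc (fun p => oddPower R L (p + 1)) H n ≪≫ₗ
        LinearEquiv.prodCongr (TensorProduct.congr (oddPowerOne L) (LinearEquiv.refl R _))
          (antidiagonalSumCongr H (oddPowerAddTwo L) n ≪≫ₗ
            antidiagonalSumTensor (fun p => L ⊗[R] oddPower R L p) H L n ≪≫ₗ
            TensorProduct.congr (LinearEquiv.refl R L)
              (antidiagonalSumTensor (oddPower R L) H L n)))

/-- A product with a trivial module. -/
def prodEquivOfSubsingleton {M N : Type u} [AddCommGroup M] [Module R M] [AddCommGroup N]
    [Module R N] (h : Subsingleton N) : (M × N) ≃ₗ[R] M where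
  __ := LinearMap.fst R M N
  invFun := LinearMap.inl R M N
  left_inv _ := Prod.ext rfl (h.elim _ _)
  right_inv _ := rfl

variable (G Q : ℕ → Type u) [∀ n, AddCommGroup (G n)] [∀ n, Module R (G n)]
  [∀ n, AddCommGroup (Q n)] [∀ n, Module R (Q n)]

/-- A family of modules which satisfies the recursion of `oddPowerSumAddTwo` is the direct sum. -/
theorem nonempty_prod_equiv_oddPowerSum (h0 : Subsingleton (Q 0)) (e : ∀ n, Q (n + 1) ≃ₗ[R] G n)
    (f0 : G 0 ≃ₗ[R] L ⊗[R] H 0) (f : ∀ n, G (n + 1) ≃ₗ[R] L ⊗[R] (H (n + 1) × L ⊗[R] Q n)) :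
    ∀ n, Nonempty ((G n × Q n) ≃ₗ[R] antidiagonalSum R (oddPower R L) H n)
  | 0 => ⟨prodEquivOfSubsingleton h0 ≪≫ₗ f0 ≪≫ₗ
      TensorProduct.congr (oddPowerZero L).symm (LinearEquiv.refl R _) ≪≫ₗ
      (antidiagonalSumZero (oddPower R L) H).symm⟩
  | 1 =>
    have h1 : Subsingleton (L ⊗[R] Q 0) := 
      subsingleton_of_forall_eq 0 fun z => by
        induction z with
        | zero => rfl
        | tmul x y => rw [h0.elim y 0, TensorProduct.tmul_zero]
        | add x y hx hy => rw [hx, hy, add_zero]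
    ⟨LinearEquiv.prodCongr (f 0 ≪≫ₗ TensorProduct.congr (LinearEquiv.refl R L)
        (prodEquivOfSubsingleton h1) ≪≫ₗ
          TensorProduct.congr (oddPowerZero L).symm (LinearEquiv.refl R _))
      (e 0 ≪≫ₗ f0 ≪≫ₗ TensorProduct.congr (oddPowerOne L).symm (LinearEquiv.refl R _) ≪≫ₗ
        (antidiagonalSumZero (fun p => oddPower R L (p + 1)) H).symm) ≪≫ₗ
      (antidiagonalSumSucc (oddPower R L) H 0).symm⟩
  | n + 2 => by
    obtain ⟨g⟩ := nonempty_prod_equiv_oddPowerSum h0 e f0 f n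
    -- The induction hypothesis tensored twice with L: going through the relations between G and Q
    -- once returns to the same family two degrees lower.
    have g' : ((L ⊗[R] (L ⊗[R] G n)) × (L ⊗[R] (L ⊗[R] Q n))) ≃ₗ[R]
        L ⊗[R] (L ⊗[R] antidiagonalSum R (oddPower R L) H n) :=
      (TensorProduct.prodRight R R L _ _).symm ≪≫ₗ TensorProduct.congr (LinearEquiv.refl R L)
        ((TensorProduct.prodRight R R L _ _).symm ≪≫ₗ
          TensorProduct.congr (LinearEquiv.refl R L) g)
    have a1 : G (n + 2) ≃ₗ[R] (L ⊗[R] H (n + 2)) × (L ⊗[R] (L ⊗[R] G n)) :=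
      f (n + 1) ≪≫ₗ TensorProduct.prodRight R R L _ _ ≪≫ₗ
        LinearEquiv.prodCongr (LinearEquiv.refl R _) (TensorProduct.congr (LinearEquiv.refl R L)
          (TensorProduct.congr (LinearEquiv.refl R L) (e n)))
    have a2 : Q (n + 2) ≃ₗ[R] (L ⊗[R] H (n + 1)) × (L ⊗[R] (L ⊗[R] Q n)) :=
      e (n + 1) ≪≫ₗ f n ≪≫ₗ TensorProduct.prodRight R R L _ _
    exact ⟨LinearEquiv.prodCongr a1 a2 ≪≫ₗ LinearEquiv.prodProdProdComm R _ _ _ _ ≪≫ₗ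
      LinearEquiv.prodCongr (LinearEquiv.refl R _) g' ≪≫ₗ LinearEquiv.prodAssoc R _ _ _ ≪≫ₗ
      (oddPowerSumAddTwo H L n).symm⟩

end Antidiagonal

/-! ### Assembling the recursion for the relative homology -/

section Recursion

variable (k : Type u) [CommRing k] {R : Type u} [CommRing R] [Algebra k R]
  {L : Type u} [AddCommGroup L] [Module R L] [Module Rᵐᵒᵖ L] [IsCentralScalar R L]
  [Module k L] [IsScalarTower k R L] [IsScalarTower k Rᵐᵒᵖ L]
  {ι : Type} [Fintype ι] (x : ι → L) (l : ι → L →ₗ[R] R)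
  (hx : ∀ y, ∑ i, l i y • x i = y) (hl : ∀ i y z, l i y • z = l i z • y)

include hx hl

/-- `SqZeroRetract.Frame.nilEquiv` for the square-zero extension by a module of rank one. -/
def trivNilEquiv (ε ε' : ℤ) (hε : -ε = ε') (n : ℕ) :
    L ⊗[R] (trivRetract R L).projHomology k ε' n ≃ₗ[R] (trivRetract R L).nilHomology k ε n :=
  (trivFrame x l hx hl).nilEquiv k (TrivSqZeroExt.inrHom R L)
    (fun y => by simp [trivRetract_proj]) x (fun _ => rfl) l
    (fun i y => by simp [trivFrame, TrivSqZeroExt.algebraMap_eq_inl]) hx ε ε' hε n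

/-- The antisymmetric nilpotent part is `L` tensored with the Hochschild homology of `R` and a
reduced symmetric part. -/
def trivNilEquivProd (n : ℕ) : (trivRetract R L).nilHomology k (-1) n ≃ₗ[R]
    L ⊗[R] (HH k R R n × (trivRetract R L).reducedHomology k 1 n) :=
  (trivNilEquiv k x l hx hl (-1) 1 rfl n).symm ≪≫ₗ
    TensorProduct.congr (LinearEquiv.refl R L)
      (SqZeroRetract.projEquivProd k (fstAlgHom R L) (fun _ => rfl) n ≪≫ₗ
        LinearEquiv.prodCongr (HHEquiv k n).symm (LinearEquiv.refl R _))

/-- The reduced symmetric part is `L` tensored with the reduced antisymmetric part. -/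
def trivReducedEquiv {c : R} (hc : c + c = 1) (n : ℕ) :
    (trivRetract R L).reducedHomology k 1 (n + 1) ≃ₗ[R]
      L ⊗[R] (trivRetract R L).reducedHomology k (-1) n :=
  SqZeroRetract.reducedEquiv k (trivRetract R L) 1 n ≪≫ₗ
    (trivNilEquiv k x l hx hl 1 (-1) rfl n).symm ≪≫ₗ
      TensorProduct.congr (LinearEquiv.refl R L) (SqZeroRetract.projEquivReduced k hc n)

/-- The relative Hochschild homology of a square-zero extension by a module with a dual basis of
rank one. -/
theorem nonempty_relHH_equiv {c : R} (hc : c + c = 1) (n : ℕ) :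
    Nonempty (relHH k R (TrivSqZeroExt.kerIdeal R L) n ≃ₗ[R]
      antidiagonalSum R (oddPower R L) (fun q => HH k R R q) n) := by
  -- G is the odd homology with head in L and Q the odd reduced homology. The reduced even homology
  -- occurring in G vanishes in degree 0 and is L ⊗ Q_n in degree n + 1.
  obtain ⟨g⟩ := nonempty_prod_equiv_oddPowerSum (fun q => HH k R R q) L
    (fun n => (trivRetract R L).nilHomology k (-1) n)
    (fun n => (trivRetract R L).reducedHomology k (-1) n)
    (SqZeroRetract.subsingleton_reducedHomology_zero k _ _)
    (SqZeroRetract.reducedEquiv k (trivRetract R L) (-1))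
    (trivNilEquivProd k x l hx hl 0 ≪≫ₗ TensorProduct.congr (LinearEquiv.refl R L)
      (prodEquivOfSubsingleton (SqZeroRetract.subsingleton_reducedHomology_zero k _ _)))
    (fun n => trivNilEquivProd k x l hx hl (n + 1) ≪≫ₗ
      TensorProduct.congr (LinearEquiv.refl R L)
        (LinearEquiv.prodCongr (LinearEquiv.refl R _) (trivReducedEquiv k x l hx hl hc n))) n
  exact ⟨relHHEquivKerHomology R L k n ≪≫ₗ (trivFrame x l hx hl).kerEquiv k hc n ≪≫ₗ
    LinearEquiv.prodCongr (LinearEquiv.refl R _) (SqZeroRetract.projEquivReduced k hc n) ≪≫ₗ g⟩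

end Recursion

end Hochschild

end

theorem mainTheorem10 (k : Type u) [Field k] (hk : ringChar k ≠ 2)
    (R : Type u) [CommRing R] [Algebra k R]
    (L : Type u) [AddCommGroup L] [Module R L] [Module Rᵐᵒᵖ L] [IsCentralScalar R L]
    [Module k L] [IsScalarTower k R L] [IsScalarTower k Rᵐᵒᵖ L]
    [Module.Finite R L] [Module.Projective R L]
    (hL : ∀ P : PrimeSpectrum R, Module.rankAtStalk L P = 1) (n : ℕ) :
    Nonempty (Hochschild.relHH k R (TrivSqZeroExt.kerIdeal R L) n ≃ₗ[R]
      ⨁ pq : Finset.HasAntidiagonal.antidiagonal n,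
        Hochschild.oddPower R L pq.1.1 ⊗[R] Hochschild.HH k R R pq.1.2) := by
  -- L is a retract of R^m. The images of the standard basis and the coordinates of the section g
  -- form a dual basis, and c is the image of 1/2 in R.
  obtain ⟨m, f, g, -, -, hfg⟩ := Module.Finite.exists_comp_eq_id_of_projective R L
  refine Hochschild.nonempty_relHH_equiv k (fun i => f (Pi.single i 1))
    (fun i => LinearMap.proj i ∘ₗ g) (fun y => ?_)
    (fun i => Hochschild.smul_comm_of_rankAtStalk_eq_one hL _)
    (c := algebraMap k R 2⁻¹) ?_ n
  · conv_rhs => rw [← LinearMap.id_apply (R := R) y, ← hfg, LinearMap.comp_apply,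
      pi_eq_sum_univ' (g y), map_sum]
    simp only [map_smul]
    rfl
  · rw [← map_add, ← two_mul, mul_inv_cancel₀ (Ring.two_ne_zero hk), map_one]
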